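/- Let $A$ be an infinite Boolean algebra. Ideals of $A$ may be improper ($A$ itself is allowed) or $\{0\}$; an ideal $I$ is dense if every nonzero element of $A$ lies above a nonzero element of $I$. A homomorphism from an ideal $I$ onto an ideal $J$ is a surjective map $f\colon I\to J$ with $f(0)=0$, $f(x\cup y)=f(x)\cup f(y)$ and $f(x\cap y)=f(x)\cap f(y)$. Two such maps are identified only if they have the same domain and the same values. Let - $\mathrm{id}(A)$ and $\mathrm{sub}(A)$ be the number of ideals and of subalgebras of $A$; - $\mathrm{End}_2(A)$ be the set of surjective Boolean endomorphisms of $A$; - $\mathrm{End}_3(A)$ be the set of all homomorphisms from some dense ideal $I$ of $A$ onto $I$ itself; - $\mathrm{End}_4(A)$ be the set of all homomorphisms from some ideal $I$ of $A$ onto $I$ itself; - $\mathrm{End}_5(A)$ be the set of all homomorphisms from some dense ideal of $A$ onto some dense ideal of $A$; - $\mathrm{End}_6(A)$ be the set of all homomorphisms from some ideal of $A$ onto some ideal of $A$; - $\mathrm{Aut}_3(A)$ be the set of $f\in\mathrm{End}_3(A)$ such that $f(x)=0\Leftrightarrow x=0$ for all $x$ in the domain of $f$; - $\mathrm{end}_e(A)=|\mathrm{End}_e(A)|$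 and $\mathrm{aut}_3(A)=|\mathrm{Aut}_3(A)|$. Then: 1. $\mathrm{end}_e(A)=\mathrm{id}(A)+\mathrm{aut}_3(A)$ for $e=3,4,5,6$. 2. $\mathrm{end}_6(A)^{\aleph_0}\le \mathrm{sub}(A)$. 3. $\mathrm{end}_e(A)^{\aleph_0}\le \mathrm{sub}(A)$ for $e=2,3,4,5,6$. -/

import Mathlib

open Cardinal

namespace ShelahBA

/-- An ideal of a Boolean algebra (possibly improper, possibly `{⊥}`) is dense if below every
nonzero element of the algebra there is a nonzero element of the ideal. -/
def DenseIdeal {A : Type*} [BooleanAlgebra A] (I : Order.Ideal A) : Prop :=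
  ∀ x : A, x ≠ ⊥ → ∃ y ∈ I, y ≠ ⊥ ∧ y ≤ x

/-- The partial function `f` is a homomorphism of the ideal `I` onto the ideal `J`: its domain is
`I`, its range is `J`, it preserves `⊥` and commutes with `⊔` and `⊓`. (Complements are not
mentioned, since an ideal need not be closed under them.) -/
structure IsHomOnto {A : Type*} [BooleanAlgebra A] (f : A →. A) (I J : Order.Ideal A) : Prop where
  dom_eq : f.Dom = (I : Set A)
  ran_eq : f.ran = (J : Set A)
  map_bot : ⊥ ∈ f ⊥
  map_sup : ∀ x y a b : A, a ∈ f x → b ∈ f y → a ⊔ b ∈ f (x ⊔ y)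
  map_inf : ∀ x y a b : A, a ∈ f x → b ∈ f y → a ⊓ b ∈ f (x ⊓ y)

/-- Endomorphisms of the Boolean algebra `A` that are onto. A bounded lattice homomorphism between
Boolean algebras is the same as a Boolean homomorphism. -/
def End₂ (A : Type*) [BooleanAlgebra A] : Set (A →. A) :=
  {f | ∃ g : BoundedLatticeHom A A, Function.Surjective g ∧ f = ((g : A → A) : A →. A)}

/-- Endomorphisms of some dense ideal `I`, onto `I`. -/
def End₃ (A : Type*) [BooleanAlgebra A] : Set (A →. A) :=
  {f | ∃ I : Order.Ideal A, DenseIdeal I ∧ IsHomOnto f I I}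

/-- Endomorphisms of some ideal `I`, onto `I`. -/
def End₄ (A : Type*) [BooleanAlgebra A] : Set (A →. A) :=
  {f | ∃ I : Order.Ideal A, IsHomOnto f I I}

/-- Homomorphisms of some dense ideal onto some dense ideal. -/
def End₅ (A : Type*) [BooleanAlgebra A] : Set (A →. A) :=
  {f | ∃ I J : Order.Ideal A, DenseIdeal I ∧ DenseIdeal J ∧ IsHomOnto f I J}

/-- Homomorphisms of some ideal onto some ideal. -/
def End₆ (A : Type*) [BooleanAlgebra A] : Set (A →. A) :=
  {f | ∃ I J : Order.Ideal A, IsHomOnto f I J}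

/-- The members `f` of `End₃ A` such that `f x = ⊥` iff `x = ⊥`, for `x` in the domain of `f`. -/
def Aut₃ (A : Type*) [BooleanAlgebra A] : Set (A →. A) :=
  {f | f ∈ End₃ A ∧ ∀ x ∈ f.Dom, (⊥ ∈ f x ↔ x = ⊥)}

end ShelahBA

-- Write id, sub, end_e, aut for the cardinals in question and work in the Stone space of A.
--
-- Equalities. All four sets lie between `End₃` and `End₆`. A homomorphism f of I onto J is
-- determined by I, J, its kernel and an automorphism of the dense ideal J + J^⊥: compare f with a
-- fixed f₀ having the same data, and send f₀ x ⊔ k to f x ⊔ k. Hence end₆ ≤ id³ · aut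
-- (`mk_end₆_le`). Conversely aut ≤ end₃ is clear, and id ≤ end₃ (`mk_ideal_le_end₃`): an ideal is
-- coded by two dense ideals and a choice of one element below each member of a partition; such
-- choices are counted by dense ideals and sets of atoms; dense ideals have their identity maps, and
-- permutations of the atoms act on a dense ideal.
--
-- Powers. By the equality for `End₆` it remains to treat id and aut.
--
-- For id (`mk_ideal_power_le_sub`), suppose sub < id^ℵ₀ and let μ be least with id ≤ μ^ℵ₀. Then μ
-- has countable cofinality, and sub < μ^ℵ₀. Let Y be a smallest set of points with at least μ
-- relatively closed subsets, and L least with μ ≤ 2^L. If μ ≤ |Y|, there are disjoint clopen sets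
-- with many points, and deleting one point from each gives μ^ℵ₀ ideals. If |Y| < μ ≤ |Y|^κ for some
-- κ < L, some closed set has a long sequence of points that are limits of its complement in a
-- strong sense; independent choices near them give χ^κ ideals for some χ with μ ≤ χ^κ, and χ^κ is
-- its own ℵ₀-th power. Otherwise sub < 2^L, so subspaces have density below L: large density would
-- give 2^L subalgebras (`two_power_le_sub`). As closed sets are determined by dense subsets, Y has
-- fewer than μ of them; the delicate case, L of countable cofinality, is `exists_le_mk_denseIn`.
--
-- For aut (`mk_aut₃_power_le_sub`), take a maximal disjoint family of elements that are homogeneous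
-- for the number of subrings below them, and let q be the product of these numbers. Homogeneity and
-- the result on id give q^ℵ₀ ≤ sub. An automorphism of a dense ideal is given by the ideal, the
-- image of a partition (at most id possibilities) and isomorphisms between the pieces; a relative
-- algebra with s subrings has at most s^7 automorphisms. So aut ≤ id² · q^7.

universe u

namespace ShelahBA

/-! ### Stone duality by prime ideals; ideals from open sets -/

section Points

variable {A : Type u} [BooleanAlgebra A]

/-- The ideal with a given carrier. -/
def mkIdeal (S : Set A) (h0 : ⊥ ∈ S) (hl : ∀ x y, y ≤ x → x ∈ S → y ∈ S)
    (hs : ∀ x y, x ∈ S → y ∈ S → x ⊔ y ∈ S) : Order.Ideal A where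
  carrier := S
  lower' := fun x y h hx => hl x y h hx
  nonempty' := ⟨⊥, h0⟩
  directed' := fun x hx y hy => ⟨x ⊔ y, hs x y hx hy, le_sup_left, le_sup_right⟩

theorem ideal_mem_of_le {I : Order.Ideal A} {x y : A} (h : y ≤ x) (hx : x ∈ I) : y ∈ I :=
  I.lower h hx

/-- Points of the Stone space, as prime ideals. -/
def Pt (A : Type u) [BooleanAlgebra A] : Type u := {P : Order.Ideal A // P.IsPrime}

/-- The clopen set of an element. -/
def pts (a : A) : Set (Pt A) := {x | a ∉ x.1}

theorem mem_pts {a : A} {x : Pt A} : x ∈ pts a ↔ a ∉ x.1 := Iff.rfl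

@[simp] theorem mem_pts_inf {a b : A} {x : Pt A} : x ∈ pts (a ⊓ b) ↔ x ∈ pts a ∧ x ∈ pts b := by
  simp only [mem_pts]
  constructor
  · intro h
    exact ⟨fun ha => h (ideal_mem_of_le inf_le_left ha),
      fun hb => h (ideal_mem_of_le inf_le_right hb)⟩
  · rintro ⟨ha, hb⟩ h
    rcases x.2.mem_or_mem h with h | h
    · exact ha h
    · exact hb h

@[simp] theorem mem_pts_sup {a b : A} {x : Pt A} : x ∈ pts (a ⊔ b) ↔ x ∈ pts a ∨ x ∈ pts b := by
  simp only [mem_pts, Order.Ideal.sup_mem_iff]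
  tauto

@[simp] theorem not_mem_pts_bot {x : Pt A} : x ∉ pts (⊥ : A) := by
  simp [mem_pts]

@[simp] theorem mem_pts_top {x : Pt A} : x ∈ pts (⊤ : A) :=
  x.2.toIsProper.top_notMem

@[simp] theorem mem_pts_compl {a : A} {x : Pt A} : x ∈ pts aᶜ ↔ x ∉ pts a := by
  constructor
  · intro h h'
    have : x ∈ pts (a ⊓ aᶜ) := mem_pts_inf.2 ⟨h', h⟩
    simp at this
  · intro h
    have : x ∈ pts (a ⊔ aᶜ) := by simp
    rcases mem_pts_sup.1 this with h1 | h1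
    · exact absurd h1 h
    · exact h1

@[simp] theorem mem_pts_sdiff {a b : A} {x : Pt A} : x ∈ pts (a \ b) ↔ x ∈ pts a ∧ x ∉ pts b := by
  rw [sdiff_eq, mem_pts_inf, mem_pts_compl]

theorem pts_mono {a b : A} (h : a ≤ b) : pts a ⊆ pts b := by
  intro x hx hb
  exact hx (ideal_mem_of_le h hb)

/-- An element outside an ideal contains a point outside the open set of the ideal. -/
theorem exists_pt_of_notMem {I : Order.Ideal A} {a : A} (h : a ∉ I) :
    ∃ x ∈ pts a, ∀ b ∈ I, x ∉ pts b := by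
  have hd : Disjoint ((Order.PFilter.principal a : Order.PFilter A) : Set A) (I : Set A) := by
    rw [Set.disjoint_left]
    intro b hb hI
    exact h (ideal_mem_of_le (Order.PFilter.mem_principal.1 hb) hI)
  obtain ⟨J, hJ, hIJ, hJd⟩ := DistribLattice.prime_ideal_of_disjoint_filter_ideal hd
  refine ⟨⟨J, hJ⟩, fun ha => ?_, fun b hb hx => hx (hIJ hb)⟩
  exact Set.disjoint_left.1 hJd (show a ∈ Order.PFilter.principal a from
    Order.PFilter.mem_principal.2 le_rfl) ha

theorem le_of_pts_subset {a b : A} (h : pts a ⊆ pts b) : a ≤ b := by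
  by_contra hn
  obtain ⟨x, hx, hb⟩ := exists_pt_of_notMem (I := Order.Ideal.principal b) (a := a)
    (by simpa using hn)
  exact hb b (by simp) (h hx)

theorem pts_injective : Function.Injective (pts : A → Set (Pt A)) := fun _ _ h =>
  le_antisymm (le_of_pts_subset h.le) (le_of_pts_subset h.ge)

theorem exists_pt {a : A} (h : a ≠ ⊥) : ∃ x, x ∈ pts a := by
  by_contra hn
  push Not at hn
  exact h (le_bot_iff.1 (le_of_pts_subset fun x hx => absurd hx (hn x)))

theorem inf_eq_bot_of_pts {a b : A} (h : ∀ x ∈ pts a, x ∉ pts b) : a ⊓ b = ⊥ := by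
  by_contra hn
  obtain ⟨x, hx⟩ := exists_pt hn
  rw [mem_pts_inf] at hx
  exact h x hx.1 hx.2

theorem exists_separating {x y : Pt A} (h : x ≠ y) : ∃ a, x ∈ pts a ∧ y ∉ pts a := by
  have : x.1 ≠ y.1 := fun h' => h (Subtype.ext h')
  by_contra hn
  push Not at hn
  apply this
  apply SetLike.ext
  intro a
  constructor
  · intro ha
    by_contra hy
    have h1 : x ∈ pts aᶜ := by rw [mem_pts_compl]; exact fun h => h ha
    have h2 := hn _ h1
    rw [mem_pts_compl] at h2
    exact h2 hy
  · intro ha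
    by_contra hx
    exact hn a hx ha

/-- `U` is open in the Stone space. -/
def IsOp (U : Set (Pt A)) : Prop := ∀ x ∈ U, ∃ a, x ∈ pts a ∧ pts a ⊆ U

/-- The ideal of clopen subsets of a set of points. -/
def idealOf (U : Set (Pt A)) : Order.Ideal A :=
  mkIdeal {a | pts a ⊆ U} (fun _ hx => absurd hx not_mem_pts_bot)
    (fun _ _ h hx => (pts_mono h).trans hx)
    (fun _ _ hx hy _ hz => (mem_pts_sup.1 hz).elim (fun h => hx h) fun h => hy h)

theorem mem_idealOf {U : Set (Pt A)} {a : A} : a ∈ idealOf U ↔ pts a ⊆ U := Iff.rfl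

theorem idealOf_inj {U V : Set (Pt A)} (hU : IsOp U) (hV : IsOp V) (h : idealOf U = idealOf V) :
    U = V := by
  ext x
  constructor
  · intro hx
    obtain ⟨a, ha, hs⟩ := hU x hx
    have : a ∈ idealOf V := h ▸ mem_idealOf.2 hs
    exact this ha
  · intro hx
    obtain ⟨a, ha, hs⟩ := hV x hx
    have : a ∈ idealOf U := h ▸ mem_idealOf.2 hs
    exact this ha

theorem isOp_iUnion_pts {ι : Sort*} (e : ι → A) : IsOp (⋃ i, pts (e i)) := by
  intro x hx
  obtain ⟨i, hi⟩ := Set.mem_iUnion.1 hx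
  exact ⟨e i, hi, Set.subset_iUnion (fun i => pts (e i)) i⟩

theorem isOp_diff_singleton (a : A) (y : Pt A) : IsOp (pts a \ {y}) := by
  rintro x ⟨hx, hy⟩
  obtain ⟨b, hb, hb'⟩ := exists_separating (x := x) (y := y) hy
  refine ⟨a ⊓ b, mem_pts_inf.2 ⟨hx, hb⟩, fun z hz => ?_⟩
  rw [mem_pts_inf] at hz
  exact ⟨hz.1, fun h => hb' (by rw [Set.mem_singleton_iff] at h; exact h ▸ hz.2)⟩

theorem isOp_iUnion {ι : Sort*} {U : ι → Set (Pt A)} (h : ∀ i, IsOp (U i)) : IsOp (⋃ i, U i) := by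
  intro x hx
  obtain ⟨i, hi⟩ := Set.mem_iUnion.1 hx
  obtain ⟨a, ha, hs⟩ := h i x hi
  exact ⟨a, ha, hs.trans (Set.subset_iUnion U i)⟩

/-- Independent choices of points in separated sets give different ideals. -/
theorem exists_injective_pi_ideal {ι : Type*} (e : ι → A) (G : ι → Set (Pt A))
    (hG : ∀ i, G i ⊆ pts (e i)) (hd : ∀ i j, i ≠ j → Disjoint (G i) (pts (e j))) :
    ∃ f : (∀ i, G i) → Order.Ideal A, Function.Injective f := by
  refine ⟨fun y => idealOf (⋃ i, (pts (e i) \ {(y i).1})), fun y y' h => ?_⟩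
  have h1 := idealOf_inj (isOp_iUnion fun i => isOp_diff_singleton _ _)
    (isOp_iUnion fun i => isOp_diff_singleton _ _) h
  funext i
  by_contra hne
  have h2 : (y i).1 ∈ ⋃ i, (pts (e i) \ {(y' i).1}) :=
    Set.mem_iUnion.2 ⟨i, hG i (y i).2, fun h => hne (Subtype.ext h)⟩
  rw [← h1] at h2
  obtain ⟨j, hj1, hj2⟩ := Set.mem_iUnion.1 h2
  by_cases hij : i = j
  · subst hij; exact hj2 rfl
  · exact Set.disjoint_left.1 (hd i j hij) (y i).2 hj1

/-- Relatively closed subsets of a set of points. -/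
def IsCl (Y F : Set (Pt A)) : Prop :=
  F ⊆ Y ∧ ∀ z ∈ Y, z ∉ F → ∃ a, z ∈ pts a ∧ Disjoint (pts a) F

/-- The type of relatively closed subsets. -/
def Cl (Y : Set (Pt A)) : Type u := {F : Set (Pt A) // IsCl Y F}

theorem IsCl.inter {Y Z F : Set (Pt A)} (h : IsCl Y F) (hZ : Z ⊆ Y) : IsCl Z (F ∩ Z) := by
  refine ⟨Set.inter_subset_right, fun z hz hF => ?_⟩
  obtain ⟨a, ha, hd⟩ := h.2 z (hZ hz) (fun h => hF ⟨h, hz⟩)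
  exact ⟨a, ha, hd.mono_right Set.inter_subset_left⟩

/-- Restriction to Z is onto: a relatively closed subset of Z is the trace of its closure in Y. -/
theorem mk_Cl_mono {Y Z : Set (Pt A)} (hZ : Z ⊆ Y) : #(Cl Z) ≤ #(Cl Y) := by
  refine Cardinal.mk_le_of_surjective (f := fun F : Cl Y => (⟨F.1 ∩ Z, F.2.inter hZ⟩ : Cl Z)) ?_
  rintro ⟨F, hF⟩
  refine ⟨⟨{z ∈ Y | ∀ a, z ∈ pts a → (pts a ∩ F).Nonempty}, fun z hz => hz.1, fun z hz hn => ?_⟩, ?_⟩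
  · have hn' : ¬ ∀ a, z ∈ pts a → (pts a ∩ F).Nonempty := fun h => hn ⟨hz, h⟩
    push Not at hn'
    obtain ⟨a, ha, hF'⟩ := hn'
    refine ⟨a, ha, Set.disjoint_left.2 fun w hw hw' => ?_⟩
    have := hw'.2 a hw
    rw [hF'] at this
    exact Set.not_nonempty_empty this
  · apply Subtype.ext
    ext z
    constructor
    · rintro ⟨⟨_, h2⟩, h3⟩
      by_contra hn
      obtain ⟨a, ha, hd⟩ := hF.2 z h3 hn
      obtain ⟨w, hw⟩ := h2 a ha
      exact Set.disjoint_left.1 hd hw.1 hw.2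
    · intro hz
      exact ⟨⟨hZ (hF.1 hz), fun a ha => ⟨z, ha, hz⟩⟩, hF.1 hz⟩

theorem mk_ideal_le_Cl : #(Order.Ideal A) ≤ #(Cl (Set.univ : Set (Pt A))) := by
  refine Cardinal.mk_le_of_injective
    (f := fun I : Order.Ideal A => ⟨{x | ∀ a ∈ I, x ∉ pts a}, Set.subset_univ _, ?_⟩) ?_
  · intro z _ hz
    simp only [Set.mem_ofPred_eq, not_forall, not_not] at hz
    obtain ⟨a, ha, hz⟩ := hz
    exact ⟨a, hz, Set.disjoint_left.2 fun x hx h => h a ha hx⟩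
  · intro I J h
    have h1 : {x : Pt A | ∀ a ∈ I, x ∉ pts a} = {x | ∀ a ∈ J, x ∉ pts a} := congrArg Subtype.val h
    apply SetLike.ext
    intro a
    constructor
    · intro ha
      by_contra hn
      obtain ⟨x, hx, hb⟩ := exists_pt_of_notMem hn
      have : x ∈ {x : Pt A | ∀ a ∈ I, x ∉ pts a} := h1 ▸ hb
      exact this a ha hx
    · intro ha
      by_contra hn
      obtain ⟨x, hx, hb⟩ := exists_pt_of_notMem hn
      have : x ∈ {x : Pt A | ∀ a ∈ J, x ∉ pts a} := h1 ▸ hb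
      exact this a ha hx

theorem infinite_pt [Infinite A] : Infinite (Pt A) := by
  by_contra h
  rw [not_infinite_iff_finite] at h
  have := Finite.of_injective _ (pts_injective (A := A))
  exact not_finite A

/-- From a decreasing sequence of infinite sets of points one can pick points with pairwise
disjoint clopen neighbourhoods. -/
theorem exists_disjoint_clopens (S : ℕ → Set (Pt A)) (hS : Antitone S) (hi : ∀ n, (S n).Infinite) :
    ∃ (x : ℕ → Pt A) (a : ℕ → A), (∀ n, x n ∈ S n) ∧ (∀ n, x n ∈ pts (a n)) ∧
      ∀ m n, m ≠ n → Disjoint (pts (a m)) (pts (a n)) := by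
  classical
  -- The remainder r still to be used must meet every S m in an infinite set. Split it between two
  -- of its points in S n: as S decreases, one half is again such a remainder, and the other half is
  -- the neighbourhood of the point it contains.
  let R := {r : A // ∀ m, (pts r ∩ S m).Infinite}
  have step : ∀ (r : R) (n : ℕ), ∃ (s : R) (y : Pt A) (b : A), y ∈ S n ∧ y ∈ pts b ∧ b ≤ r.1 ∧
      s.1 ≤ r.1 ∧ b ⊓ s.1 = ⊥ := by
    rintro ⟨r, hr⟩ n
    obtain ⟨p, hp, q, hq, hpq⟩ := (hr n).nontrivial
    obtain ⟨a, hpa, hqa⟩ := exists_separating hpq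
    by_cases h : ∀ m, (pts (r \ a) ∩ S m).Infinite
    · refine ⟨⟨r \ a, h⟩, p, r ⊓ a, hp.2, mem_pts_inf.2 ⟨hp.1, hpa⟩, inf_le_left, sdiff_le, ?_⟩
      apply inf_eq_bot_of_pts
      intro x; simp only [mem_pts_inf, mem_pts_sdiff]; tauto
    · push Not at h
      obtain ⟨m, hm⟩ := h
      refine ⟨⟨r ⊓ a, fun k => ?_⟩, q, r \ a, hq.2, mem_pts_sdiff.2 ⟨hq.1, hqa⟩, sdiff_le,
        inf_le_left, ?_⟩
      · intro hk
        apply hr (max m k)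
        refine (Set.Finite.union hm hk).subset ?_
        rintro x ⟨hx, hx'⟩
        by_cases hxa : x ∈ pts a
        · exact Or.inr ⟨mem_pts_inf.2 ⟨hx, hxa⟩, hS (le_max_right m k) hx'⟩
        · exact Or.inl ⟨mem_pts_sdiff.2 ⟨hx, hxa⟩, hS (le_max_left m k) hx'⟩
      · apply inf_eq_bot_of_pts
        intro x; simp only [mem_pts_inf, mem_pts_sdiff]; tauto
  choose s y b h1 h2 h3 h4 h5 using step
  let r : ℕ → R := fun n => Nat.rec ⟨⊤, fun m => by
    have : pts (⊤ : A) = Set.univ := Set.eq_univ_of_forall fun x => mem_pts_top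
    rw [this, Set.univ_inter]; exact hi m⟩ (fun n r => s r n) n
  have hr : ∀ n, r (n + 1) = s (r n) n := fun n => rfl
  have hanti : Antitone fun n => (r n).1 := antitone_nat_of_succ_le fun n => by rw [hr]; exact h4 _ _
  have hdis : ∀ m n, m < n → Disjoint (pts (b (r m) m)) (pts (b (r n) n)) := by
    intro m n hmn
    rw [Set.disjoint_left]
    intro z hz hz'
    have e1 : z ∈ pts (r (m + 1)).1 := pts_mono ((h3 (r n) n).trans (hanti hmn)) hz'
    rw [hr] at e1
    have : z ∈ pts (b (r m) m ⊓ (s (r m) m).1) := mem_pts_inf.2 ⟨hz, e1⟩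
    rw [h5] at this
    exact not_mem_pts_bot this
  refine ⟨fun n => y (r n) n, fun n => b (r n) n, fun n => h1 _ _, fun n => h2 _ _, ?_⟩
  intro m n hmn
  rcases lt_or_gt_of_ne hmn with h | h
  · exact hdis m n h
  · exact (hdis n m h).symm

/-- Sets of indices of disjoint nonzero elements give different ideals. -/
theorem exists_injective_set_ideal {ι : Type*} (a : ι → A) (h0 : ∀ i, a i ≠ ⊥)
    (hd : ∀ i j, i ≠ j → Disjoint (pts (a i)) (pts (a j))) :
    ∃ f : Set ι → Order.Ideal A, Function.Injective f := by
  refine ⟨fun s => idealOf (⋃ i : s, pts (a i)), fun s t h => ?_⟩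
  have h1 := idealOf_inj (isOp_iUnion_pts _) (isOp_iUnion_pts _) h
  have key : ∀ s t : Set ι, (⋃ i : s, pts (a i)) ⊆ ⋃ i : t, pts (a i) → s ⊆ t := by
    intro s t h i hi
    obtain ⟨x, hx⟩ := exists_pt (h0 i)
    obtain ⟨⟨j, hj⟩, hxj⟩ := Set.mem_iUnion.1 (h (Set.mem_iUnion.2 ⟨⟨i, hi⟩, hx⟩))
    by_cases hij : i = j
    · exact hij ▸ hj
    · exact absurd hxj (Set.disjoint_left.1 (hd i j hij) hx)
  exact Set.Subset.antisymm (key _ _ h1.le) (key _ _ h1.ge)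

theorem exists_infinite_disjoint [Infinite A] :
    ∃ a : ℕ → A, (∀ n, a n ≠ ⊥) ∧ ∀ m n, m ≠ n → Disjoint (pts (a m)) (pts (a n)) := by
  have := infinite_pt (A := A)
  obtain ⟨x, a, -, h2, h3⟩ := exists_disjoint_clopens (A := A) (fun _ => Set.univ)
    (fun _ _ _ => le_rfl) fun _ => Set.infinite_univ
  refine ⟨a, fun n h => ?_, h3⟩
  have := h2 n
  rw [h] at this
  exact not_mem_pts_bot this

theorem continuum_le_mk_ideal [Infinite A] : (2 : Cardinal.{u}) ^ (ℵ₀ : Cardinal.{u}) ≤ #(Order.Ideal A) := by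
  obtain ⟨a, h0, hd⟩ := exists_infinite_disjoint (A := A)
  obtain ⟨f, hf⟩ := exists_injective_set_ideal a h0 hd
  have := Cardinal.mk_le_of_injective (hf.comp Equiv.ulift.{u}.injective)
  simpa using this

end Points

/-- Construction of a function by well-founded recursion. -/
theorem exists_rec_choice {ι : Type*} [LinearOrder ι] [WellFoundedLT ι] {α : Type*}
    [Nonempty α] (P : ι → (ι → α) → α → Prop)
    (hloc : ∀ i f g a, (∀ j < i, f j = g j) → P i f a → P i g a)
    (hex : ∀ i f, (∀ j < i, P j f (f j)) → ∃ a, P i f a) : ∃ f, ∀ i, P i f (f i) := by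
  classical
  obtain ⟨a0⟩ := ‹Nonempty α›
  let F : ∀ i, (∀ j, j < i → α) → α := fun i g =>
    if h : ∃ a, P i (fun j => if hj : j < i then g j hj else a0) a then h.choose else a0
  let f : ι → α := (wellFounded_lt (α := ι)).fix F
  have hf : ∀ i, f i = F i (fun j _ => f j) := fun i => (wellFounded_lt (α := ι)).fix_eq F i
  refine ⟨f, fun i => ?_⟩
  induction i using (wellFounded_lt (α := ι)).induction with
  | _ i ih =>
    have h1 : ∃ a, P i (fun j => if hj : j < i then f j else a0) a := by
      obtain ⟨a, ha⟩ := hex i f ih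
      exact ⟨a, hloc i _ _ a (fun j hj => by simp [hj]) ha⟩
    rw [hf i]
    simp only [F]
    rw [dif_pos h1]
    exact hloc i _ _ _ (fun j hj => by simp [hj]) h1.choose_spec

end ShelahBA
namespace ShelahBA

theorem mk_Iio_toType {c : Cardinal.{u}} (i : c.ord.ToType) : #(Set.Iio i) < c := by
  simpa using Cardinal.mk_Iio_lt i (by simp)

/-! ### Lower bounds for the number of subalgebras -/

section Subalgebras

variable {A : Type u} [BooleanAlgebra A]

/-- Successive stages of the generation of a Boolean subalgebra. -/
def genStage (s : Set A) : ℕ → Set A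
  | 0 => insert ⊥ s
  | n + 1 => genStage s n ∪ Set.image2 (· ⊔ ·) (genStage s n) (genStage s n) ∪
      compl '' genStage s n

theorem genStage_mono (s : Set A) : Monotone (genStage s) :=
  monotone_nat_of_le_succ fun _ _ hx => Or.inl (Or.inl hx)

theorem mk_genStage_le (s : Set A) (n : ℕ) : #(genStage s n) ≤ max #s ℵ₀ := by
  have hinf : ℵ₀ ≤ max #s ℵ₀ := le_max_right _ _
  induction n with
  | zero =>
    refine (Cardinal.mk_insert_le).trans ?_
    exact add_le_of_le hinf (le_max_left _ _) (one_le_aleph0.trans hinf)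
  | succ n ih =>
    refine (mk_union_le _ _).trans (add_le_of_le hinf ((mk_union_le _ _).trans
      (add_le_of_le hinf ih ?_)) (mk_image_le.trans ih))
    rw [← Set.image_prod]
    refine mk_image_le.trans ?_
    have : #(↥(genStage s n ×ˢ genStage s n)) = #(genStage s n) * #(genStage s n) := by
      rw [mk_setProd]
    rw [this]
    exact (mul_le_mul' ih ih).trans (mul_eq_self hinf).le

theorem closure_subset_genStage (s : Set A) :
    (BooleanSubalgebra.closure s : Set A) ⊆ ⋃ n, genStage s n := by
  intro x (hx : x ∈ BooleanSubalgebra.closure s)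
  induction hx using BooleanSubalgebra.closure_bot_sup_induction with
  | mem x hx => exact Set.mem_iUnion.2 ⟨0, Or.inr hx⟩
  | bot => exact Set.mem_iUnion.2 ⟨0, Or.inl rfl⟩
  | sup x hx y hy h1 h2 =>
    obtain ⟨m, hm⟩ := Set.mem_iUnion.1 h1
    obtain ⟨n, hn⟩ := Set.mem_iUnion.1 h2
    refine Set.mem_iUnion.2 ⟨max m n + 1, Or.inl (Or.inr ⟨x, ?_, y, ?_, rfl⟩)⟩
    · exact genStage_mono s (le_max_left m n) hm
    · exact genStage_mono s (le_max_right m n) hn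
  | compl x hx h =>
    obtain ⟨m, hm⟩ := Set.mem_iUnion.1 h
    exact Set.mem_iUnion.2 ⟨m + 1, Or.inr ⟨x, hm, rfl⟩⟩

theorem mk_closure_le (s : Set A) : #(BooleanSubalgebra.closure s) ≤ max #s ℵ₀ := by
  have h1 : #(BooleanSubalgebra.closure s) ≤ #(↥(⋃ n, genStage s n)) :=
    mk_le_mk_of_subset (closure_subset_genStage s)
  refine h1.trans ?_
  have h2 : (⋃ n, genStage s n) = ⋃ n : ULift.{u} ℕ, genStage s n.down := by
    ext x; simp
  rw [h2]
  refine (mk_iUnion_le _).trans ?_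
  have h3 : ⨆ i : ULift.{u} ℕ, #(genStage s i.down) ≤ max #s ℵ₀ :=
    ciSup_le' fun i => mk_genStage_le s _
  refine (mul_le_mul' (b := ℵ₀) (by simp) h3).trans ?_
  exact (mul_le_mul' (le_max_right #s ℵ₀) le_rfl).trans (mul_eq_self (le_max_right _ _)).le

/-- The subalgebra of all elements that do not separate two given points. -/
def gluing (x y : Pt A) : BooleanSubalgebra A where
  carrier := {a | x ∈ pts a ↔ y ∈ pts a}
  supClosed' := fun a ha b hb => by
    simp only [Set.mem_ofPred_eq, mem_pts_sup] at *
    rw [ha, hb]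
  infClosed' := fun a ha b hb => by
    simp only [Set.mem_ofPred_eq, mem_pts_inf] at *
    rw [ha, hb]
  compl_mem' := fun {a} ha => by
    simp only [Set.mem_ofPred_eq, mem_pts_compl] at *
    rw [ha]
  bot_mem' := by simp

theorem mem_gluing {x y : Pt A} {a : A} : a ∈ gluing x y ↔ (x ∈ pts a ↔ y ∈ pts a) := Iff.rfl

/-- With x0 fixed, the gluing of x to x0 determines x: an element containing x but neither y nor x0
belongs to the gluing of y only. -/
theorem mk_pt_le_sub [Infinite A] : #(Pt A) ≤ #(BooleanSubalgebra A) := by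
  have := infinite_pt (A := A)
  obtain ⟨x0⟩ : Nonempty (Pt A) := inferInstance
  have key : ∀ x y : Pt A, x ≠ y → x ≠ x0 → gluing x x0 ≠ gluing y x0 := by
    intro x y hxy hx h
    obtain ⟨a, ha, ha'⟩ := exists_separating hxy
    obtain ⟨b, hb, hb'⟩ := exists_separating hx
    have h1 : a ⊓ b ∈ gluing y x0 := by
      rw [mem_gluing]; simp [ha', hb']
    rw [← h, mem_gluing] at h1
    simp [ha, hb, hb'] at h1
  refine Cardinal.mk_le_of_injective (f := fun x => gluing x x0) fun x y h => ?_
  by_contra hne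
  by_cases hx : x = x0
  · exact key y x (Ne.symm hne) (fun h' => hne (hx.trans h'.symm)) h.symm
  · exact key x y hne hx h

theorem aleph0_le_sub [Infinite A] : ℵ₀ ≤ #(BooleanSubalgebra A) := by
  have := infinite_pt (A := A)
  exact (Cardinal.infinite_iff.1 this).trans mk_pt_le_sub

/-- `R` is a subring of the relative algebra below `a`. -/
structure IsSubring (a : A) (R : Set A) : Prop where
  bot_mem : ⊥ ∈ R
  le : ∀ x ∈ R, x ≤ a
  sup_mem : ∀ x ∈ R, ∀ y ∈ R, x ⊔ y ∈ R
  sdiff_mem : ∀ x ∈ R, ∀ y ∈ R, x \ y ∈ R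

theorem IsSubring.inf_mem {a : A} {R : Set A} (h : IsSubring a R) {x y : A} (hx : x ∈ R)
    (hy : y ∈ R) : x ⊓ y ∈ R := by
  have := h.sdiff_mem x hx _ (h.sdiff_mem x hx y hy)
  rwa [sdiff_sdiff_right_self] at this

theorem IsSubring.mono {a b : A} (hab : a ≤ b) {R : Set A} (h : IsSubring a R) : IsSubring b R :=
  ⟨h.bot_mem, fun x hx => (h.le x hx).trans hab, h.sup_mem, h.sdiff_mem⟩

/-- Subrings of the relative algebra below `a`. -/
def Subring (a : A) : Type u := {R : Set A // IsSubring a R}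

/-- The subalgebra generated by a subring. -/
def IsSubring.toSub {a : A} {R : Set A} (h : IsSubring a R) : BooleanSubalgebra A where
  carrier := {x | x ∈ R ∨ xᶜ ∈ R}
  supClosed' := by
    rintro x (hx | hx) y (hy | hy)
    · exact Or.inl (h.sup_mem x hx y hy)
    · right
      rw [compl_sup, inf_comm, ← sdiff_eq]
      exact h.sdiff_mem _ hy _ hx
    · right
      rw [compl_sup, ← sdiff_eq]
      exact h.sdiff_mem _ hx _ hy
    · right
      rw [compl_sup]
      exact h.inf_mem hx hy
  infClosed' := by
    rintro x (hx | hx) y (hy | hy)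
    · exact Or.inl (h.inf_mem hx hy)
    · left
      have := h.sdiff_mem _ hx _ hy
      rwa [sdiff_eq, compl_compl] at this
    · left
      have := h.sdiff_mem _ hy _ hx
      rwa [sdiff_eq, compl_compl, inf_comm] at this
    · right
      rw [compl_inf]
      exact h.sup_mem _ hx _ hy
  compl_mem' := by
    rintro x (hx | hx)
    · right; rwa [compl_compl]
    · exact Or.inl hx
  bot_mem' := Or.inl h.bot_mem

theorem IsSubring.exists_avoiding {a : A} {R : Set A} (h : IsSubring a R) (ht : ⊤ ∉ R) :
    ∃ x : Pt A, ∀ b ∈ R, x ∉ pts b := by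
  let I : Order.Ideal A := mkIdeal {b | ∃ r ∈ R, b ≤ r} ⟨⊥, h.bot_mem, le_rfl⟩
    (fun x y hyx ⟨r, hr, hx⟩ => ⟨r, hr, hyx.trans hx⟩)
    (fun x y ⟨r, hr, hx⟩ ⟨s, hs, hy⟩ => ⟨r ⊔ s, h.sup_mem r hr s hs, sup_le_sup hx hy⟩)
  have : (⊤ : A) ∉ I := fun ⟨r, hr, hle⟩ => ht (top_le_iff.1 hle ▸ hr)
  obtain ⟨x, -, hx⟩ := exists_pt_of_notMem this
  exact ⟨x, fun b hb => hx b ⟨b, hb, le_rfl⟩⟩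

/-- A subring R can be recovered from the subalgebra R ∪ {xᶜ : x ∈ R} and, when ⊤ ∉ R, one point
lying in no element of R: the point tells which of b and bᶜ is in R. There are at most sub(A)
points. -/
theorem mk_subring_le [Infinite A] (a : A) : #(Subring a) ≤ #(BooleanSubalgebra A) := by
  classical
  have h1 : #(Subring a) ≤ #(BooleanSubalgebra A × Option (Pt A)) := by
    refine Cardinal.mk_le_of_injective (f := fun R : Subring a =>
      (R.2.toSub, if ht : ⊤ ∈ R.1 then none else some (R.2.exists_avoiding ht).choose)) ?_
    intro R S h
    simp only [Prod.mk.injEq] at h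
    obtain ⟨h1, h2⟩ := h
    have hB : ∀ x, (x ∈ R.1 ∨ xᶜ ∈ R.1) ↔ (x ∈ S.1 ∨ xᶜ ∈ S.1) := fun x => by
      change x ∈ R.2.toSub ↔ x ∈ S.2.toSub
      rw [h1]
    apply Subtype.ext
    by_cases hR : ⊤ ∈ R.1
    · by_cases hS : ⊤ ∈ S.1
      · have hc : ∀ T : Subring a, ⊤ ∈ T.1 → ∀ x, xᶜ ∈ T.1 → x ∈ T.1 := by
          intro T hT x hx
          have := T.2.sdiff_mem _ hT _ hx
          rwa [top_sdiff, compl_compl] at this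
        ext x
        constructor
        · intro hx
          rcases (hB x).1 (Or.inl hx) with h | h
          · exact h
          · exact hc S hS x h
        · intro hx
          rcases (hB x).2 (Or.inl hx) with h | h
          · exact h
          · exact hc R hR x h
      · rw [dif_pos hR, dif_neg hS] at h2
        cases h2
    · by_cases hS : ⊤ ∈ S.1
      · rw [dif_neg hR, dif_pos hS] at h2
        cases h2
      · rw [dif_neg hR, dif_neg hS] at h2
        have hx := (R.2.exists_avoiding hR).choose_spec
        have hx' := (S.2.exists_avoiding hS).choose_spec
        rw [← Option.some.inj h2] at hx'
        generalize (R.2.exists_avoiding hR).choose = x at hx hx'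
        ext b
        constructor
        · intro hb
          rcases (hB b).1 (Or.inl hb) with h | h
          · exact h
          · exact absurd (mem_pts_compl.2 (hx b hb)) (hx' _ h)
        · intro hb
          rcases (hB b).2 (Or.inl hb) with h | h
          · exact h
          · exact absurd (mem_pts_compl.2 (hx' b hb)) (hx _ h)
  refine h1.trans ?_
  have hinf := aleph0_le_sub (A := A)
  rw [mk_prod, lift_id, lift_id, mk_option]
  refine (mul_le_mul' le_rfl (add_le_of_le hinf mk_pt_le_sub (one_le_aleph0.trans hinf))).trans ?_
  exact (mul_eq_self hinf).le

theorem isSubring_ideal (I : Order.Ideal A) : IsSubring ⊤ (I : Set A) :=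
  ⟨I.bot_mem, fun _ _ => le_top, fun _ hx _ hy => Order.Ideal.sup_mem hx hy,
    fun _ hx _ _ => ideal_mem_of_le sdiff_le hx⟩

theorem mk_ideal_le_sub [Infinite A] : #(Order.Ideal A) ≤ #(BooleanSubalgebra A) := by
  refine le_trans ?_ (mk_subring_le (⊤ : A))
  refine Cardinal.mk_le_of_injective
    (f := fun I : Order.Ideal A => (⟨I, isSubring_ideal I⟩ : Subring (⊤ : A))) fun I J h => ?_
  exact SetLike.coe_injective (congrArg Subtype.val h)

/-- `S` is a dense subset of the space `F`. -/
def DenseIn (S F : Set (Pt A)) : Prop :=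
  S ⊆ F ∧ ∀ a, (pts a ∩ F).Nonempty → (pts a ∩ S).Nonempty

/-- A space without small dense subsets yields many subalgebras. -/
theorem two_power_le_sub {κ : Cardinal.{u}} (hκ : ℵ₀ < κ) {F : Set (Pt A)}
    (hF : ∀ S, DenseIn S F → κ ≤ #S) : 2 ^ κ ≤ #(BooleanSubalgebra A) := by
  classical
  have hne : F.Nonempty := by
    by_contra h
    rw [Set.not_nonempty_iff_eq_empty] at h
    have := hF ∅ ⟨Set.empty_subset _, fun a ha => by simp [h] at ha⟩
    simp at this
    exact absurd hκ (by simp [this])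
  have : Nonempty (Pt A) := ⟨hne.some⟩
  have hw : ∃ w : A → Pt A, ∀ a, (pts a ∩ F).Nonempty → w a ∈ pts a ∩ F :=
    ⟨fun a => Classical.epsilon (· ∈ pts a ∩ F), fun a ha => Classical.epsilon_spec ha⟩
  obtain ⟨w, hw⟩ := hw
  let ι := κ.ord.ToType
  -- `w u` is a chosen point of u in F. The generators earlier than i yield fewer than κ such
  -- points, so these are not dense in F, and the next generator `c i` meets F while missing all of
  -- them.
  obtain ⟨c, hc⟩ := exists_rec_choice (ι := ι) (α := A) (fun i c a => (pts a ∩ F).Nonempty ∧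
      ∀ u ∈ BooleanSubalgebra.closure (c '' Set.Iio i), (pts u ∩ F).Nonempty → w u ∉ pts a)
    (by
      rintro i f g a hfg ⟨h1, h2⟩
      refine ⟨h1, ?_⟩
      have : g '' Set.Iio i = f '' Set.Iio i := Set.image_congr fun j hj => (hfg j hj).symm
      rwa [this])
    (by
      intro i f _
      let W : Set (Pt A) := w '' {u | u ∈ BooleanSubalgebra.closure (f '' Set.Iio i) ∧
        (pts u ∩ F).Nonempty}
      have hWF : W ⊆ F := by
        rintro _ ⟨u, hu, rfl⟩
        exact (hw u hu.2).2
      have hWc : #W < κ := by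
        have h1 : #W ≤ #(BooleanSubalgebra.closure (f '' Set.Iio i)) :=
          mk_image_le.trans (mk_le_mk_of_subset fun u hu => hu.1)
        refine h1.trans_lt ((mk_closure_le _).trans_lt (max_lt ?_ hκ))
        exact mk_image_le.trans_lt (mk_Iio_toType i)
      by_contra hn
      push Not at hn
      refine (hF W ⟨hWF, fun a ha => ?_⟩).not_gt hWc
      obtain ⟨u, hu, hu1, hu2⟩ := hn a ha
      exact ⟨w u, hu2, u, ⟨hu, hu1⟩, rfl⟩)
  -- At the points chosen for the algebra of the generators up to k, later generators vanish, so
  -- replacing them by ⊥ does not change the trace.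
  have trace : ∀ (T : Set ι) (k : ι), ∀ u ∈ BooleanSubalgebra.closure (c '' T),
      ∃ v ∈ BooleanSubalgebra.closure (c '' (T ∩ Set.Iic k)),
        ∀ z ∈ BooleanSubalgebra.closure (c '' Set.Iic k), (pts z ∩ F).Nonempty →
          (w z ∈ pts u ↔ w z ∈ pts v) := by
    intro T k u hu
    induction hu using BooleanSubalgebra.closure_bot_sup_induction with
    | mem x hx =>
      obtain ⟨β, hβ, rfl⟩ := hx
      rcases le_or_gt β k with h | h
      · exact ⟨c β, BooleanSubalgebra.subset_closure ⟨β, ⟨hβ, h⟩, rfl⟩, fun _ _ _ => Iff.rfl⟩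
      · refine ⟨⊥, BooleanSubalgebra.bot_mem, fun z hz hzF => ?_⟩
        have := (hc β).2 z (BooleanSubalgebra.closure_mono
          (Set.image_mono fun j hj => lt_of_le_of_lt hj h) hz) hzF
        simp [this]
    | bot => exact ⟨⊥, BooleanSubalgebra.bot_mem, fun _ _ _ => Iff.rfl⟩
    | sup x hx y hy h1 h2 =>
      obtain ⟨v, hv, hv'⟩ := h1
      obtain ⟨v2, hv2, hv2'⟩ := h2
      refine ⟨v ⊔ v2, BooleanSubalgebra.sup_mem hv hv2, fun z hz hzF => ?_⟩
      rw [mem_pts_sup, mem_pts_sup, hv' z hz hzF, hv2' z hz hzF]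
    | compl x hx h =>
      obtain ⟨v, hv, hv'⟩ := h
      refine ⟨vᶜ, BooleanSubalgebra.compl_mem hv, fun z hz hzF => ?_⟩
      rw [mem_pts_compl, mem_pts_compl, hv' z hz hzF]
  -- If α ∉ T, then `c α` agrees at the chosen points with some v generated before α. Were v and `c
  -- α` different on F, the point chosen in their difference would show it; so they agree on F. But
  -- `c α` misses the point chosen in v.
  have key : ∀ (T : Set ι) (α : ι), c α ∈ BooleanSubalgebra.closure (c '' T) → α ∈ T := by
    intro T α hα
    by_contra hT
    obtain ⟨v, hv, hv'⟩ := trace T α _ hα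
    have hvI : v ∈ BooleanSubalgebra.closure (c '' Set.Iio α) := by
      refine BooleanSubalgebra.closure_mono (Set.image_mono ?_) hv
      rintro j ⟨hj, hj'⟩
      exact Set.mem_Iio.2 (lt_of_le_of_ne (Set.mem_Iic.1 hj') fun h => hT (h ▸ hj))
    have hvI' : v ∈ BooleanSubalgebra.closure (c '' Set.Iic α) :=
      BooleanSubalgebra.closure_mono (Set.image_mono Set.Iio_subset_Iic_self) hvI
    have hcI : c α ∈ BooleanSubalgebra.closure (c '' Set.Iic α) :=
      BooleanSubalgebra.subset_closure ⟨α, Set.self_mem_Iic, rfl⟩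
    have h1 : ¬ (pts (v \ c α) ∩ F).Nonempty := by
      intro h
      have e := hv' _ (BooleanSubalgebra.sdiff_mem hvI' hcI) h
      have := (hw _ h).1
      rw [mem_pts_sdiff] at this
      tauto
    have h2 : ¬ (pts (c α \ v) ∩ F).Nonempty := by
      intro h
      have e := hv' _ (BooleanSubalgebra.sdiff_mem hcI hvI') h
      have := (hw _ h).1
      rw [mem_pts_sdiff] at this
      tauto
    obtain ⟨x, hx, hxF⟩ := (hc α).1
    have hxv : x ∈ pts v := by
      by_contra hxv
      exact h2 ⟨x, mem_pts_sdiff.2 ⟨hx, hxv⟩, hxF⟩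
    have hvF : (pts v ∩ F).Nonempty := ⟨x, hxv, hxF⟩
    have h3 := (hc α).2 v hvI hvF
    exact h1 ⟨w v, mem_pts_sdiff.2 ⟨(hw v hvF).1, h3⟩, (hw v hvF).2⟩
  have hinj : Function.Injective fun T : Set ι => BooleanSubalgebra.closure (c '' T) := by
    intro T T' h
    have h : BooleanSubalgebra.closure (c '' T) = BooleanSubalgebra.closure (c '' T') := h
    ext α
    exact ⟨fun hα => key _ _ (h ▸ BooleanSubalgebra.subset_closure ⟨α, hα, rfl⟩),
      fun hα => key _ _ (h ▸ BooleanSubalgebra.subset_closure ⟨α, hα, rfl⟩)⟩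
  have := Cardinal.mk_le_of_injective hinj
  rwa [mk_set, mk_ord_toType] at this

end Subalgebras

end ShelahBA
namespace ShelahBA

/-! ### Density of subspaces; attaining a density of countable cofinality -/

section Separability

variable {A : Type u} [BooleanAlgebra A]

/-- `F` has a dense subset of size at most `δ`. -/
def Sep (F : Set (Pt A)) (δ : Cardinal.{u}) : Prop := ∃ S, DenseIn S F ∧ #S ≤ δ

theorem Sep.mono {F : Set (Pt A)} {δ ε : Cardinal.{u}} (h : Sep F δ) (hle : δ ≤ ε) : Sep F ε :=
  let ⟨S, h1, h2⟩ := h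
  ⟨S, h1, h2.trans hle⟩

theorem sep_of_mk_le {F : Set (Pt A)} {δ : Cardinal.{u}} (h : #F ≤ δ) : Sep F δ :=
  ⟨F, ⟨le_rfl, fun _ h => h⟩, h⟩

theorem sep_iUnion {ι : Type u} {F : ι → Set (Pt A)} {δ : Cardinal.{u}} (h : ∀ i, Sep (F i) δ) :
    Sep (⋃ i, F i) (#ι * δ) := by
  choose S h1 h2 using h
  refine ⟨⋃ i, S i, ⟨Set.iUnion_mono fun i => (h1 i).1, ?_⟩, ?_⟩
  · rintro a ⟨x, hx, hxF⟩
    obtain ⟨i, hi⟩ := Set.mem_iUnion.1 hxF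
    obtain ⟨y, hy, hyS⟩ := (h1 i).2 a ⟨x, hx, hi⟩
    exact ⟨y, hy, Set.mem_iUnion.2 ⟨i, hyS⟩⟩
  · exact (mk_iUnion_le _).trans (mul_le_mul' le_rfl (ciSup_le' h2))

theorem Sep.union {F G : Set (Pt A)} {δ ε : Cardinal.{u}} (h : Sep F δ) (h' : Sep G ε) :
    Sep (F ∪ G) (δ + ε) := by
  obtain ⟨S, h1, h2⟩ := h
  obtain ⟨T, h3, h4⟩ := h'
  refine ⟨S ∪ T, ⟨Set.union_subset_union h1.1 h3.1, ?_⟩,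
    (mk_union_le _ _).trans (add_le_add h2 h4)⟩
  rintro a ⟨x, hx, hxF | hxF⟩
  · obtain ⟨y, hy, hyS⟩ := h1.2 a ⟨x, hx, hxF⟩
    exact ⟨y, hy, Or.inl hyS⟩
  · obtain ⟨y, hy, hyS⟩ := h3.2 a ⟨x, hx, hxF⟩
    exact ⟨y, hy, Or.inr hyS⟩

/-- Every point of `F` is isolated in `F`. -/
def Discrete (F : Set (Pt A)) : Prop := ∀ x ∈ F, ∃ a, x ∈ pts a ∧ ∀ y ∈ F, y ∈ pts a → y = x

theorem Discrete.eq_of_denseIn {F S : Set (Pt A)} (h : Discrete F) (hS : DenseIn S F) : S = F := by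
  refine hS.1.antisymm fun x hx => ?_
  obtain ⟨a, ha, hu⟩ := h x hx
  obtain ⟨y, hy, hyS⟩ := hS.2 a ⟨x, ha, hx⟩
  exact hu y (hS.1 hyS) hy ▸ hyS

theorem Discrete.mk_le {F : Set (Pt A)} (h : Discrete F) {δ : Cardinal.{u}} (hs : Sep F δ) :
    #F ≤ δ := by
  obtain ⟨S, h1, h2⟩ := hs
  rwa [h.eq_of_denseIn h1] at h2

theorem Discrete.subset {F G : Set (Pt A)} (h : Discrete F) (hG : G ⊆ F) : Discrete G := by
  intro x hx
  obtain ⟨a, ha, hu⟩ := h x (hG hx)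
  exact ⟨a, ha, fun y hy => hu y (hG hy)⟩

/-- `E` has subspaces of arbitrarily large density below `L`. -/
def Rich (L : Cardinal.{u}) (E : Set (Pt A)) : Prop := ∀ ε < L, ∃ F ⊆ E, ¬ Sep F ε

/-- One step of the construction of a discrete set of size L: split off a large discrete T and keep
a rich remainder E', such that the neighbourhoods c of points of either set miss the other.
Iterating, the union of the sets T stays discrete. -/
theorem rich_step {L : Cardinal.{u}} {δ : ℕ → Cardinal.{u}} (hδ : ∀ n, δ n < L)
    (hcof : ∀ ε < L, ∃ n, ε < δ n) (hω : ℵ₀ < L) {c : Pt A → A} {E : Set (Pt A)}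
    {l : Cardinal.{u}} (hl : l < L) (hcE : ∀ x ∈ E, x ∈ pts (c x))
    (hcs : ∀ x ∈ E, ∀ F ⊆ pts (c x), Sep F l) (hE : Rich L E) {ε : Cardinal.{u}} (hε : ε < L) :
    ∃ T E', T ⊆ E ∧ E' ⊆ E ∧ Rich L E' ∧ ε < #T ∧ Discrete T ∧
      (∀ y ∈ E', Disjoint (pts (c y)) T) ∧ ∀ z ∈ T, Disjoint (pts (c z)) E' := by
  classical
  have hsucc : ∀ ε < L, Order.succ ε < L := fun ε hε => by
    obtain ⟨n, hn⟩ := hcof ε hε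
    exact (Order.succ_le_of_lt hn).trans_lt (hδ n)
  obtain ⟨k, hk⟩ : ∃ k, k = max (max l ε) ℵ₀ := ⟨_, rfl⟩
  have hkω : ℵ₀ ≤ k := hk ▸ le_max_right _ _
  have hkl : l ≤ k := hk ▸ (le_max_left _ _).trans (le_max_left _ _)
  have hkε : ε ≤ k := hk ▸ (le_max_right _ _).trans (le_max_left _ _)
  have hkL : k < L := hk ▸ max_lt (max_lt hl hε) hω
  -- A successor, so that κ is regular and uncountable, and above every density occurring inside a
  -- set `pts (c x)`.
  obtain ⟨κ, hκ⟩ : ∃ κ, κ = Order.succ k := ⟨_, rfl⟩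
  have hκL : κ < L := hκ ▸ hsucc k hkL
  have hkκ : k < κ := hκ ▸ Order.lt_succ k
  have hκω : ℵ₀ ≤ κ := hkω.trans hkκ.le
  have hreg : κ.IsRegular := hκ ▸ isRegular_succ hkω
  obtain ⟨F, hFE, hF⟩ := hE κ hκL
  have hFne : Nonempty (Pt A) := by
    by_contra h
    rw [not_nonempty_iff] at h
    exact hF (sep_of_mk_le (by rw [Set.eq_empty_of_isEmpty F]; simp))
  let ι := κ.ord.ToType
  have hι : #ι = κ := mk_ord_toType κ
  -- If no next point existed, dense subsets of the pieces of F in the earlier neighbourhoods would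
  -- together be dense in F, with at most κ points.
  obtain ⟨d, hd⟩ := exists_rec_choice (ι := ι) (α := Pt A)
    (fun i d x => x ∈ F ∧ (∀ j < i, x ∉ pts (c (d j))) ∧ ∃ a, x ∈ pts a ∧ ∀ j < i, d j ∉ pts a)
    (by
      rintro i f g x hfg ⟨h1, h2, a, h3, h4⟩
      exact ⟨h1, fun j hj => hfg j hj ▸ h2 j hj, a, h3, fun j hj => hfg j hj ▸ h4 j hj⟩)
    (by
      intro i f hf
      by_contra hn
      have h1 : ∀ j : Set.Iio i, Sep (F ∩ pts (c (f j))) k := fun j =>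
        (hcs (f j) (hFE (hf j j.2).1) _ Set.inter_subset_right).mono hkl
      choose S hS hSk using h1
      refine hF ⟨⋃ j, S j, ⟨Set.iUnion_subset fun j => (hS j).1.trans Set.inter_subset_left, ?_⟩, ?_⟩
      · rintro a ⟨x, hx, hxF⟩
        by_contra hne
        have h2 : ∀ j < i, ∀ y ∈ F, y ∈ pts (c (f j)) → y ∉ pts a := by
          intro j hj y hy hyc hya
          obtain ⟨z, hz, hzS⟩ := (hS ⟨j, hj⟩).2 a ⟨y, hya, hy, hyc⟩
          exact hne ⟨z, hz, Set.mem_iUnion.2 ⟨_, hzS⟩⟩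
        exact hn ⟨x, hxF, fun j hj h => h2 j hj x hxF h hx, a, hx,
          fun j hj => h2 j hj _ (hf j hj).1 (hcE _ (hFE (hf j hj).1))⟩
      · refine (mk_iUnion_le _).trans ((mul_le_mul' (mk_Iio_toType i).le
          ((ciSup_le' hSk).trans hkκ.le)).trans (mul_eq_self hκω).le))
  have hdE : ∀ i, d i ∈ E := fun i => hFE (hd i).1
  have hiso : ∀ i, ∃ a, d i ∈ pts a ∧ ∀ j, d j ∈ pts a → j = i := by
    intro i
    obtain ⟨-, -, a, ha, ha'⟩ := hd i
    refine ⟨a ⊓ c (d i), mem_pts_inf.2 ⟨ha, hcE _ (hdE i)⟩, fun j hj => ?_⟩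
    rw [mem_pts_inf] at hj
    rcases lt_trichotomy j i with h | h | h
    · exact absurd hj.1 (ha' j h)
    · exact h
    · exact absurd hj.2 ((hd j).2.1 i h)
  have hdinj : Function.Injective d := by
    intro i j hij
    obtain ⟨a, ha, hu⟩ := hiso i
    exact (hu j (hij ▸ ha)).symm
  have hdis : Discrete (Set.range d) := by
    rintro _ ⟨i, rfl⟩
    obtain ⟨a, ha, hu⟩ := hiso i
    refine ⟨a, ha, ?_⟩
    rintro _ ⟨j, rfl⟩ hj
    rw [hu j hj]
  obtain ⟨e⟩ : Nonempty (ι × ι ≃ ι) := by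
    rw [← Cardinal.eq, ← mul_def, hι, mul_eq_self hκω]
  -- The sequence is cut into κ disjoint blocks of size κ. A neighbourhood `c y` contains at most k
  -- of the points, since they form a discrete set, so it meets fewer than κ blocks.
  let D : ι → Set (Pt A) := fun i => Set.range fun j => d (e (i, j))
  let Ei : ι → Set (Pt A) := fun i => {y ∈ E | Disjoint (pts (c y)) (D i)}
  have hfew : ∀ y ∈ E, #{i : ι | ¬ Disjoint (pts (c y)) (D i)} < κ := by
    intro y hy
    refine lt_of_le_of_lt ?_ hkκ
    have h1 : #(↥(pts (c y) ∩ Set.range d)) ≤ k :=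
      (hdis.subset Set.inter_subset_right).mk_le ((hcs y hy _ Set.inter_subset_left).mono hkl)
    refine le_trans ?_ h1
    have h2 : ∀ i : {i : ι | ¬ Disjoint (pts (c y)) (D i)}, ∃ j, d (e (i, j)) ∈ pts (c y) := by
      rintro ⟨i, hi⟩
      obtain ⟨x, hx, j, rfl⟩ := Set.not_disjoint_iff.1 hi
      exact ⟨j, hx⟩
    choose j hj using h2
    refine Cardinal.mk_le_of_injective (f := fun i => ⟨d (e (i.1, j i)), hj i, _, rfl⟩) ?_
    intro i i' h
    have := e.injective (hdinj (congrArg Subtype.val h))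
    exact Subtype.ext (Prod.mk.inj this).1
  have hrich : ∃ i, Rich L (Ei i) := by
    by_contra hn
    push Not at hn
    simp only [Rich, not_forall, not_exists, not_and, not_not] at hn
    choose ε' hε' hsep using hn
    have h1 : ∀ i, ∃ n, ε' i < δ n := fun i => hcof _ (hε' i)
    choose n hn using h1
    -- If no `Ei i` is rich, κ many of them share one density bound `δ m`. Every y lies in one of
    -- these, having fewer than κ bad blocks, so all subspaces of E would have density at most max κ
    -- (δ m).
    obtain ⟨m, hm⟩ := infinite_pigeonhole_card (fun i : ι => ULift.up.{u} (n i)) κ hι.ge hκω (by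
      rw [hreg.cof_ord]
      simpa using hkω.trans_lt hkκ)
    obtain ⟨F', hF'E, hF'⟩ := hE (max κ (δ m.down)) (max_lt hκL (hδ _))
    let J := (fun i : ι => ULift.up.{u} (n i)) ⁻¹' {m}
    have hcov : F' = ⋃ i : J, (F' ∩ Ei i.1) := by
      refine Set.Subset.antisymm (fun y hy => ?_) (Set.iUnion_subset fun _ => Set.inter_subset_left)
      rw [Set.mem_iUnion]
      by_contra hno
      have h2 : J ⊆ {i : ι | ¬ Disjoint (pts (c y)) (D i)} := fun i hi hdj =>
        hno ⟨⟨i, hi⟩, hy, hF'E hy, hdj⟩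
      exact absurd (hm.trans (mk_le_mk_of_subset h2)) (hfew y (hF'E hy)).not_ge
    apply hF'
    rw [hcov]
    refine (sep_iUnion (δ := δ m.down) fun i => ?_).mono ?_
    · refine (hsep i.1 _ Set.inter_subset_right).mono ?_
      have h3 : n i.1 = m.down := congrArg ULift.down i.2
      rw [← h3]
      exact (hn _).le
    · refine (mul_le_mul' ((mk_set_le J).trans hι.le) le_rfl).trans ?_
      exact (mul_le_max κ _).trans (max_le le_rfl (hκω.trans (le_max_left _ _)))
  obtain ⟨i, hi⟩ := hrich
  have hDE : D i ⊆ E := by rintro _ ⟨j, rfl⟩; exact hdE _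
  have hDc : #(D i) = κ := by
    rw [mk_range_eq _ fun j j' h => (Prod.mk.inj (e.injective (hdinj h))).2, hι]
  -- Removing the neighbourhoods of the points of `D i` preserves richness, because the removed part
  -- of any subspace has density at most κ · k = κ < L.
  refine ⟨D i, Ei i \ ⋃ z : D i, pts (c z), hDE, Set.sdiff_subset.trans fun y hy => hy.1, ?_,
    hDc ▸ hkε.trans_lt hkκ, hdis.subset (by rintro _ ⟨j, rfl⟩; exact ⟨_, rfl⟩),
    fun y hy => hy.1.2, fun z hz => ?_⟩
  · intro ε' hε'
    obtain ⟨F', hF', hns⟩ := hi (max ε' κ) (max_lt hε' hκL)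
    refine ⟨F' \ ⋃ z : D i, pts (c z), Set.sdiff_subset_sdiff_left hF', fun hs => hns ?_⟩
    have h1 : F' = (F' \ ⋃ z : D i, pts (c z)) ∪ ⋃ z : D i, (F' ∩ pts (c z)) := by
      rw [← Set.inter_iUnion, Set.sdiff_union_inter]
    rw [h1]
    refine (hs.union (sep_iUnion (F := fun z : D i => F' ∩ pts (c z)) (δ := k) fun z =>
      (hcs z.1 (hDE z.2) _ Set.inter_subset_right).mono hkl)).mono ?_
    rw [hDc]
    have h2 : κ * k ≤ κ := (mul_le_mul' le_rfl hkκ.le).trans (mul_eq_self hκω).le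
    refine (add_le_add le_rfl h2).trans ((add_le_max _ _).trans ?_)
    exact max_le le_rfl (hκω.trans (le_max_right _ _))
  · rw [Set.disjoint_left]
    intro y hy hy'
    exact hy'.2 (Set.mem_iUnion.2 ⟨⟨z, hz⟩, hy⟩)

/-- If there are subspaces of density above every cardinal below `L`, a cardinal of countable
cofinality, then there is a subspace of density at least `L`. -/
theorem exists_le_mk_denseIn {L : Cardinal.{u}} {δ : ℕ → Cardinal.{u}} (hδ : ∀ n, δ n < L)
    (hcof : ∀ ε < L, ∃ n, ε < δ n) (hmono : Monotone δ) (hω : ∀ n, ℵ₀ ≤ δ n)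
    (hr : Rich L (Set.univ : Set (Pt A))) :
    ∃ F : Set (Pt A), ∀ S, DenseIn S F → L ≤ #S := by
  classical
  have hωL : ℵ₀ < L := (hω 0).trans_lt (hδ 0)
  -- Points all of whose neighbourhoods contain a subspace of density above `δ n`. If these sets are
  -- all infinite, subspaces of increasing density fit in disjoint clopen sets and their union is as
  -- wanted.
  let Sn : ℕ → Set (Pt A) := fun n => {x | ∀ a, x ∈ pts a → ∃ F ⊆ pts a, ¬ Sep F (δ n)}
  have hanti : Antitone Sn := by
    intro m n hmn x hx a ha
    obtain ⟨F, hF, hs⟩ := hx a ha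
    exact ⟨F, hF, fun h => hs (h.mono (hmono hmn))⟩
  by_cases hinf : ∀ n, (Sn n).Infinite
  · obtain ⟨x, a, h1, h2, h3⟩ := exists_disjoint_clopens Sn hanti hinf
    have h4 : ∀ n, ∃ F ⊆ pts (a n), ¬ Sep F (δ n) := fun n => h1 n (a n) (h2 n)
    choose F hF hs using h4
    refine ⟨⋃ n, F n, fun S hS => ?_⟩
    by_contra hlt
    obtain ⟨n, hn⟩ := hcof _ (not_le.1 hlt)
    refine hs n ⟨S ∩ pts (a n), ⟨?_, ?_⟩, (mk_le_mk_of_subset Set.inter_subset_left).trans hn.le⟩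
    · rintro y ⟨hy, hya⟩
      obtain ⟨m, hm⟩ := Set.mem_iUnion.1 (hS.1 hy)
      by_cases hmn : m = n
      · exact hmn ▸ hm
      · exact absurd hya (Set.disjoint_left.1 (h3 m n hmn) (hF m hm))
    · rintro b ⟨y, hy, hyF⟩
      obtain ⟨z, hz, hzS⟩ := hS.2 (b ⊓ a n)
        ⟨y, mem_pts_inf.2 ⟨hy, hF n hyF⟩, Set.mem_iUnion.2 ⟨n, hyF⟩⟩
      rw [mem_pts_inf] at hz
      exact ⟨z, hz.1, hzS, hz.2⟩
  -- Otherwise all but finitely many points have a neighbourhood whose subspaces have density at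
  -- most `δ n0`, and `rich_step` can be iterated; the density of the resulting discrete set is its
  -- cardinality.
  · push Not at hinf
    obtain ⟨n0, hP⟩ := hinf
    have hc : ∀ x : Pt A, ∃ a : A, x ∉ Sn n0 → x ∈ pts a ∧ ∀ F ⊆ pts a, Sep F (δ n0) := by
      intro x
      by_cases hx : x ∈ Sn n0
      · exact ⟨⊥, fun h => absurd hx h⟩
      · have hx' : ¬ ∀ a, x ∈ pts a → ∃ F ⊆ pts a, ¬ Sep F (δ n0) := hx
        push Not at hx'
        obtain ⟨a, ha⟩ := hx'
        exact ⟨a, fun _ => ha⟩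
    choose c hc using hc
    let E0 : Set (Pt A) := (Sn n0)ᶜ
    have hE0 : Rich L E0 := by
      intro ε hε
      obtain ⟨F, -, hF⟩ := hr (max ε ℵ₀) (max_lt hε hωL)
      refine ⟨F \ Sn n0, fun y hy => hy.2, fun hs => hF ?_⟩
      rw [← Set.sdiff_union_inter F (Sn n0)]
      refine (hs.union (sep_of_mk_le (δ := ℵ₀) ?_)).mono
        (add_le_of_le (le_max_right _ _) (le_max_left _ _) (le_max_right _ _))
      exact (lt_aleph0_iff_set_finite.2 (hP.subset Set.inter_subset_right)).le
    let R := {E : Set (Pt A) // E ⊆ E0 ∧ Rich L E}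
    have step : ∀ (E : R) (n : ℕ), ∃ (T : Set (Pt A)) (E' : R), T ⊆ E.1 ∧ E'.1 ⊆ E.1 ∧ δ n < #T ∧
        Discrete T ∧ (∀ y ∈ E'.1, Disjoint (pts (c y)) T) ∧ ∀ z ∈ T, Disjoint (pts (c z)) E'.1 := by
      rintro ⟨E, hE, hER⟩ n
      obtain ⟨T, E', h1, h2, h3, h4, h5, h6, h7⟩ := rich_step hδ hcof hωL (hδ n0)
        (fun x hx => (hc x (hE hx)).1) (fun x hx => (hc x (hE hx)).2) hER (hδ n)
      exact ⟨T, ⟨E', h2.trans hE, h3⟩, h1, h2, h4, h5, h6, h7⟩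
    choose T E' h1 h2 h3 h4 h5 h6 using step
    let E : ℕ → R := fun n => Nat.rec ⟨E0, le_rfl, hE0⟩ (fun n E => E' E n) n
    have hE : ∀ n, E (n + 1) = E' (E n) n := fun n => rfl
    have hEanti : Antitone fun n => (E n).1 := antitone_nat_of_succ_le fun n => by
      rw [hE]; exact h2 _ _
    let U : ℕ → Set (Pt A) := fun n => T (E n) n
    have hUE : ∀ n, U n ⊆ (E n).1 := fun n => h1 _ _
    have hdisc : Discrete (⋃ n, U n) := by
      intro x hx
      obtain ⟨n, hn⟩ := Set.mem_iUnion.1 hx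
      obtain ⟨a, ha, hu⟩ := h4 (E n) n x hn
      refine ⟨a ⊓ c x, mem_pts_inf.2 ⟨ha, (hc x ((E n).2.1 (hUE n hn))).1⟩, fun y hy hya => ?_⟩
      rw [mem_pts_inf] at hya
      obtain ⟨m, hm⟩ := Set.mem_iUnion.1 hy
      rcases lt_trichotomy m n with h | h | h
      · have e1 : x ∈ (E (m + 1)).1 := hEanti h (hUE n hn)
        rw [hE] at e1
        exact absurd hm (Set.disjoint_left.1 (h5 _ _ x e1) hya.2)
      · subst h
        exact hu y hm hya.1
      · have e1 : y ∈ (E (n + 1)).1 := hEanti h (hUE m hm)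
        rw [hE] at e1
        exact absurd e1 (Set.disjoint_left.1 (h6 _ _ x hn) hya.2)
    refine ⟨⋃ n, U n, fun S hS => ?_⟩
    rw [hdisc.eq_of_denseIn hS]
    by_contra hlt
    obtain ⟨n, hn⟩ := hcof _ (not_le.1 hlt)
    have e1 : #(U n) ≤ #(↥(⋃ n, U n)) := mk_le_mk_of_subset (Set.subset_iUnion U n)
    exact absurd ((h3 (E n) n).trans_le e1) hn.not_gt

end Separability

end ShelahBA
namespace ShelahBA

/-! ### Powers, products and cofinal families of cardinals -/

section CardinalArithmetic

theorem exists_mk_Iio_eq {c θ : Cardinal.{u}} (h : θ < c) : ∃ i : c.ord.ToType, #(Set.Iio i) = θ := by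
  have h1 : θ.ord < Ordinal.type (α := c.ord.ToType) (· < ·) := by
    rw [Ordinal.type_toType]; exact ord_lt_ord.2 h
  refine ⟨Ordinal.enum (α := c.ord.ToType) (· < ·) ⟨θ.ord, h1⟩, ?_⟩
  have h2 := Ordinal.card_typein (r := ((· < ·) : c.ord.ToType → c.ord.ToType → Prop))
    (Ordinal.enum (α := c.ord.ToType) (· < ·) ⟨θ.ord, h1⟩)
  rw [Ordinal.typein_enum, card_ord] at h2
  exact h2.symm

theorem exists_equiv_prod {ι : Type u} (h : ℵ₀ ≤ #ι) : Nonempty (ι ≃ ι × ι) := by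
  rw [← Cardinal.eq, ← mul_def, mul_eq_self h]

theorem sum_le_prod_succ {ι : Type u} (r : ι → Cardinal.{u}) :
    sum r ≤ prod fun i => Order.succ (r i) :=
  (sum_lt_prod _ _ fun i => Order.lt_succ (r i)).le

/-- Cardinals with sum at least `χ`, each repeated often enough, have product at least `χ ^ #ι`. -/
theorem power_le_prod {ι : Type u} (e : ι ≃ ι × ι) {χ : Cardinal.{u}} {r s : ι → Cardinal.{u}}
    (h : χ ≤ sum r) (hs : ∀ i, r (e i).1 < s i) : χ ^ #ι ≤ prod s := by
  have h1 : χ ^ #ι ≤ #(ι → ∀ i, (Order.succ (r i)).out) := by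
    rw [mk_arrow, lift_id, lift_id, mk_pi]
    simp only [mk_out]
    exact power_le_power_right (h.trans (sum_le_prod_succ r))
  -- Through e each index occurs as a first coordinate #ι times, which supplies the exponent #ι.
  have h2 : #(ι → ∀ i, (Order.succ (r i)).out) ≤ #(∀ k, (Order.succ (r (e k).1)).out) := by
    refine Cardinal.mk_le_of_injective (f := fun F k => F (e k).2 (e k).1) fun F G hFG => ?_
    funext j i
    obtain ⟨k, hk⟩ := e.surjective (i, j)
    obtain rfl : (e k).1 = i := congrArg Prod.fst hk
    obtain rfl : (e k).2 = j := congrArg Prod.snd hk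
    exact congrFun hFG k
  refine h1.trans (h2.trans ?_)
  rw [mk_pi]
  simp only [mk_out]
  exact prod_le_prod _ _ fun i => Order.succ_le_of_lt (hs i)

/-- If a power of `χ` is larger than `χ` and all powers of smaller cardinals are at most `χ`, then
the exponent indexes a cofinal family. -/
theorem exists_cofinal_of_lt_power {ι : Type u} {χ : Cardinal.{u}} (hχ : ℵ₀ ≤ χ)
    (h : ∀ ρ < χ, ρ ^ #ι ≤ χ) (hlt : χ < χ ^ #ι) :
    ∃ f : ι → χ.ord.ToType, ∀ m, ∃ i, m ≤ f i := by
  by_contra hn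
  push Not at hn
  refine hlt.not_ge ?_
  have h1 : (Set.univ : Set (ι → χ.ord.ToType)) ⊆ ⋃ m, {f | ∀ i, f i < m} := fun f _ =>
    Set.mem_iUnion.2 (hn f)
  have h2 : #(ι → χ.ord.ToType) ≤ #(↥(⋃ m : χ.ord.ToType, {f : ι → χ.ord.ToType | ∀ i, f i < m})) := by
    rw [← mk_univ]; exact mk_le_mk_of_subset h1
  rw [mk_arrow, lift_id, lift_id, mk_ord_toType] at h2
  refine h2.trans ((mk_iUnion_le _).trans ?_)
  rw [mk_ord_toType]
  refine (mul_le_mul' le_rfl (ciSup_le' fun m => ?_)).trans (mul_eq_self hχ).le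
  refine le_trans ?_ (h _ (mk_Iio_toType m))
  have : #(ι → Set.Iio m) = #(Set.Iio m) ^ #ι := by rw [mk_arrow, lift_id, lift_id]
  rw [← this]
  refine Cardinal.mk_le_of_injective (f := fun f i => ⟨f.1 i, f.2 i⟩) fun f g hfg => ?_
  apply Subtype.ext
  funext i
  exact congrArg Subtype.val (congrFun hfg i)

theorem le_sum_of_cofinal {ι : Type u} {χ : Cardinal.{u}} {f : ι → χ.ord.ToType}
    (hf : ∀ m, ∃ i, m ≤ f i) : χ ≤ sum fun i => #(Set.Iic (f i)) := by
  calc χ = #χ.ord.ToType := (mk_ord_toType χ).symm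
    _ ≤ #(↥(⋃ i, Set.Iic (f i))) := by
      rw [← mk_univ]
      exact mk_le_mk_of_subset fun m _ => Set.mem_iUnion.2 (hf m)
    _ ≤ _ := mk_iUnion_le_sum_mk

theorem mk_Iic_toType {χ : Cardinal.{u}} (hχ : ℵ₀ ≤ χ) (i : χ.ord.ToType) : #(Set.Iic i) < χ := by
  rw [← Set.Iio_insert]
  exact mk_insert_le.trans_lt (add_lt_of_lt hχ (mk_Iio_toType i) (one_lt_aleph0.trans_le hχ))

theorem prod_power {ι : Type u} (f : ι → Cardinal.{u}) (κ : Cardinal.{u}) :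
    (prod fun i => f i ^ κ) = prod f ^ κ := by
  induction κ using Cardinal.inductionOn with
  | _ K =>
  have : #(∀ i, K → (f i).out) = #(K → ∀ i, (f i).out) := mk_congr (Equiv.piComm _)
  simpa [mk_pi] using this

theorem prod_mul_le {ι : Type u} (f g : ι → Cardinal.{u}) :
    (prod fun i => f i * g i) ≤ prod f * prod g := by
  have : #(∀ i, (f i).out × (g i).out) ≤ #((∀ i, (f i).out) × ∀ i, (g i).out) :=
    Cardinal.mk_le_of_injective (f := fun F => (fun i => (F i).1, fun i => (F i).2)) fun F G h => by
      obtain ⟨h1, h2⟩ := Prod.mk.inj h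
      funext i
      exact Prod.ext (congrFun h1 i) (congrFun h2 i)
  simpa [mk_pi] using this

/-- Exponents can be reduced to the length of a family with large sum. -/
theorem power_le_power_of_le_sum {ι : Type u} {χ κ : Cardinal.{u}} {r : ι → Cardinal.{u}}
    (hr : χ ≤ sum r) (h : ∀ i, Order.succ (r i) ^ κ ≤ χ) : χ ^ κ ≤ χ ^ #ι := by
  calc χ ^ κ ≤ (prod fun i => Order.succ (r i)) ^ κ :=
        power_le_power_right (hr.trans (sum_le_prod_succ r))
    _ = prod fun i => Order.succ (r i) ^ κ := (prod_power _ _).symm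
    _ ≤ prod fun _ : ι => χ := prod_le_prod _ _ h
    _ = χ ^ #ι := by rw [prod_const, lift_id, lift_id]

/-- A cofinal sequence can be made increasing. -/
theorem exists_monotone_cofinal {L : Cardinal.{u}} (hL : ℵ₀ < L) {d : ℕ → Cardinal.{u}}
    (hd : ∀ n, d n < L) (hcof : ∀ ε < L, ∃ n, ε < d n) :
    ∃ δ : ℕ → Cardinal.{u}, (∀ n, δ n < L) ∧ (∀ ε < L, ∃ n, ε < δ n) ∧ Monotone δ ∧
      ∀ n, ℵ₀ ≤ δ n := by
  let δ : ℕ → Cardinal.{u} := fun n => Nat.rec (max ℵ₀ (d 0)) (fun n x => max x (d (n + 1))) n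
  have h1 : ∀ n, δ (n + 1) = max (δ n) (d (n + 1)) := fun n => rfl
  have hm : Monotone δ := monotone_nat_of_le_succ fun n => h1 n ▸ le_max_left _ _
  refine ⟨δ, fun n => ?_, fun ε hε => ?_, hm, fun n => (le_max_left _ _).trans (hm (Nat.zero_le n))⟩
  · induction n with
    | zero => exact max_lt hL (hd 0)
    | succ n ih => rw [h1]; exact max_lt ih (hd _)
  · obtain ⟨n, hn⟩ := hcof ε hε
    refine ⟨n, hn.trans_le ?_⟩
    cases n with
    | zero => exact le_max_right _ _
    | succ n => rw [h1]; exact le_max_right _ _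

end CardinalArithmetic

/-! ### Many closed sets yield many ideals -/

section ManyClosedSets

variable {A : Type u} [BooleanAlgebra A]

/-- Pairing of natural numbers repeats each s n infinitely often as a factor; as a first coordinate
never exceeds the code of the pair, monotonicity of s makes every factor small enough. -/
theorem mk_pi_nat_le {μ : Cardinal.{u}} {s : ℕ → Cardinal.{u}} (hcof : ∀ ε < μ, ∃ n, ε < s n)
    (hm : Monotone s) {G : ℕ → Type u} (hG : ∀ n, s n < #(G n)) :
    μ ^ ℵ₀ ≤ #(∀ n, G n) := by
  let e : ULift.{u} ℕ ≃ ULift.{u} ℕ × ULift.{u} ℕ :=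
    Equiv.ulift.trans (Nat.pairEquiv.symm.trans (Equiv.prodCongr Equiv.ulift.symm Equiv.ulift.symm))
  have h1 : μ ≤ sum fun n : ULift.{u} ℕ => s n.down := by
    refine le_of_forall_lt fun ε hε => ?_
    obtain ⟨n, hn⟩ := hcof ε hε
    exact hn.trans_le (le_sum (fun n : ULift.{u} ℕ => s n.down) ⟨n⟩)
  have h2 := power_le_prod e (s := fun n => #(G n.down)) h1 fun i =>
    (hm (Nat.unpair_left_le i.down)).trans_lt (hG i.down)
  rw [← mk_pi] at h2
  have h3 : #(∀ n : ULift.{u} ℕ, G n.down) ≤ #(∀ n, G n) :=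
    Cardinal.mk_le_of_injective (f := fun F n => F ⟨n⟩) fun F F' h => by
      funext ⟨n⟩; exact congrFun h n
  simpa using h2.trans h3

/-- Many points, with few clopen sets, give many ideals. -/
theorem power_le_mk_ideal_of_points {μ : Cardinal.{u}} {s : ℕ → Cardinal.{u}}
    (hs : ∀ n, s n < μ) (hcof : ∀ ε < μ, ∃ n, ε < s n) (hm : Monotone s) (hω : ∀ n, ℵ₀ ≤ s n)
    (hA : #A < μ) (hX : μ ≤ #(Pt A)) : μ ^ ℵ₀ ≤ #(Order.Ideal A) := by
  have hμ : ℵ₀ < μ := (hω 0).trans_lt (hs 0)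
  -- The complement of `S n` is covered by at most #A < μ clopen sets of at most s n points, so `S
  -- n` is not finite.
  let S : ℕ → Set (Pt A) := fun n => {x | ∀ a, x ∈ pts a → s n < #(pts a)}
  have hanti : Antitone S := fun m n hmn x hx a ha => (hm hmn).trans_lt (hx a ha)
  have hinf : ∀ n, (S n).Infinite := by
    intro n hfin
    have h1 : #(↥((S n)ᶜ)) < μ := by
      have hsub : (S n)ᶜ ⊆ ⋃ a : {a : A // #(pts a) ≤ s n}, pts a.1 := by
        intro x hx
        have hx' : ¬ ∀ a, x ∈ pts a → s n < #(pts a) := hx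
        push Not at hx'
        obtain ⟨a, ha, hle⟩ := hx'
        exact Set.mem_iUnion.2 ⟨⟨a, hle⟩, ha⟩
      refine (mk_le_mk_of_subset hsub).trans_lt ((mk_iUnion_le _).trans_lt ?_)
      refine (mul_le_mul' (mk_subtype_le _) (ciSup_le' fun a => a.2)).trans_lt ?_
      exact mul_lt_of_lt hμ.le hA (hs n)
    have h2 : #(S n) < μ := (lt_aleph0_iff_set_finite.2 hfin).trans hμ
    have h3 := add_lt_of_lt hμ.le h2 h1
    rw [mk_sum_compl] at h3
    exact h3.not_ge hX
  obtain ⟨x, a, h1, h2, h3⟩ := exists_disjoint_clopens S hanti hinf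
  obtain ⟨f, hf⟩ := exists_injective_pi_ideal a (fun n => pts (a n)) (fun _ => le_rfl) h3
  exact (mk_pi_nat_le hcof hm fun n => h1 n _ (h2 n)).trans (Cardinal.mk_le_of_injective hf)

theorem IsCl.eq_of_denseIn {Y F G S : Set (Pt A)} (hF : IsCl Y F) (hG : IsCl Y G)
    (h1 : DenseIn S F) (h2 : DenseIn S G) : F = G := by
  have key : ∀ F G : Set (Pt A), IsCl Y F → IsCl Y G → DenseIn S F → DenseIn S G → F ⊆ G := by
    intro F G hF hG h1 h2 x hx
    by_contra hn
    obtain ⟨a, ha, hd⟩ := hG.2 x (hF.1 hx) hn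
    obtain ⟨y, hy, hyS⟩ := h1.2 a ⟨x, ha, hx⟩
    exact Set.disjoint_left.1 hd hy (h2.1 hyS)
  exact (key F G hF hG h1 h2).antisymm (key G F hG hF h2 h1)

theorem mk_sep_closed_le (Y : Set (Pt A)) (δ : Cardinal.{u}) :
    #{F : Cl Y // Sep F.1 δ} ≤ max #Y ℵ₀ ^ δ := by
  refine le_trans ?_ (mk_bounded_subset_le Y δ)
  refine Cardinal.mk_le_of_injective
    (f := fun F => ⟨F.2.choose, F.2.choose_spec.1.1.trans F.1.2.1, F.2.choose_spec.2⟩) ?_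
  intro F G h
  have h : F.2.choose = G.2.choose := congrArg Subtype.val h
  apply Subtype.ext
  apply Subtype.ext
  exact F.1.2.eq_of_denseIn G.1.2 F.2.choose_spec.1 (h ▸ G.2.choose_spec.1)

/-- Every subspace has a dense subset of fewer than L points, by `two_power_le_sub`, and a closed
set is determined by a dense subset. Each #Y ^ δ with δ < L is below μ; what has to be excluded is
that these powers approach μ while all of them are needed. -/
theorem mk_Cl_lt_of_sep {μ L : Cardinal.{u}} {s : ℕ → Cardinal.{u}} (hs : ∀ n, s n < μ)
    (hcof : ∀ ε < μ, ∃ n, ε < s n) (hL : ℵ₀ < L)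
    (hsub : #(BooleanSubalgebra A) < 2 ^ L) {Y : Set (Pt A)} (hY : ℵ₀ ≤ #Y)
    (hYL : ∀ δ < L, #Y ^ δ < μ) : #(Cl Y) < μ := by
  have hmax : max #Y ℵ₀ = #Y := max_eq_left hY
  have hdense : ∀ F : Set (Pt A), ∃ δ < L, Sep F δ := by
    intro F
    by_contra hn
    push Not at hn
    refine hsub.not_ge (two_power_le_sub hL (F := F) fun S hS => ?_)
    by_contra hlt
    exact hn _ (not_le.1 hlt) ⟨S, hS, le_rfl⟩
  by_cases hr : Rich L (Set.univ : Set (Pt A))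
  · by_cases hb : ∃ ν < μ, ∀ δ < L, #Y ^ δ ≤ ν
    · obtain ⟨ν, hν, hb⟩ := hb
      refine lt_of_le_of_lt ?_ hν
      have hLν : L ≤ ν := le_of_forall_lt fun δ hδ => (cantor δ).trans_le
        ((power_le_power_right ((natCast_lt_aleph0 (n := 2)).le.trans hY)).trans (hb δ hδ))
      have hνω : ℵ₀ ≤ ν := hL.le.trans hLν
      have h1 : (Set.univ : Set (Cl Y)) ⊆
          ⋃ i : L.ord.ToType, {F : Cl Y | Sep F.1 #(Set.Iio i)} := by
        intro F _
        obtain ⟨δ, hδ, hF⟩ := hdense F.1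
        obtain ⟨i, hi⟩ := exists_mk_Iio_eq hδ
        exact Set.mem_iUnion.2 ⟨i, by rw [Set.mem_ofPred_eq, hi]; exact hF⟩
      rw [← mk_univ]
      refine (mk_le_mk_of_subset h1).trans ((mk_iUnion_le _).trans ?_)
      rw [mk_ord_toType]
      refine (mul_le_mul' hLν (ciSup_le' fun i => ?_)).trans (mul_eq_self hνω).le
      exact (mk_sep_closed_le Y _).trans (by rw [hmax]; exact hb _ (mk_Iio_toType i))
    -- Powers unbounded in μ make the exponents `d n` cofinal in L. Then L has countable cofinality,
    -- and richness gives a subspace of density at least L, hence 2 ^ L subalgebras.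
    · exfalso
      push Not at hb
      have h1 : ∀ n, ∃ δ < L, s n < #Y ^ δ := fun n => hb _ (hs n)
      choose d hd hsd using h1
      obtain ⟨δ, h1, h2, h3, h4⟩ := exists_monotone_cofinal hL hd (fun ε hε => by
        obtain ⟨n, hn⟩ := hcof _ (hYL ε hε)
        refine ⟨n, ?_⟩
        by_contra hle
        have h5 := power_le_power_left (aleph0_pos.trans_le hY).ne' (not_lt.1 hle)
        exact (hn.trans (hsd n)).not_ge h5)
      obtain ⟨F, hF⟩ := exists_le_mk_denseIn h1 h2 h3 h4 hr
      exact hsub.not_ge (two_power_le_sub hL hF)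
  · simp only [Rich, not_forall, not_exists, not_and, not_not] at hr
    obtain ⟨ε, hε, hF⟩ := hr
    refine lt_of_le_of_lt ?_ (hYL ε hε)
    refine le_trans ?_ ((mk_sep_closed_le Y ε).trans (by rw [hmax]))
    exact Cardinal.mk_le_of_injective (f := fun F => ⟨F, hF F.1 (Set.subset_univ _)⟩)
      fun F G h => congrArg Subtype.val h

/-- Intersections of families of clopen sets. -/
def interPts {ι : Type u} (s : ι → A) : Set (Pt A) := ⋂ i, pts (s i)

theorem mem_interPts {ι : Type u} {s : ι → A} {x : Pt A} :
    x ∈ interPts s ↔ ∀ i, x ∈ pts (s i) := Set.mem_iInter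

theorem mem_interPts_inf {ι : Type u} [Nonempty ι] {s : ι → A} {a : A} {x : Pt A} :
    (x ∈ interPts fun i => s i ⊓ a) ↔ x ∈ interPts s ∧ x ∈ pts a := by
  simp only [mem_interPts, mem_pts_inf]
  exact ⟨fun h => ⟨fun i => (h i).1, (h (Classical.arbitrary ι)).2⟩, fun h i => ⟨h.1 i, h.2⟩⟩

/-- A small set of points that meets intersections of clopen sets in many points. -/
theorem exists_sample (ι : Type u) (Y : Set (Pt A)) {ρ : Cardinal.{u}} (hρ : ℵ₀ ≤ ρ)
    (hA : #A ^ #ι ≤ ρ) : ∃ Z ⊆ Y, #Z ≤ Order.succ ρ ∧ ∀ s : ι → A,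
      (#(↥(interPts s ∩ Y)) ≤ ρ → interPts s ∩ Y ⊆ Z) ∧
      (ρ < #(↥(interPts s ∩ Y)) → ρ < #(↥(interPts s ∩ Z))) := by
  have h1 : ∀ s : ι → A, ∃ Z ⊆ interPts s ∩ Y, #Z ≤ Order.succ ρ ∧
      (#(↥(interPts s ∩ Y)) ≤ ρ → Z = interPts s ∩ Y) ∧ (ρ < #(↥(interPts s ∩ Y)) → ρ < #Z) := by
    intro s
    rcases le_or_gt #(↥(interPts s ∩ Y)) ρ with h | h
    · exact ⟨_, le_rfl, h.trans (Order.le_succ ρ), fun _ => rfl, fun h => h⟩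
    · obtain ⟨Z, hZ, hc⟩ := le_mk_iff_exists_subset.1 (Order.succ_le_of_lt h)
      exact ⟨Z, hZ, hc.le, fun h' => absurd h h'.not_gt, fun _ => hc ▸ Order.lt_succ ρ⟩
  choose Z hZ hc h2 h3 using h1
  refine ⟨⋃ s, Z s, Set.iUnion_subset fun s => (hZ s).trans Set.inter_subset_right, ?_,
    fun s => ⟨fun h => ?_, fun h => ?_⟩⟩
  · refine (mk_iUnion_le _).trans ((mul_le_mul' ?_ (ciSup_le' hc)).trans
      (mul_eq_self (hρ.trans (Order.le_succ ρ))).le)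
    rw [mk_arrow, lift_id, lift_id]
    exact hA.trans (Order.le_succ ρ)
  · rw [← h2 s h]; exact Set.subset_iUnion Z s
  · exact (h3 s h).trans_le (mk_le_mk_of_subset (Set.subset_inter
      ((hZ s).trans Set.inter_subset_left) (Set.subset_iUnion Z s)))

/-- The points of `F` that are limits of many points of `Y \ F`. -/
def deepPts (ι : Type u) (ρ : Cardinal.{u}) (Y F : Set (Pt A)) : Set (Pt A) :=
  {z ∈ F | ∀ s : ι → A, z ∈ interPts s → ρ < #(↥(interPts s ∩ (Y \ F)))}

/-- A closed F is recovered from its trace on the sample Z and a set W accumulating at its deep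
points. Let y ∈ F have a neighbourhood a missing G. If y is deep, a meets W. If not, some
intersection of clopen sets around y, inside a, has at most ρ points of Y outside F; so either y
itself is in Z, or the sample has a point of F there. Either contradicts the equality of the traces.
-/
theorem subset_of_sample {ι : Type u} [Nonempty ι] {ρ : Cardinal.{u}} {Y Z W F G : Set (Pt A)}
    (hF : IsCl Y F) (hG : IsCl Y G) (hZY : Z ⊆ Y)
    (hZ : ∀ s : ι → A, (#(↥(interPts s ∩ Y)) ≤ ρ → interPts s ∩ Y ⊆ Z) ∧
      (ρ < #(↥(interPts s ∩ Y)) → ρ < #(↥(interPts s ∩ Z))))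
    (hd : ∀ z ∈ deepPts ι ρ Y F, ∀ a, z ∈ pts a → (pts a ∩ W).Nonempty) (hWG : W ⊆ G)
    (hFG : F ∩ Z = G ∩ Z) : F ⊆ G := by
  intro y hy
  by_contra hyG
  obtain ⟨a, ha, hdis⟩ := hG.2 y (hF.1 hy) hyG
  by_cases hyd : y ∈ deepPts ι ρ Y F
  · obtain ⟨w, hw, hwW⟩ := hd y hyd a ha
    exact Set.disjoint_left.1 hdis hw (hWG hwW)
  · have hn : ¬ ∀ s : ι → A, y ∈ interPts s → ρ < #(↥(interPts s ∩ (Y \ F))) :=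
      fun h => hyd ⟨hy, h⟩
    push Not at hn
    obtain ⟨s, hs, hle⟩ := hn
    have hyt : y ∈ interPts fun i => s i ⊓ a := mem_interPts_inf.2 ⟨hs, ha⟩
    obtain ⟨h1, h2⟩ := hZ fun i => s i ⊓ a
    rcases le_or_gt #(↥(interPts (fun i => s i ⊓ a) ∩ Y)) ρ with h | h
    · have hyZ : y ∈ F ∩ Z := ⟨hy, h1 h ⟨hyt, hF.1 hy⟩⟩
      rw [hFG] at hyZ
      exact hyG hyZ.1
    · obtain ⟨w, hw, hwF⟩ : ∃ w ∈ interPts (fun i => s i ⊓ a) ∩ Z, w ∈ F := by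
        by_contra hn
        push Not at hn
        refine (h2 h).not_ge ((mk_le_mk_of_subset fun w hw => ?_).trans hle)
        exact ⟨(mem_interPts_inf.1 hw.1).1, hZY hw.2, hn w hw⟩
      have hwG : w ∈ F ∩ Z := ⟨hwF, hw.2⟩
      rw [hFG] at hwG
      exact Set.disjoint_left.1 hdis (mem_interPts_inf.1 hw.1).2 hwG.1

/-- If for each closed F the choice of deep points stops at some i, the points chosen so far
accumulate at all remaining deep points, and F is coded by i, these points and F ∩ Z i. There are
too few codes. -/
theorem exists_deep_sequence {ι : Type u} [LinearOrder ι] [WellFoundedLT ι] [Nonempty ι]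
    {ρ : ι → Cardinal.{u}} {Y : Set (Pt A)} {Z : ι → Set (Pt A)} (hZY : ∀ i, Z i ⊆ Y)
    (hZ : ∀ i, ∀ s : ι → A, (#(↥(interPts s ∩ Y)) ≤ ρ i → interPts s ∩ Y ⊆ Z i) ∧
      (ρ i < #(↥(interPts s ∩ Y)) → ρ i < #(↥(interPts s ∩ Z i))))
    {ν ν' : Cardinal.{u}} (hν : ∀ i : ι, #Y ^ #(Set.Iio i) ≤ ν) (hν' : ∀ i, #(Cl (Z i)) ≤ ν')
    (hlt : #ι * (ν * ν') < #(Cl Y)) :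
    ∃ F, IsCl Y F ∧ ∃ z : ι → Pt A, ∀ i, z i ∈ deepPts ι (ρ i) Y F ∧
      ∃ a, z i ∈ pts a ∧ ∀ j < i, z j ∉ pts a := by
  by_contra hn
  refine hlt.not_ge ?_
  -- The recursion needs a default point, so the degenerate empty space is treated apart.
  rcases isEmpty_or_nonempty (Pt A) with he | he
  · have h1 : ∀ F G : Cl Y, F = G := fun F G => Subtype.ext (by
      rw [Set.eq_empty_of_isEmpty F.1, Set.eq_empty_of_isEmpty G.1])
    have h2 : #(Cl Y) ≤ 1 := le_one_iff_subsingleton.2 ⟨h1⟩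
    have e1 : (1 : Cardinal.{u}) ≤ #ι := Cardinal.one_le_iff_ne_zero.2 (mk_ne_zero ι)
    obtain ⟨i⟩ := ‹Nonempty ι›
    have e2 : (1 : Cardinal.{u}) ≤ ν := by
      obtain ⟨m, hm⟩ : ∃ m : ι, #(Set.Iio m) = 0 := by
        obtain ⟨m, -, hm⟩ := (wellFounded_lt (α := ι)).has_min Set.univ ⟨i, trivial⟩
        refine ⟨m, mk_eq_zero_iff.2 ⟨fun x => hm x.1 trivial x.2⟩⟩
      have := hν m
      rwa [hm, power_zero] at this
    have e3 : (1 : Cardinal.{u}) ≤ ν' := by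
      refine le_trans (Cardinal.one_le_iff_ne_zero.2 ?_) (hν' i)
      rw [mk_ne_zero_iff]
      exact ⟨⟨Z i, le_rfl, fun z hz h => absurd hz h⟩⟩
    calc #(Cl Y) ≤ 1 * (1 * 1) := by simpa using h2
      _ ≤ _ := mul_le_mul' e1 (mul_le_mul' e2 e3)
  have h1 : ∀ F : Cl Y, ∃ (i : ι) (f : Set.Iio i → Y), (∀ j, (f j).1 ∈ F.1) ∧
      ∀ z ∈ deepPts ι (ρ i) Y F.1, ∀ a, z ∈ pts a →
        (pts a ∩ Set.range fun j => (f j).1).Nonempty := by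
    intro F
    by_contra hF
    push Not at hF
    apply hn
    refine ⟨F.1, F.2, exists_rec_choice (fun i z x => x ∈ deepPts ι (ρ i) Y F.1 ∧
      ∃ a, x ∈ pts a ∧ ∀ j < i, z j ∉ pts a) ?_ ?_⟩
    · rintro i f g x hfg ⟨h1, a, h3, h4⟩
      exact ⟨h1, a, h3, fun j hj => hfg j hj ▸ h4 j hj⟩
    · intro i f hf
      obtain ⟨z, hz, a, ha, he⟩ := hF i (fun j => ⟨f j, F.2.1 (hf j j.2).1.1⟩)
        fun j => (hf j j.2).1.1
      refine ⟨z, hz, a, ha, fun j hj hja => ?_⟩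
      have : f j ∈ pts a ∩ Set.range fun j : Set.Iio i => f j := ⟨hja, ⟨j, hj⟩, rfl⟩
      rw [he] at this
      exact this
  choose i f hfF hfd using h1
  have h2 : #(Cl Y) ≤ #(Σ i : ι, (Set.Iio i → Y) × Cl (Z i)) := by
    refine Cardinal.mk_le_of_injective
      (f := fun F => ⟨i F, f F, ⟨F.1 ∩ Z (i F), F.2.inter (hZY _)⟩⟩) ?_
    intro F G h
    obtain ⟨hi, h⟩ := Sigma.mk.inj_iff.1 h
    have hfF1 := hfF F
    have hfd1 := hfd F
    have hfG1 := hfF G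
    have hfd2 := hfd G
    generalize f F = fF at *
    generalize f G = fG at *
    generalize i F = iF at *
    generalize i G = iG at *
    subst hi
    have h := eq_of_heq h
    obtain ⟨h3, h4⟩ := Prod.mk.inj h
    have h4 : F.1 ∩ Z iF = G.1 ∩ Z iF := congrArg Subtype.val h4
    subst h3
    apply Subtype.ext
    refine Set.Subset.antisymm ?_ ?_
    · exact subset_of_sample F.2 G.2 (hZY iF) (hZ iF) hfd1 (Set.range_subset_iff.2 hfG1) h4
    · exact subset_of_sample G.2 F.2 (hZY iF) (hZ iF) hfd2 (Set.range_subset_iff.2 hfF1) h4.symm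
  refine h2.trans ?_
  rw [mk_sigma]
  refine (sum_le_sum _ (fun _ => ν * ν') fun i => ?_).trans (sum_const' _ _).le
  rw [mk_prod, lift_id, lift_id, mk_arrow, lift_id, lift_id]
  exact mul_le_mul' (hν i) (hν' i)

/-- Near each z i there are many points of Y off F. Clopen sets e i avoiding F capture more than ρ i
of them in mutually separated regions G i, and one point of each region is chosen independently. -/
theorem prod_le_mk_ideal_of_deep {ι : Type u} [LinearOrder ι] [WellFoundedLT ι] [Nonempty ι]
    {ρ : ι → Cardinal.{u}} (hρ : ∀ i, ℵ₀ ≤ ρ i) (hA : ∀ i, #A ^ #ι ≤ ρ i)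
    {Y F : Set (Pt A)} (hF : IsCl Y F)
    {z : ι → Pt A} (hz : ∀ i, z i ∈ deepPts ι (ρ i) Y F ∧ ∃ a, z i ∈ pts a ∧ ∀ j < i, z j ∉ pts a)
    {s : ι → Cardinal.{u}} (hs : ∀ i, s i ≤ Order.succ (ρ i)) : prod s ≤ #(Order.Ideal A) := by
  classical
  have hdeep := fun i => (hz i).1
  choose c hc hcz using fun i => (hz i).2
  -- There are at most #A ^ #ι ≤ ρ i relevant intersections, hence at most ρ i such points. Around a
  -- point of Y outside `N i` every such intersection has more than ρ i points of Y.
  let N : ι → Set (Pt A) := fun i => {y ∈ Y | ∃ s : ι → A, y ∈ interPts s ∧ #(↥(interPts s ∩ Y)) ≤ ρ i}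
  have hN : ∀ i, #(N i) ≤ ρ i := by
    intro i
    have hsub : N i ⊆ ⋃ s : {s : ι → A // #(↥(interPts s ∩ Y)) ≤ ρ i}, (interPts s.1 ∩ Y) := by
      rintro y ⟨hy, s, hs, hle⟩
      exact Set.mem_iUnion.2 ⟨⟨s, hle⟩, hs, hy⟩
    refine (mk_le_mk_of_subset hsub).trans ((mk_iUnion_le _).trans ?_)
    refine (mul_le_mul' ((mk_subtype_le _).trans ?_) (ciSup_le' fun s => s.2)).trans
      (mul_eq_self (hρ i)).le
    rw [mk_arrow, lift_id, lift_id]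
    exact hA i
  -- The intersection over j is `c i` without the earlier e j and the later c j. It contains z i,
  -- because e j misses F and c j misses the earlier points; and it uses e only below i, as the
  -- recursion requires.
  let h : (ι → A) → ι → ι → A := fun e i j =>
    c i ⊓ if j < i then (e j)ᶜ else if i < j then (c j)ᶜ else ⊤
  have hmem : ∀ e i x, x ∈ interPts (h e i) ↔
      x ∈ pts (c i) ∧ (∀ j < i, x ∉ pts (e j)) ∧ ∀ j > i, x ∉ pts (c j) := by
    intro e i x
    rw [mem_interPts]
    constructor
    · intro H
      refine ⟨(mem_pts_inf.1 (H i)).1, fun j hj => ?_, fun j hj => ?_⟩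
      · have := (mem_pts_inf.1 (H j)).2
        rwa [if_pos hj, mem_pts_compl] at this
      · have := (mem_pts_inf.1 (H j)).2
        rwa [if_neg (not_lt.2 (le_of_lt hj)), if_pos hj, mem_pts_compl] at this
    · rintro ⟨h1, h2, h3⟩ j
      refine mem_pts_inf.2 ⟨h1, ?_⟩
      split_ifs with hj hj'
      · exact mem_pts_compl.2 (h2 j hj)
      · exact mem_pts_compl.2 (h3 j hj')
      · exact mem_pts_top
  obtain ⟨e, he⟩ := exists_rec_choice (ι := ι) (α := A)
    (fun i e a => Disjoint (pts a) F ∧ ∃ x ∈ Y, x ∈ pts a ∧ x ∈ interPts (h e i) ∧ x ∉ N i)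
    (by
      rintro i f g a hfg ⟨h1, x, h2, h3, h4, h5⟩
      refine ⟨h1, x, h2, h3, ?_, h5⟩
      rw [hmem] at h4 ⊢
      exact ⟨h4.1, fun j hj => hfg j hj ▸ h4.2.1 j hj, h4.2.2⟩)
    (by
      intro i e hd
      have hzi : z i ∈ interPts (h e i) := by
        rw [hmem]
        exact ⟨hc i, fun j hj hj' => Set.disjoint_left.1 (hd j hj).1 hj' (hdeep i).1,
          fun j hj => hcz j i hj⟩
      have hlt := (hdeep i).2 _ hzi
      obtain ⟨x, hx, hxN⟩ : ∃ x ∈ interPts (h e i) ∩ (Y \ F), x ∉ N i := by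
        by_contra hn
        push Not at hn
        exact hlt.not_ge ((mk_le_mk_of_subset hn).trans (hN i))
      obtain ⟨a, ha, hdis⟩ := hF.2 x hx.2.1 hx.2.2
      exact ⟨a, hdis, x, hx.2.1, ha, hx.1, hxN⟩)
  let G : ι → Set (Pt A) := fun i => interPts (fun j => h e i j ⊓ e i) ∩ Y
  have hG : ∀ i, ρ i < #(G i) := by
    intro i
    obtain ⟨-, x, hxY, hxe, hxh, hxN⟩ := he i
    by_contra hle
    exact hxN ⟨hxY, _, mem_interPts_inf.2 ⟨hxh, hxe⟩, not_lt.1 hle⟩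
  obtain ⟨f, hf⟩ := exists_injective_pi_ideal (fun i => e i ⊓ c i) G
    (by
      rintro i x ⟨hx, -⟩
      obtain ⟨h1, h2⟩ := mem_interPts_inf.1 hx
      exact mem_pts_inf.2 ⟨h2, ((hmem _ _ _).1 h1).1⟩)
    (by
      intro i j hij
      rw [Set.disjoint_left]
      rintro x ⟨hx, -⟩ hxj
      obtain ⟨h1, h2⟩ := mem_interPts_inf.1 hx
      rw [hmem] at h1
      rw [mem_pts_inf] at hxj
      rcases lt_or_gt_of_ne hij with h | h
      · exact h1.2.2 j h hxj.2
      · exact h1.2.1 j h hxj.1)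
  refine le_trans ?_ (Cardinal.mk_le_of_injective hf)
  rw [mk_pi]
  exact prod_le_prod _ _ fun i => (hs i).trans (Order.succ_le_of_lt (hG i))

end ManyClosedSets

end ShelahBA
namespace ShelahBA

/-! ### The ℵ₀-th power of the number of ideals -/

section IdealPower

variable {A : Type u} [BooleanAlgebra A]

/-- The least χ with μ ≤ χ ^ κ is closed under κ-th powers and has a cofinal family of length κ but
no shorter one. As κ is uncountable and μ has countable cofinality, bounds below μ become uniform,
so a deep sequence exists. It gives χ ^ κ = (χ ^ κ) ^ ℵ₀ ideals. -/
theorem power_le_mk_ideal_of_closed [Infinite A] {μ κ : Cardinal.{u}} {s : ℕ → Cardinal.{u}}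
    (hs : ∀ n, s n < μ) (hcof : ∀ ε < μ, ∃ n, ε < s n) {Y : Set (Pt A)} (hYμ : #Y < μ)
    (hκω : ℵ₀ < κ) (hκ : μ ≤ #Y ^ κ) (hmin : ∀ θ < κ, #Y ^ θ < μ) (hAκ : #A ^ κ < μ)
    (hZ : ∀ Z : Set (Pt A), #Z < #Y → #(Cl Z) < μ) (hCl : μ ≤ #(Cl Y)) :
    μ ^ ℵ₀ ≤ #(Order.Ideal A) := by
  have hAω : ℵ₀ ≤ #A := Cardinal.infinite_iff.1 inferInstance
  have hκκ : κ * κ = κ := mul_eq_self hκω.le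
  obtain ⟨χ, hχ, hχmin⟩ := (wellFounded_lt (α := Cardinal.{u})).has_min {χ | μ ≤ χ ^ κ} ⟨_, hκ⟩
  have hχ : μ ≤ χ ^ κ := hχ
  have hχmin : ∀ ρ < χ, ρ ^ κ < μ := fun ρ hρ => not_le.1 fun h => hχmin ρ h hρ
  have hχY : χ ≤ #Y := not_lt.1 fun h => (hχmin _ h).not_ge hκ
  have hpow : ∀ ρ, ρ ^ κ < μ → ρ ^ κ < χ := by
    intro ρ hρ
    by_contra h
    have h1 : χ ^ κ ≤ (ρ ^ κ) ^ κ := power_le_power_right (not_lt.1 h)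
    rw [← power_mul, hκκ] at h1
    exact (hχ.trans h1).not_gt hρ
  have hρ : ∀ ρ < χ, ρ ^ κ < χ := fun ρ h => hpow ρ (hχmin ρ h)
  have hAχ : #A ^ κ < χ := hpow _ hAκ
  have hA1 : #A ≤ #A ^ κ := self_le_power _ (one_lt_aleph0.le.trans hκω.le)
  have hAκω : ℵ₀ ≤ #A ^ κ := hAω.trans hA1
  have hχω : ℵ₀ ≤ χ := hAκω.trans hAχ.le
  have hκχ : κ < χ := ((cantor κ).trans_le (power_le_power_right
    ((natCast_lt_aleph0 (n := 2)).le.trans hAω))).trans hAχ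
  have hμω : ℵ₀ ≤ μ := hχω.trans (hχY.trans hYμ.le)
  let ι := κ.ord.ToType
  have hι : #ι = κ := mk_ord_toType κ
  have hιω : ℵ₀ ≤ #ι := hι ▸ hκω.le
  have : Nonempty ι := mk_ne_zero_iff.1 (aleph0_pos.trans_le hιω).ne'
  obtain ⟨e⟩ := exists_equiv_prod hιω
  obtain ⟨f, hf⟩ := exists_cofinal_of_lt_power (ι := ι) hχω
    (fun ρ h => by rw [hι]; exact (hρ ρ h).le) (by rw [hι]; exact (hχY.trans_lt hYμ).trans_le hχ)
  have hr : ∀ i, #(Set.Iic (f i)) < χ := fun i => mk_Iic_toType hχω _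
  have hrsum := le_sum_of_cofinal hf
  have hsucc : ∀ ρ < χ, Order.succ ρ < χ := by
    intro ρ hρχ
    by_contra h
    have h1 : ∀ i, #(Set.Iic (f i)) ≤ ρ := fun i =>
      Order.lt_succ_iff.1 ((hr i).trans_le (not_lt.1 h))
    have h2 := hrsum.trans ((sum_le_sum _ (fun _ => ρ) h1).trans (sum_const' _ _).le)
    rw [hι] at h2
    exact h2.not_gt (mul_lt_of_lt hχω hκχ hρχ)
  -- A shorter family with sum χ would reduce the exponent, giving μ ≤ χ ^ #J ≤ #Y ^ #J against the
  -- minimality of κ.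
  have hsum : ∀ (J : Type u) (t : J → Cardinal.{u}), #J < κ → (∀ j, t j < χ) → sum t < χ := by
    intro J t hJ ht
    by_contra h
    have h1 := power_le_power_of_le_sum (κ := κ) (not_lt.1 h) fun j => (hρ _ (hsucc _ (ht j))).le
    exact (hχ.trans (h1.trans (power_le_power_right hχY))).not_gt (hmin _ hJ)
  have hnat : #(ULift.{u} ℕ) < κ := by simpa using hκω
  -- Otherwise a countable union of counterexamples, still smaller than χ, would have at least μ
  -- closed subsets.
  obtain ⟨ν', hν'μ, hν'⟩ : ∃ ν' < μ, ∀ Z ⊆ Y, #Z < χ → #(Cl Z) ≤ ν' := by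
    by_contra hn
    push Not at hn
    choose Z hZY hZχ hZs using fun n => hn (s n) (hs n)
    have h1 : #(↥(⋃ n : ULift.{u} ℕ, Z n.down)) < χ :=
      mk_iUnion_le_sum_mk.trans_lt (hsum _ _ hnat fun n => hZχ n.down)
    obtain ⟨n, hn⟩ := hcof _ (hZ _ (h1.trans_le hχY))
    exact (hn.trans (hZs n)).not_ge
      (mk_Cl_mono (Set.subset_iUnion (fun n : ULift.{u} ℕ => Z n.down) ⟨n⟩))
  obtain ⟨ν, hνμ, hν⟩ : ∃ ν < μ, ∀ i : ι, #Y ^ #(Set.Iio i) ≤ ν := by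
    by_contra hn
    push Not at hn
    choose k hk using fun n => hn (s n) (hs n)
    -- If the k n were unbounded, χ would be covered by countably many unions of fewer than κ proper
    -- initial segments, contrary to `hsum`.
    obtain ⟨i, hi⟩ : ∃ i, ∀ n, k n ≤ i := by
      by_contra hn
      push Not at hn
      have h1 : (Set.univ : Set χ.ord.ToType) ⊆
          ⋃ n : ULift.{u} ℕ, ⋃ j : Set.Iio (k n.down), Set.Iic (f j) := by
        intro m _
        obtain ⟨i, hi⟩ := hf m
        obtain ⟨n, hn⟩ := hn i
        exact Set.mem_iUnion.2 ⟨⟨n⟩, Set.mem_iUnion.2 ⟨⟨i, hn⟩, hi⟩⟩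
      have h2 := mk_le_mk_of_subset h1
      rw [mk_univ, mk_ord_toType] at h2
      refine h2.not_gt (mk_iUnion_le_sum_mk.trans_lt (hsum _ _ hnat fun n => ?_))
      exact mk_iUnion_le_sum_mk.trans_lt (hsum _ _ (mk_Iio_toType _) fun j => hr j)
    obtain ⟨n, hn⟩ := hcof _ (hmin _ (mk_Iio_toType i))
    refine (hn.trans (hk n)).not_ge (power_le_power_left ?_ (mk_le_mk_of_subset
      (Set.Iio_subset_Iio (hi n))))
    exact (aleph0_pos.trans_le (hχω.trans hχY)).ne'
  -- Each segment size is repeated κ times, so that the product of the successors reaches χ ^ κ; #A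
  -- ^ κ bounds the number of κ-fold intersections of clopen sets.
  let ρ : ι → Cardinal.{u} := fun i => max #(Set.Iic (f (e i).1)) (#A ^ κ)
  have hρχ : ∀ i, ρ i < χ := fun i => max_lt (hr _) hAχ
  have hρω : ∀ i, ℵ₀ ≤ ρ i := fun i => hAκω.trans (le_max_right _ _)
  have hρA : ∀ i, #A ^ #ι ≤ ρ i := fun i => by rw [hι]; exact le_max_right _ _
  choose Z hZY hZc hZs using fun i => exists_sample ι Y (hρω i) (hρA i)
  obtain ⟨F, hF, z, hz⟩ := exists_deep_sequence hZY hZs hν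
    (fun i => hν' _ (hZY i) ((hZc i).trans_lt (hsucc _ (hρχ i)))) (by
      rw [hι]
      exact (mul_lt_of_lt hμω (hκχ.trans_le (hχY.trans hYμ.le))
        (mul_lt_of_lt hμω hνμ hν'μ)).trans_le hCl)
  have h1 := prod_le_mk_ideal_of_deep hρω hρA hF hz (s := fun i => Order.succ (ρ i)) fun i => le_rfl
  have h2 := power_le_prod e (s := fun i => Order.succ (ρ i)) hrsum
    fun i => Order.lt_succ_of_le (le_max_left _ _)
  rw [hι] at h2
  refine le_trans ?_ (h2.trans h1)
  calc μ ^ ℵ₀ ≤ (χ ^ κ) ^ ℵ₀ := power_le_power_right hχ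
    _ = χ ^ κ := by rw [← power_mul, mul_eq_left hκω.le hκω.le aleph0_ne_zero]

/-- The number of ideals to the power `ℵ₀` is at most the number of subalgebras. -/
theorem mk_ideal_power_le_sub [Infinite A] :
    #(Order.Ideal A) ^ ℵ₀ ≤ #(BooleanSubalgebra A) := by
  by_contra hcon
  have hcon := not_le.1 hcon
  have hAω : ℵ₀ ≤ #A := Cardinal.infinite_iff.1 inferInstance
  have hω2 : ∀ c : Cardinal.{u}, (c ^ ℵ₀) ^ ℵ₀ = c ^ ℵ₀ := fun c => by
    rw [← power_mul, aleph0_mul_aleph0]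
  have hidσ := mk_ideal_le_sub (A := A)
  have h2σ := (continuum_le_mk_ideal (A := A)).trans hidσ
  obtain ⟨μ, hμ, hμmin⟩ := (wellFounded_lt (α := Cardinal.{u})).has_min
    {μ | #(Order.Ideal A) ≤ μ ^ ℵ₀}
    ⟨#(Order.Ideal A), self_le_power (#(Order.Ideal A)) one_le_aleph0⟩
  have hμ : #(Order.Ideal A) ≤ μ ^ ℵ₀ := hμ
  have hμmin : ∀ ν < μ, ν ^ ℵ₀ < #(Order.Ideal A) := fun ν h => not_le.1 fun h' => hμmin ν h' h
  have hμid : μ ≤ #(Order.Ideal A) :=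
    not_lt.1 fun h => (hμmin _ h).not_ge (self_le_power _ one_le_aleph0)
  have hσμ : #(BooleanSubalgebra A) < μ ^ ℵ₀ := by
    refine hcon.trans_le ?_
    rw [← hω2 μ]
    exact power_le_power_right hμ
  -- Applied to ν = 2 ^ c with c infinite, where ν ^ ℵ₀ = ν.
  have hbig : ∀ ν, μ ≤ ν → ν ^ ℵ₀ ≤ #(BooleanSubalgebra A) → False := fun ν h h' =>
    hσμ.not_ge ((power_le_power_right h).trans h')
  have hpow : ∀ ν < μ, ν ^ ℵ₀ < μ := by
    intro ν hν
    by_contra h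
    refine (hμmin ν hν).not_ge (hμ.trans ?_)
    rw [← hω2 ν]
    exact power_le_power_right (not_lt.1 h)
  have h2ω : (2 : Cardinal.{u}) ^ (ℵ₀ : Cardinal.{u}) < μ := by
    by_contra h
    exact hbig _ (not_lt.1 h) (by rw [hω2]; exact h2σ)
  have hωμ : ℵ₀ < μ := (cantor ℵ₀).trans h2ω
  -- Since μ < μ ^ ℵ₀ while ν ^ ℵ₀ < μ for all ν < μ, some function from ℕ is cofinal in μ.
  obtain ⟨s, hs, hcof, hsm, hsω⟩ : ∃ s : ℕ → Cardinal.{u}, (∀ n, s n < μ) ∧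
      (∀ ε < μ, ∃ n, ε < s n) ∧ Monotone s ∧ ∀ n, ℵ₀ ≤ s n := by
    have hU : #(ULift.{u} ℕ) = ℵ₀ := by simp
    obtain ⟨f, hf⟩ := exists_cofinal_of_lt_power (ι := ULift.{u} ℕ) hωμ.le
      (fun ρ h => by rw [hU]; exact (hpow ρ h).le)
      (by rw [hU]; exact (hμid.trans hidσ).trans_lt hσμ)
    refine exists_monotone_cofinal hωμ (d := fun n => #(Set.Iic (f ⟨n⟩)))
      (fun n => mk_Iic_toType hωμ.le _) fun ε hε => ?_
    by_contra hn
    push Not at hn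
    have h1 := (le_sum_of_cofinal hf).trans
      ((sum_le_sum _ (fun _ => ε) fun i : ULift.{u} ℕ => hn i.down).trans (sum_const' _ _).le)
    rw [hU] at h1
    exact h1.not_gt (mul_lt_of_lt hωμ.le hωμ hε)
  -- d is the density of the whole Stone space, or ℵ₀ if that is larger; an element is determined by
  -- its trace on a dense set.
  obtain ⟨d, hdω, hdσ, hAd⟩ : ∃ d : Cardinal.{u}, ℵ₀ ≤ d ∧ 2 ^ d ≤ #(BooleanSubalgebra A) ∧
      #A ≤ 2 ^ d := by
    obtain ⟨D, hD, hDmin⟩ := (InvImage.wf (fun D : Set (Pt A) => #D)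
      (wellFounded_lt (α := Cardinal.{u}))).has_min {D | DenseIn D (Set.univ : Set (Pt A))}
      ⟨_, le_rfl, fun _ h => h⟩
    have hAD : #A ≤ 2 ^ #D := by
      rw [← mk_set]
      refine Cardinal.mk_le_of_injective (f := fun a : A => {x : D | x.1 ∈ pts a}) fun a b h => ?_
      have key : ∀ a b : A, {x : D | x.1 ∈ pts a} ⊆ {x : D | x.1 ∈ pts b} → a ≤ b := by
        intro a b hab
        rw [← sdiff_eq_bot_iff]
        by_contra hne
        obtain ⟨x, hx⟩ := exists_pt hne
        obtain ⟨y, hy, hyD⟩ := hD.2 _ ⟨x, hx, trivial⟩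
        rw [mem_pts_sdiff] at hy
        exact hy.2 (hab (show (⟨y, hyD⟩ : D) ∈ _ from hy.1))
      exact le_antisymm (key a b h.le) (key b a h.ge)
    refine ⟨max #D ℵ₀, le_max_right _ _, ?_,
      hAD.trans (power_le_power_left two_ne_zero (le_max_left _ _))⟩
    rcases le_or_gt #D ℵ₀ with h | h
    · rw [max_eq_right h]; exact h2σ
    · rw [max_eq_left h.le]
      exact two_power_le_sub h fun S hS => not_lt.1 fun hlt => hDmin S hS hlt
  have hdμ : 2 ^ d < μ := by
    by_contra h
    refine hbig _ (not_lt.1 h) ?_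
    rwa [← power_mul, mul_eq_left hdω hdω aleph0_ne_zero]
  have hAμ : #A < μ := hAd.trans_lt hdμ
  obtain ⟨Y, hY, hYmin⟩ := (InvImage.wf (fun Y : Set (Pt A) => #Y)
    (wellFounded_lt (α := Cardinal.{u}))).has_min {Y | μ ≤ #(Cl Y)}
    ⟨_, hμid.trans mk_ideal_le_Cl⟩
  have hY : μ ≤ #(Cl Y) := hY
  have hYmin : ∀ Z : Set (Pt A), #Z < #Y → #(Cl Z) < μ := fun Z h =>
    not_le.1 fun h' => hYmin Z h' h
  have hYω : ℵ₀ ≤ #Y := by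
    by_contra h
    have h1 : #(Cl Y) ≤ 2 ^ #Y := by
      rw [← mk_powerset]
      exact Cardinal.mk_le_of_injective (f := fun F : Cl Y => (⟨F.1, F.2.1⟩ : 𝒫 Y))
        fun F G h => Subtype.ext (Subtype.mk.inj h)
    have h2 := power_lt_aleph0 (natCast_lt_aleph0 (n := 2)) (not_le.1 h)
    exact (hY.trans h1).not_gt (h2.trans hωμ)
  rcases le_or_gt μ #Y with hμY | hYμ
  · have h1 := power_le_mk_ideal_of_points hs hcof hsm hsω hAμ (hμY.trans (mk_set_le Y))
    exact hσμ.not_ge (h1.trans hidσ)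
  obtain ⟨L, hL, hLmin⟩ := (wellFounded_lt (α := Cardinal.{u})).has_min {L | μ ≤ 2 ^ L}
    ⟨_, (cantor μ).le⟩
  have hL : μ ≤ 2 ^ L := hL
  have hLmin : ∀ κ < L, 2 ^ κ < μ := fun κ h => not_le.1 fun h' => hLmin κ h' h
  have hLω : ℵ₀ < L := by
    by_contra h
    exact (hL.trans (power_le_power_left two_ne_zero (not_lt.1 h))).not_gt h2ω
  by_cases hκ : ∃ κ < L, μ ≤ #Y ^ κ
  · obtain ⟨κ, ⟨hκL, hκ⟩, hκmin⟩ := (wellFounded_lt (α := Cardinal.{u})).has_min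
      {κ | κ < L ∧ μ ≤ #Y ^ κ} hκ
    have hκmin : ∀ θ < κ, #Y ^ θ < μ := fun θ h =>
      not_le.1 fun h' => hκmin θ ⟨h.trans hκL, h'⟩ h
    have hκω : ℵ₀ < κ := by
      by_contra h
      exact (hκ.trans (power_le_power_left (aleph0_pos.trans_le hYω).ne' (not_lt.1 h))).not_gt
        (hpow _ hYμ)
    have hAκ : #A ^ κ < μ := by
      refine (power_le_power_right hAd).trans_lt ?_
      rw [← power_mul, mul_eq_max hdω hκω.le]
      rcases max_choice d κ with h | h
      · rw [h]; exact hdμ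
      · rw [h]; exact hLmin κ hκL
    exact hσμ.not_ge
      ((power_le_mk_ideal_of_closed hs hcof hYμ hκω hκ hκmin hAκ hYmin hY).trans hidσ)
  · push Not at hκ
    have hsub : #(BooleanSubalgebra A) < 2 ^ L := by
      by_contra h
      refine hbig _ hL ?_
      rw [← power_mul, mul_eq_left hLω.le hLω.le aleph0_ne_zero]
      exact not_lt.1 h
    exact (mk_Cl_lt_of_sep hs hcof hLω hsub hYω hκ).not_ge hY

end IdealPower

end ShelahBA
namespace ShelahBA

/-! ### Elements homogeneous for the number of subrings -/

section Homogeneous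

variable {A : Type u} [BooleanAlgebra A]

theorem mk_subring_mono {a b : A} (h : a ≤ b) : #(Subring a) ≤ #(Subring b) :=
  Cardinal.mk_le_of_injective (f := fun R : Subring a => (⟨R.1, R.2.mono h⟩ : Subring b))
    fun _ _ h => Subtype.ext (Subtype.mk.inj h)

theorem disjoint_pts_of_inf_eq_bot {a b : A} (h : a ⊓ b = ⊥) : Disjoint (pts a) (pts b) := by
  rw [Set.disjoint_left]
  intro x hx hx'
  have : x ∈ pts (a ⊓ b) := mem_pts_inf.2 ⟨hx, hx'⟩
  rw [h] at this
  exact not_mem_pts_bot this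

/-- Subrings below disjoint elements can be combined. -/
theorem mk_pi_subring_le {ι : Type u} {a : A} (b : ι → A) (hb : ∀ i, b i ≤ a)
    (hd : ∀ i j, i ≠ j → b i ⊓ b j = ⊥) : #(∀ i, Subring (b i)) ≤ #(Subring a) := by
  classical
  -- The combined subring is kept inside the ideal generated by the b i; no join of infinitely many
  -- of them is needed.
  have hR : ∀ f : ∀ i, Subring (b i), IsSubring a
      {x | (∃ s : Finset ι, x ≤ s.sup b) ∧ ∀ i, x ⊓ b i ∈ (f i).1} := by
    intro f
    refine ⟨⟨⟨∅, by simp⟩, fun i => by rw [bot_inf_eq]; exact (f i).2.bot_mem⟩, ?_, ?_, ?_⟩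
    · rintro x ⟨⟨s, hs⟩, -⟩
      exact hs.trans (Finset.sup_le fun i _ => hb i)
    · rintro x ⟨⟨s, hs⟩, hx⟩ y ⟨⟨t, ht⟩, hy⟩
      refine ⟨⟨s ∪ t, ?_⟩, fun i => ?_⟩
      · rw [Finset.sup_union]; exact sup_le_sup hs ht
      · rw [inf_sup_right]; exact (f i).2.sup_mem _ (hx i) _ (hy i)
    · rintro x ⟨⟨s, hs⟩, hx⟩ y ⟨-, hy⟩
      refine ⟨⟨s, sdiff_le.trans hs⟩, fun i => ?_⟩
      rw [inf_sdiff_distrib_right]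
      exact (f i).2.sdiff_mem _ (hx i) _ (hy i)
  refine Cardinal.mk_le_of_injective (f := fun f => (⟨_, hR f⟩ : Subring a)) ?_
  intro f g h
  have h : {x | (∃ s : Finset ι, x ≤ s.sup b) ∧ ∀ i, x ⊓ b i ∈ (f i).1} =
    {x | (∃ s : Finset ι, x ≤ s.sup b) ∧ ∀ i, x ⊓ b i ∈ (g i).1} := Subtype.mk.inj h
  have key : ∀ (f : ∀ i, Subring (b i)) (i : ι) (x : A), x ≤ b i →
      (x ∈ {x | (∃ s : Finset ι, x ≤ s.sup b) ∧ ∀ i, x ⊓ b i ∈ (f i).1} ↔ x ∈ (f i).1) := by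
    intro f i x hx
    constructor
    · rintro ⟨-, h⟩
      have := h i
      rwa [inf_eq_left.2 hx] at this
    · intro h
      refine ⟨⟨{i}, by simpa using hx⟩, fun j => ?_⟩
      by_cases hij : i = j
      · subst hij; rwa [inf_eq_left.2 hx]
      · have : x ⊓ b j = ⊥ := le_bot_iff.1 ((inf_le_inf_right _ hx).trans (hd i j hij).le)
        rw [this]
        exact (f j).2.bot_mem
  funext i
  apply Subtype.ext
  ext x
  constructor
  · intro hx
    have hxb := (f i).2.le x hx
    rwa [← key g i x hxb, ← h, key f i x hxb]
  · intro hx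
    have hxb := (g i).2.le x hx
    rwa [← key f i x hxb, h, key g i x hxb]

/-- All nonzero elements below `a` have as many subrings as `a`. -/
def Homog (a : A) : Prop := ∀ b ≤ a, b ≠ ⊥ → #(Subring b) = #(Subring a)

theorem exists_homog {x : A} (hx : x ≠ ⊥) : ∃ y ≤ x, y ≠ ⊥ ∧ Homog y := by
  obtain ⟨y, ⟨hy, hy0⟩, hmin⟩ := (InvImage.wf (fun y : A => #(Subring y))
    (wellFounded_lt (α := Cardinal.{u}))).has_min {y | y ≤ x ∧ y ≠ ⊥} ⟨x, le_rfl, hx⟩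
  refine ⟨y, hy, hy0, fun b hb hb0 => le_antisymm (mk_subring_mono hb) ?_⟩
  exact not_lt.1 fun h => hmin b ⟨hb.trans hy, hb0⟩ h

/-- A maximal set of pairwise disjoint nonzero elements. -/
structure MaxDisj (F : Set A) : Prop where
  ne_bot : ∀ a ∈ F, a ≠ ⊥
  disj : ∀ a ∈ F, ∀ b ∈ F, a ≠ b → a ⊓ b = ⊥
  meets : ∀ x, x ≠ ⊥ → ∃ a ∈ F, x ⊓ a ≠ ⊥

theorem exists_maxDisj {P : A → Prop} (hP : ∀ x, x ≠ ⊥ → ∃ y ≤ x, y ≠ ⊥ ∧ P y) :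
    ∃ F : Set A, MaxDisj F ∧ ∀ a ∈ F, P a := by
  obtain ⟨F, hF⟩ := zorn_subset {F : Set A | (∀ a ∈ F, a ≠ ⊥ ∧ P a) ∧
    ∀ a ∈ F, ∀ b ∈ F, a ≠ b → a ⊓ b = ⊥} (by
      intro c hc hchain
      refine ⟨⋃₀ c, ⟨?_, ?_⟩, fun s hs => Set.subset_sUnion_of_mem hs⟩
      · rintro a ⟨s, hs, ha⟩
        exact (hc hs).1 a ha
      · rintro a ⟨s, hs, ha⟩ b ⟨t, ht, hb⟩ hab
        rcases hchain.total hs ht with h | h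
        · exact (hc ht).2 a (h ha) b hb hab
        · exact (hc hs).2 a ha b (h hb) hab)
  refine ⟨F, ⟨fun a ha => (hF.prop.1 a ha).1, hF.prop.2, fun x hx => ?_⟩,
    fun a ha => (hF.prop.1 a ha).2⟩
  by_contra hn
  push Not at hn
  obtain ⟨y, hy, hy0, hPy⟩ := hP x hx
  have hyF : ∀ a ∈ F, y ⊓ a = ⊥ := fun a ha =>
    le_bot_iff.1 ((inf_le_inf_right _ hy).trans (hn a ha).le)
  have hmem : y ∈ F := by
    refine hF.le_of_ge ⟨?_, ?_⟩ (Set.subset_insert y F) (Set.mem_insert y F)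
    · rintro a (rfl | ha)
      · exact ⟨hy0, hPy⟩
      · exact hF.prop.1 a ha
    · rintro a (rfl | ha) b (rfl | hb) hab
      · exact absurd rfl hab
      · exact hyF b hb
      · rw [inf_comm]; exact hyF a ha
      · exact hF.prop.2 a ha b hb hab
  have := hyF y hmem
  rw [inf_idem] at this
  exact hy0 this

theorem MaxDisj.two_power_le {F : Set A} (hF : MaxDisj F) : 2 ^ #F ≤ #(Order.Ideal A) := by
  obtain ⟨f, hf⟩ := exists_injective_set_ideal (fun a : F => a.1) (fun a => hF.ne_bot _ a.2)
    fun a b hab => disjoint_pts_of_inf_eq_bot (hF.disj _ a.2 _ b.2 fun h => hab (Subtype.ext h))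
  rw [← mk_set]
  exact Cardinal.mk_le_of_injective hf

/-- If a has infinitely many subrings, it contains infinitely many disjoint nonzero pieces, each
with as many subrings as a; combining them shows that the number equals its ℵ₀-th power. The factor
2 ^ ℵ₀ covers the finite case. -/
theorem Homog.power_le {a : A} (h : Homog a) :
    #(Subring a) ^ ℵ₀ ≤ 2 ^ (ℵ₀ : Cardinal.{u}) * #(Subring a) := by
  have hpos : (1 : Cardinal.{u}) ≤ #(Subring a) :=
    Cardinal.one_le_iff_ne_zero.2 (mk_ne_zero_iff.2 ⟨⟨{⊥}, rfl, by simp, by simp, by simp⟩⟩)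
  rcases lt_or_ge #(Subring a) ℵ₀ with hlt | hge
  · calc #(Subring a) ^ ℵ₀ ≤ ℵ₀ ^ (ℵ₀ : Cardinal.{u}) := power_le_power_right hlt.le
      _ = 2 ^ (ℵ₀ : Cardinal.{u}) := by rw [power_self_eq le_rfl]
      _ = 2 ^ (ℵ₀ : Cardinal.{u}) * 1 := (mul_one _).symm
      _ ≤ _ := mul_le_mul' le_rfl hpos
  · have hinf : (pts a).Infinite := by
      intro hfin
      have hI : (Set.Iic a).Finite := by
        refine Set.Finite.of_finite_image (hfin.powerset.subset ?_) pts_injective.injOn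
        rintro _ ⟨x, hx, rfl⟩
        exact pts_mono hx
      have hS : Finite (Subring a) := by
        have := hI.powerset.to_subtype
        exact Finite.of_injective (fun R : Subring a => (⟨R.1, R.2.le⟩ : 𝒫 (Set.Iic a)))
          fun R S h => Subtype.ext (Subtype.mk.inj h)
      exact hge.not_gt (lt_aleph0_of_finite _)
    obtain ⟨x, b, h1, h2, h3⟩ := exists_disjoint_clopens (fun _ => pts a) (fun _ _ _ => le_rfl)
      fun _ => hinf
    have h4 := mk_pi_subring_le (a := a) (fun n : ULift.{u} ℕ => b n.down ⊓ a)
      (fun _ => inf_le_right) (by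
        intro m n hmn
        apply inf_eq_bot_of_pts
        intro z hz hz'
        have hne : m.down ≠ n.down := fun h => hmn (ULift.ext _ _ h)
        exact Set.disjoint_left.1 (h3 _ _ hne) (mem_pts_inf.1 hz).1 (mem_pts_inf.1 hz').1)
    have h5 : ∀ n : ULift.{u} ℕ, #(Subring (b n.down ⊓ a)) = #(Subring a) := fun n =>
      h _ inf_le_right (fun h0 => by
        have : x n.down ∈ pts (b n.down ⊓ a) := mem_pts_inf.2 ⟨h2 _, h1 _⟩
        rw [h0] at this
        exact not_mem_pts_bot this)
    rw [mk_pi] at h4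
    simp only [h5] at h4
    rw [prod_const] at h4
    have h6 : #(Subring a) ^ ℵ₀ ≤ #(Subring a) := by simpa using h4
    calc #(Subring a) ^ ℵ₀ ≤ 1 * #(Subring a) := by rwa [one_mul]
      _ ≤ _ := mul_le_mul' (one_le_aleph0.trans (cantor _).le) le_rfl

/-- The product itself is at most sub(A). Raising the factors to ℵ₀ costs only (2 ^ #F) ^ ℵ₀, which
is at most id(A) ^ ℵ₀. -/
theorem MaxDisj.prod_subring_power_le [Infinite A] {F : Set A} (hF : MaxDisj F)
    (hh : ∀ a ∈ F, Homog a) :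
    (prod fun a : F => #(Subring a.1)) ^ ℵ₀ ≤ #(BooleanSubalgebra A) := by
  have hinf := aleph0_le_sub (A := A)
  have hq : (prod fun a : F => #(Subring a.1)) ≤ #(BooleanSubalgebra A) := by
    rw [← mk_pi]
    exact (mk_pi_subring_le (a := ⊤) (fun a : F => a.1) (fun _ => le_top)
      fun a b hab => hF.disj _ a.2 _ b.2 fun h => hab (Subtype.ext h)).trans (mk_subring_le _)
  rw [← prod_power]
  calc (prod fun a : F => #(Subring a.1) ^ ℵ₀)
      ≤ prod fun a : F => 2 ^ (ℵ₀ : Cardinal.{u}) * #(Subring a.1) :=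
        prod_le_prod _ _ fun a => (hh a.1 a.2).power_le
    _ ≤ (prod fun _ : F => 2 ^ (ℵ₀ : Cardinal.{u})) * prod fun a : F => #(Subring a.1) :=
        prod_mul_le _ _
    _ ≤ #(BooleanSubalgebra A) * #(BooleanSubalgebra A) := by
        refine mul_le_mul' ?_ hq
        rw [prod_const, lift_id, lift_id, ← power_mul, mul_comm, power_mul]
        exact (power_le_power_right hF.two_power_le).trans mk_ideal_power_le_sub
    _ = _ := mul_eq_self hinf

/-- Assign to each a ∈ F' some b ∈ F that it meets. By homogeneity a may be replaced by a ⊓ b, and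
the pieces assigned to the same b are disjoint below b. -/
theorem MaxDisj.prod_subring_le {F F' : Set A} (hF : MaxDisj F)
    (hF' : MaxDisj F') (hh' : ∀ a ∈ F', Homog a) :
    (prod fun a : F' => #(Subring a.1)) ≤ prod fun a : F => #(Subring a.1) := by
  have h1 : ∀ a : F', ∃ b : F, a.1 ⊓ b.1 ≠ ⊥ := fun a => by
    obtain ⟨b, hb, h⟩ := hF.meets a.1 (hF'.ne_bot _ a.2)
    exact ⟨⟨b, hb⟩, h⟩
  choose g hg using h1
  let e1 : (∀ p : Σ b : F, {a : F' // g a = b}, Subring p.2.1.1) ≃ (∀ a : F', Subring a.1) :=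
    Equiv.piCongrLeft (fun a : F' => Subring a.1) (Equiv.sigmaFiberEquiv g)
  let e2 : (∀ p : Σ b : F, {a : F' // g a = b}, Subring p.2.1.1) ≃
      ∀ (b : F) (a : {a : F' // g a = b}), Subring a.1.1 :=
    Equiv.piCurry fun (b : F) (a : {a : F' // g a = b}) => Subring a.1.1
  have h2 := mk_congr (e1.symm.trans e2)
  rw [← mk_pi, h2, mk_pi]
  refine prod_le_prod _ _ fun b => ?_
  rw [mk_pi]
  have h3 : ∀ a : {a : F' // g a = b}, #(Subring a.1.1) = #(Subring (a.1.1 ⊓ b.1)) := by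
    rintro ⟨a, rfl⟩
    exact (hh' a.1 a.2 _ inf_le_left (hg a)).symm
  simp only [h3]
  rw [← mk_pi]
  refine mk_pi_subring_le _ (fun _ => inf_le_right) fun a a' haa' => ?_
  have hne : a.1.1 ≠ a'.1.1 := fun h => haa' (Subtype.ext (Subtype.ext h))
  have := hF'.disj _ a.1.2 _ a'.1.2 hne
  exact le_bot_iff.1 ((inf_le_inf inf_le_left inf_le_left).trans this.le)

end Homogeneous

end ShelahBA
namespace ShelahBA

/-! ### Coding automorphisms of a Boolean algebra by subrings -/

section Automorphisms

variable {B : Type u} [BooleanAlgebra B]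

/-- The ideal `U` is disjoint from its image under `f`. -/
def Moved (f : B ≃o B) (U : Order.Ideal B) : Prop := ∀ x ∈ U, ∀ y ∈ U, f x ⊓ y = ⊥

/-- The image of an ideal. -/
def imageIdeal (f : B ≃o B) (U : Order.Ideal B) : Order.Ideal B :=
  mkIdeal {x | f.symm x ∈ U} (by simp) (fun _ _ h hx => ideal_mem_of_le (f.symm.monotone h) hx)
    (fun x y hx hy => by
      change f.symm (x ⊔ y) ∈ U
      rw [map_sup]
      exact Order.Ideal.sup_mem hx hy)

theorem mem_imageIdeal {f : B ≃o B} {U : Order.Ideal B} {x : B} :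
    x ∈ imageIdeal f U ↔ f.symm x ∈ U := Iff.rfl

theorem apply_mem_imageIdeal {f : B ≃o B} {U : Order.Ideal B} {x : B} (hx : x ∈ U) :
    f x ∈ imageIdeal f U := by
  rw [mem_imageIdeal, OrderIso.symm_apply_apply]; exact hx

theorem map_sdiff_orderIso (f : B ≃o B) (x y : B) : f (x \ y) = f x \ f y := by
  rw [sdiff_eq, map_inf, map_compl', sdiff_eq]

theorem Moved.isSubring {f : B ≃o B} {U : Order.Ideal B} (h : Moved f U) :
    IsSubring ⊤ {x | ∃ u ∈ U, x = u ⊔ f u} where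
  bot_mem := ⟨⊥, U.bot_mem, by simp⟩
  le := fun _ _ => le_top
  sup_mem := by
    rintro _ ⟨u, hu, rfl⟩ _ ⟨v, hv, rfl⟩
    exact ⟨u ⊔ v, Order.Ideal.sup_mem hu hv, by rw [map_sup, sup_sup_sup_comm]⟩
  sdiff_mem := by
    rintro _ ⟨u, hu, rfl⟩ _ ⟨v, hv, rfl⟩
    refine ⟨u \ v, ideal_mem_of_le sdiff_le hu, ?_⟩
    have h1 : u \ f v = u := sdiff_eq_left.2 (disjoint_iff.2 (by rw [inf_comm]; exact h v hv u hu))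
    have h2 : f u \ v = f u := sdiff_eq_left.2 (disjoint_iff.2 (h u hu v hv))
    have h3 : f (u \ v) = f u \ f v := map_sdiff_orderIso f u v
    rw [h3, sup_sdiff, ← sdiff_sdiff, ← sdiff_sdiff, h2]
    congr 1
    rw [sdiff_sdiff_comm, h1]

theorem Moved.image {f : B ≃o B} {U : Order.Ideal B} (h : Moved f U) :
    Moved f (imageIdeal f U) := by
  intro x hx y hy
  have := h _ hx _ hy
  have h2 := congrArg f this
  rwa [map_inf, map_bot, OrderIso.apply_symm_apply, OrderIso.apply_symm_apply] at h2

theorem Moved.preimage {f : B ≃o B} {U : Order.Ideal B} (h : Moved f U) :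
    Moved f (imageIdeal f.symm U) := by
  intro x hx y hy
  have := h _ hx _ hy
  have h2 := congrArg f.symm this
  rw [map_inf, map_bot] at h2
  simpa using h2

/-- The ideal U is disjoint from its image, so the two components of u ⊔ f u can be told apart: U,
its image and the set of these joins determine f on U. -/
theorem Moved.apply_eq {f g : B ≃o B} {U : Order.Ideal B} (h : Moved f U)
    (hi : imageIdeal f U = imageIdeal g U)
    (hr : {x | ∃ u ∈ U, x = u ⊔ f u} = {x | ∃ u ∈ U, x = u ⊔ g u}) {x : B} (hx : x ∈ U) :
    f x = g x := by
  have h1 : x ⊔ f x ∈ {x | ∃ u ∈ U, x = u ⊔ g u} := hr ▸ ⟨x, hx, rfl⟩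
  obtain ⟨u, hu, he⟩ := h1
  have hgu : g u ∈ imageIdeal f U := hi ▸ apply_mem_imageIdeal hu
  have hd : ∀ v ∈ U, ∀ w ∈ imageIdeal f U, v ⊓ w = ⊥ := by
    intro v hv w hw
    have := h _ hw v hv
    rwa [OrderIso.apply_symm_apply, inf_comm] at this
  have e1 : x = u := by
    apply le_antisymm
    · refine Disjoint.left_le_of_le_sup_right (c := g u) (he ▸ le_sup_left) ?_
      exact disjoint_iff.2 (hd x hx _ hgu)
    · refine Disjoint.left_le_of_le_sup_right (c := f x) (he ▸ le_sup_left) ?_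
      exact disjoint_iff.2 (hd u hu _ (apply_mem_imageIdeal hx))
  subst e1
  apply le_antisymm
  · refine Disjoint.left_le_of_le_sup_left (c := x) (he ▸ le_sup_right) ?_
    rw [disjoint_iff, inf_comm]
    exact hd x hx _ (apply_mem_imageIdeal hx)
  · refine Disjoint.left_le_of_le_sup_left (c := x) (he ▸ le_sup_right) ?_
    rw [disjoint_iff, inf_comm]
    exact hd x hx _ hgu

theorem exists_maximal_moved (f : B ≃o B) :
    ∃ V : Order.Ideal B, Moved f V ∧ ∀ W : Order.Ideal B, V ≤ W → Moved f W → W ≤ V := by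
  obtain ⟨V, -, hV⟩ := zorn_le_nonempty₀ {V : Order.Ideal B | Moved f V} (by
    intro c hc hchain V0 hV0
    refine ⟨mkIdeal {x | ∃ W ∈ c, x ∈ W} ⟨V0, hV0, V0.bot_mem⟩ ?_ ?_, ?_, ?_⟩
    · rintro x y hyx ⟨W, hW, hx⟩
      exact ⟨W, hW, ideal_mem_of_le hyx hx⟩
    · rintro x y ⟨W, hW, hx⟩ ⟨W', hW', hy⟩
      rcases hchain.total hW hW' with h | h
      · exact ⟨W', hW', Order.Ideal.sup_mem (h hx) hy⟩
      · exact ⟨W, hW, Order.Ideal.sup_mem hx (h hy)⟩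
    · rintro x ⟨W, hW, hx⟩ y ⟨W', hW', hy⟩
      rcases hchain.total hW hW' with h | h
      · exact hc hW' x (h hx) y hy
      · exact hc hW x hx y (h hy)
    · intro W hW x hx
      exact ⟨W, hW, hx⟩) (Order.Ideal.principal ⊥) (by
      intro x _ y hy
      have : y = ⊥ := le_bot_iff.1 (Order.Ideal.mem_principal.1 hy)
      rw [this, inf_bot_eq])
  exact ⟨V, hV.prop, fun W h hW => hV.le_of_ge hW h⟩

/-- Off the moved part, an automorphism is the identity. -/
theorem Moved.apply_eq_self {f : B ≃o B} {V : Order.Ideal B} (hV : Moved f V)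
    (hmax : ∀ W : Order.Ideal B, V ≤ W → Moved f W → W ≤ V) {z : B} (h1 : ∀ v ∈ V, z ⊓ v = ⊥)
    (h2 : ∀ v ∈ imageIdeal f V, z ⊓ v = ⊥) (h3 : ∀ v ∈ imageIdeal f.symm V, z ⊓ v = ⊥) :
    f z = z := by
  -- An element y disjoint from its image could be added to V, so by maximality it is in V, hence
  -- disjoint from itself.
  have key : ∀ y ≤ z, f y ⊓ y = ⊥ → y = ⊥ := by
    intro y hy hfy
    have hW : Moved f (V ⊔ Order.Ideal.principal y) := by
      have hsub : ∀ x ∈ V ⊔ Order.Ideal.principal y, ∃ v ∈ V, x ≤ v ⊔ y := by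
        intro x hx
        obtain ⟨i, hi, j, hj, hle⟩ := Order.Ideal.mem_sup.1 hx
        exact ⟨i, hi, hle.trans (sup_le_sup_left (Order.Ideal.mem_principal.1 hj) i)⟩
      intro x hx x' hx'
      obtain ⟨v, hv, hle⟩ := hsub x hx
      obtain ⟨v', hv', hle'⟩ := hsub x' hx'
      have e1 : f v ⊓ v' = ⊥ := hV v hv v' hv'
      have e2 : f v ⊓ y = ⊥ := by
        rw [inf_comm]
        exact le_bot_iff.1 ((inf_le_inf_right _ hy).trans (h2 _ (apply_mem_imageIdeal hv)).le)
      have e3 : f y ⊓ v' = ⊥ := by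
        have hm : f.symm v' ∈ imageIdeal f.symm V := apply_mem_imageIdeal hv'
        have := le_bot_iff.1 ((inf_le_inf_right _ hy).trans (h3 _ hm).le)
        have h' := congrArg f this
        rwa [map_inf, map_bot, OrderIso.apply_symm_apply] at h'
      refine le_bot_iff.1 ((inf_le_inf (f.monotone hle) hle').trans ?_)
      rw [map_sup, inf_sup_left, inf_sup_right, inf_sup_right, e1, e2, e3, hfy]
      simp
    have hyV : y ∈ V := hmax _ le_sup_left hW
      (le_sup_right (a := V) (Order.Ideal.mem_principal.2 le_rfl))
    have := le_bot_iff.1 ((inf_le_inf_right _ hy).trans (h1 y hyV).le)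
    rwa [inf_idem] at this
  apply le_antisymm
  · rw [← sdiff_eq_bot_iff]
    have e1 : z \ f.symm z = ⊥ := by
      apply key _ sdiff_le
      rw [map_sdiff_orderIso, OrderIso.apply_symm_apply]
      refine le_bot_iff.1 ((inf_le_inf_left _ sdiff_le).trans ?_)
      rw [inf_comm, inf_sdiff_self_right]
    have h' := congrArg f e1
    rwa [map_sdiff_orderIso, map_bot, OrderIso.apply_symm_apply] at h'
  · rw [← sdiff_eq_bot_iff]
    apply key _ sdiff_le
    refine le_bot_iff.1 ((inf_le_inf_right _ (f.monotone sdiff_le)).trans ?_)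
    rw [inf_sdiff_self_right]

/-- The subring of an ideal. -/
def idealSubring (I : Order.Ideal B) : Subring (⊤ : B) := ⟨I, isSubring_ideal I⟩

theorem idealSubring_inj {I J : Order.Ideal B} (h : idealSubring I = idealSubring J) : I = J :=
  SetLike.coe_injective (Subtype.mk.inj h)

/-- The subring coding an automorphism on an ideal that it moves. -/
def Moved.code {f : B ≃o B} {U : Order.Ideal B} (h : Moved f U) : Subring (⊤ : B) :=
  ⟨_, h.isSubring⟩

/-- Let V be a maximal ideal moved off itself by f. Then f is the identity on elements disjoint from
V, f V and f⁻¹ V. The seven subrings are V, f V, f⁻¹ V, f (f V) and the joins u ⊔ f u for u in V, f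
V and f⁻¹ V. The image of f⁻¹ V is V, so it needs no code. -/
theorem mk_orderIso_le : #(B ≃o B) ≤ #(Subring (⊤ : B)) ^ 7 := by
  choose V hV hmax using exists_maximal_moved (B := B)
  let T := Subring (⊤ : B)
  have h1 : #(B ≃o B) ≤ #(T × T × T × T × T × T × T) := by
    refine Cardinal.mk_le_of_injective (f := fun f => (idealSubring (V f),
      idealSubring (imageIdeal f (V f)), idealSubring (imageIdeal f.symm (V f)),
      idealSubring (imageIdeal f (imageIdeal f (V f))), (hV f).code, (hV f).image.code,
      (hV f).preimage.code)) ?_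
    intro f g h
    simp only [Prod.mk.injEq] at h
    obtain ⟨e1, e2, e3, e4, e5, e6, e7⟩ := h
    have e1 := idealSubring_inj e1
    have e2 := idealSubring_inj e2
    have e3 := idealSubring_inj e3
    have e4 := idealSubring_inj e4
    have e5 := Subtype.mk.inj e5
    have e6 := Subtype.mk.inj e6
    have e7 := Subtype.mk.inj e7
    have hVf := hV f
    have hVg := hV g
    have hmf := hmax f
    have hmg := hmax g
    rw [← e2] at e4 e6
    rw [← e3] at e7
    rw [← e1] at e2 e3 e5 hVg hmg
    have a1 : ∀ x ∈ (V f), f x = g x := fun x hx => hVf.apply_eq e2 e5 hx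
    have a2 : ∀ x ∈ imageIdeal f (V f), f x = g x := fun x hx => hVf.image.apply_eq e4 e6 hx
    have a3 : ∀ x ∈ imageIdeal f.symm (V f), f x = g x := fun x hx => by
      refine hVf.preimage.apply_eq ?_ e7 hx
      have t : ∀ k : B ≃o B, imageIdeal k (imageIdeal k.symm (V f)) = V f := fun k => by
        apply SetLike.ext
        intro x
        rw [mem_imageIdeal, mem_imageIdeal]
        simp
      rw [t f, e3, t g]
    have key : ∀ (W : Order.Ideal B) (f g : B ≃o B), Moved f W → (∀ U, W ≤ U → Moved f U → U ≤ W) →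
        Moved g W → (∀ U, W ≤ U → Moved g U → U ≤ W) → imageIdeal f W = imageIdeal g W →
        imageIdeal f.symm W = imageIdeal g.symm W → (∀ x ∈ W, f x = g x) →
        (∀ x ∈ imageIdeal f W, f x = g x) → (∀ x ∈ imageIdeal f.symm W, f x = g x) →
        ∀ x, f x ≤ g x := by
      intro W f g hf hfm hg hgm i1 i2 a1 a2 a3 x
      rw [← sdiff_eq_bot_iff]
      -- On no nonzero t ≤ s can f and g agree. So s is disjoint from the three ideals, where they
      -- do agree; then both fix s, and s = ⊥.
      obtain ⟨s, hs⟩ : ∃ s, s = f.symm (f x \ g x) := ⟨_, rfl⟩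
      have hfs : f s = f x \ g x := by rw [hs, OrderIso.apply_symm_apply]
      have hsx : s ≤ x := by
        rw [← f.le_iff_le, hfs]; exact sdiff_le
      have hE : ∀ t ≤ s, f t = g t → t = ⊥ := by
        intro t ht he
        have h1 : f t ≤ f x \ g x := hfs ▸ f.monotone ht
        have h2 : f t ≤ g x := he ▸ g.monotone (ht.trans hsx)
        have h3 : f t ≤ ⊥ := by
          have := le_inf h2 h1
          rwa [inf_sdiff_self_right] at this
        have h4 := f.injective ((le_bot_iff.1 h3).trans (map_bot f).symm)
        exact h4
      have b1 : ∀ v ∈ W, s ⊓ v = ⊥ := fun v hv =>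
        hE _ inf_le_left (a1 _ (ideal_mem_of_le inf_le_right hv))
      have b2 : ∀ v ∈ imageIdeal f W, s ⊓ v = ⊥ := fun v hv =>
        hE _ inf_le_left (a2 _ (ideal_mem_of_le inf_le_right hv))
      have b3 : ∀ v ∈ imageIdeal f.symm W, s ⊓ v = ⊥ := fun v hv =>
        hE _ inf_le_left (a3 _ (ideal_mem_of_le inf_le_right hv))
      have c1 := hf.apply_eq_self hfm b1 b2 b3
      have c2 := hg.apply_eq_self hgm b1 (i1 ▸ b2) (i2 ▸ b3)
      rw [← hfs, hE s le_rfl (c1.trans c2.symm), map_bot]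
    ext x
    apply le_antisymm
    · exact key _ f g hVf hmf hVg hmg e2 e3 a1 a2 a3 x
    · refine key _ g f hVg hmg hVf hmf e2.symm e3.symm (fun x hx => (a1 x hx).symm)
        (fun x hx => (a2 x (e2 ▸ hx)).symm) (fun x hx => (a3 x (e3 ▸ hx)).symm) x
  refine h1.trans (le_of_eq ?_)
  simp only [mk_prod, lift_id]
  ring

end Automorphisms

/-! ### Isomorphisms between relative algebras -/

section Relative

variable {A : Type u} [BooleanAlgebra A]

/-- The relative Boolean algebra below an element. -/
abbrev relativeAlgebra (a : A) : BooleanAlgebra (Set.Iic a) where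
  __ := (inferInstance : Lattice (Set.Iic a))
  __ := (inferInstance : BoundedOrder (Set.Iic a))
  compl x := ⟨a \ x.1, sdiff_le⟩
  le_sup_inf x y z := by
    change (x.1 ⊔ y.1) ⊓ (x.1 ⊔ z.1) ≤ x.1 ⊔ y.1 ⊓ z.1
    exact le_sup_inf
  inf_compl_le_bot x := by
    change x.1 ⊓ (a \ x.1) ≤ ⊥
    rw [inf_sdiff_self_right]
  top_le_sup_compl x := by
    change a ≤ x.1 ⊔ a \ x.1
    rw [sup_sdiff_self_right]
    exact le_sup_right

theorem mk_orderIso_Iic_le (a : A) : #(Set.Iic a ≃o Set.Iic a) ≤ #(Subring a) ^ 7 := by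
  let _ := relativeAlgebra a
  refine (mk_orderIso_le (B := Set.Iic a)).trans ?_
  have h : #(Subring (⊤ : Set.Iic a)) ≤ #(Subring a) := by
    refine Cardinal.mk_le_of_injective (f := fun R : Subring (⊤ : Set.Iic a) =>
      (⟨Subtype.val '' R.1, ?_, ?_, ?_, ?_⟩ : Subring a)) ?_
    · exact ⟨⊥, R.2.bot_mem, rfl⟩
    · rintro _ ⟨x, -, rfl⟩
      exact x.2
    · rintro _ ⟨x, hx, rfl⟩ _ ⟨y, hy, rfl⟩
      exact ⟨x ⊔ y, R.2.sup_mem x hx y hy, rfl⟩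
    · rintro _ ⟨x, hx, rfl⟩ _ ⟨y, hy, rfl⟩
      refine ⟨x \ y, R.2.sdiff_mem x hx y hy, ?_⟩
      rw [sdiff_eq]
      change x.1 ⊓ (a \ y.1) = x.1 \ y.1
      rw [← inf_sdiff_assoc, inf_eq_left.2 x.2]
    · intro R S h
      exact Subtype.ext (Subtype.val_injective.image_injective (Subtype.mk.inj h))
  exact pow_le_pow_left₀ (zero_le) h 7

theorem mk_orderIso_le_of_nonempty (a b : A) :
    #(Set.Iic a ≃o Set.Iic b) ≤ #(Subring a) ^ 7 := by
  rcases isEmpty_or_nonempty (Set.Iic a ≃o Set.Iic b) with h | ⟨⟨f⟩⟩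
  · rw [mk_eq_zero]; exact zero_le
  · refine le_trans ?_ (mk_orderIso_Iic_le a)
    exact Cardinal.mk_le_of_injective (f := fun g => g.trans f.symm) fun g g' h => by
      ext x
      have := congrArg (fun k : Set.Iic a ≃o Set.Iic a => f (k x)) h
      exact congrArg Subtype.val (by simpa using this)

end Relative

end ShelahBA
namespace ShelahBA

/-! ### Homomorphisms between ideals as partial functions -/

section PartialMaps

variable {A : Type u} [BooleanAlgebra A]

open Classical in
/-- The value of a partial function, `⊥` off its domain. -/
noncomputable def val (f : A →. A) (x : A) : A := if h : (f x).Dom then (f x).get h else ⊥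

theorem mem_iff_val {f : A →. A} {x a : A} : a ∈ f x ↔ x ∈ f.Dom ∧ val f x = a := by
  constructor
  · rintro ⟨h, rfl⟩
    exact ⟨h, dif_pos h⟩
  · rintro ⟨h, rfl⟩
    exact ⟨h, (dif_pos h).symm⟩

theorem pfun_ext {f g : A →. A} (hd : f.Dom = g.Dom) (h : ∀ x ∈ f.Dom, val f x = val g x) :
    f = g := by
  apply PFun.ext
  intro x a
  rw [mem_iff_val, mem_iff_val, ← hd]
  exact ⟨fun ⟨h1, h2⟩ => ⟨h1, h x h1 ▸ h2⟩, fun ⟨h1, h2⟩ => ⟨h1, (h x h1).symm ▸ h2⟩⟩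

theorem IsHomOnto.mem_dom {f : A →. A} {I J : Order.Ideal A} (h : IsHomOnto f I J) {x : A} :
    x ∈ f.Dom ↔ x ∈ I := by rw [h.dom_eq]; rfl

theorem IsHomOnto.mem_iff {f : A →. A} {I J : Order.Ideal A} (h : IsHomOnto f I J) {x a : A} :
    a ∈ f x ↔ x ∈ I ∧ val f x = a := by
  rw [mem_iff_val, h.mem_dom]

theorem IsHomOnto.val_mem {f : A →. A} {I J : Order.Ideal A} (h : IsHomOnto f I J) {x : A}
    (hx : x ∈ I) : val f x ∈ J := by
  have : val f x ∈ f.ran := ⟨x, h.mem_iff.2 ⟨hx, rfl⟩⟩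
  rw [h.ran_eq] at this
  exact this

theorem IsHomOnto.exists_val {f : A →. A} {I J : Order.Ideal A} (h : IsHomOnto f I J) {y : A}
    (hy : y ∈ J) : ∃ x ∈ I, val f x = y := by
  have : y ∈ f.ran := by rw [h.ran_eq]; exact hy
  obtain ⟨x, hx⟩ := this
  exact ⟨x, h.mem_iff.1 hx⟩

theorem IsHomOnto.val_bot {f : A →. A} {I J : Order.Ideal A} (h : IsHomOnto f I J) :
    val f ⊥ = ⊥ := (h.mem_iff.1 h.map_bot).2

theorem IsHomOnto.val_sup {f : A →. A} {I J : Order.Ideal A} (h : IsHomOnto f I J) {x y : A}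
    (hx : x ∈ I) (hy : y ∈ I) : val f (x ⊔ y) = val f x ⊔ val f y :=
  (h.mem_iff.1 (h.map_sup x y _ _ (h.mem_iff.2 ⟨hx, rfl⟩) (h.mem_iff.2 ⟨hy, rfl⟩))).2

theorem IsHomOnto.val_inf {f : A →. A} {I J : Order.Ideal A} (h : IsHomOnto f I J) {x y : A}
    (hx : x ∈ I) (hy : y ∈ I) : val f (x ⊓ y) = val f x ⊓ val f y :=
  (h.mem_iff.1 (h.map_inf x y _ _ (h.mem_iff.2 ⟨hx, rfl⟩) (h.mem_iff.2 ⟨hy, rfl⟩))).2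

theorem IsHomOnto.val_mono {f : A →. A} {I J : Order.Ideal A} (h : IsHomOnto f I J) {x y : A}
    (hy : y ∈ I) (hxy : x ≤ y) : val f x ≤ val f y := by
  have := h.val_inf (ideal_mem_of_le hxy hy) hy
  rw [inf_eq_left.2 hxy] at this
  rw [this]
  exact inf_le_right

theorem IsHomOnto.ext {f g : A →. A} {I J K : Order.Ideal A} (h : IsHomOnto f I J)
    (h' : IsHomOnto g I K) (he : ∀ x ∈ I, val f x = val g x) : f = g :=
  pfun_ext (h.dom_eq.trans h'.dom_eq.symm) fun x hx => he x (h.mem_dom.1 hx)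

/-- Partial homomorphism given by a total function. -/
noncomputable def ofFun (φ : A → A) (I : Order.Ideal A) : A →. A := PFun.res φ (I : Set A)

theorem mem_ofFun {φ : A → A} {I : Order.Ideal A} {x a : A} :
    a ∈ ofFun φ I x ↔ x ∈ I ∧ φ x = a := by
  rw [ofFun, PFun.mem_res]; rfl

theorem isHomOnto_ofFun {φ : A → A} {I J : Order.Ideal A} (hm : ∀ x ∈ I, φ x ∈ J)
    (hs : ∀ y ∈ J, ∃ x ∈ I, φ x = y) (h0 : φ ⊥ = ⊥)
    (hsup : ∀ x ∈ I, ∀ y ∈ I, φ (x ⊔ y) = φ x ⊔ φ y)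
    (hinf : ∀ x ∈ I, ∀ y ∈ I, φ (x ⊓ y) = φ x ⊓ φ y) : IsHomOnto (ofFun φ I) I J where
  dom_eq := by
    ext x
    rw [PFun.mem_dom]
    exact ⟨fun ⟨a, ha⟩ => (mem_ofFun.1 ha).1, fun hx => ⟨φ x, mem_ofFun.2 ⟨hx, rfl⟩⟩⟩
  ran_eq := by
    ext y
    constructor
    · rintro ⟨x, hx⟩
      rw [mem_ofFun] at hx
      exact hx.2 ▸ hm x hx.1
    · intro hy
      obtain ⟨x, hx, rfl⟩ := hs y hy
      exact ⟨x, mem_ofFun.2 ⟨hx, rfl⟩⟩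
  map_bot := mem_ofFun.2 ⟨I.bot_mem, h0⟩
  map_sup := by
    intro x y a b ha hb
    rw [mem_ofFun] at *
    exact ⟨Order.Ideal.sup_mem ha.1 hb.1, by rw [hsup x ha.1 y hb.1, ha.2, hb.2]⟩
  map_inf := by
    intro x y a b ha hb
    rw [mem_ofFun] at *
    exact ⟨ideal_mem_of_le inf_le_left ha.1, by rw [hinf x ha.1 y hb.1, ha.2, hb.2]⟩

theorem val_ofFun {φ : A → A} {I : Order.Ideal A} {x : A} (hx : x ∈ I) :
    val (ofFun φ I) x = φ x := (mem_iff_val.1 (mem_ofFun.2 ⟨hx, rfl⟩)).2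

/-- `f` is an automorphism of the dense ideal `I`. -/
structure IsAut (f : A →. A) (I : Order.Ideal A) : Prop where
  dense : DenseIdeal I
  hom : IsHomOnto f I I
  eq_bot : ∀ x ∈ I, val f x = ⊥ → x = ⊥

theorem mem_aut₃_iff {f : A →. A} : f ∈ Aut₃ A ↔ ∃ I, IsAut f I := by
  constructor
  · rintro ⟨⟨I, hd, h⟩, hb⟩
    exact ⟨I, hd, h, fun x hx h0 =>
      (hb x (h.mem_dom.2 hx)).1 (h.mem_iff.2 ⟨hx, h0⟩)⟩
  · rintro ⟨I, hd, h, hb⟩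
    refine ⟨⟨I, hd, h⟩, fun x hx => ⟨fun h0 => hb x (h.mem_dom.1 hx) (h.mem_iff.1 h0).2, ?_⟩⟩
    rintro rfl
    exact h.map_bot

theorem IsAut.le_iff {f : A →. A} {I : Order.Ideal A} (h : IsAut f I) {x y : A} (hx : x ∈ I)
    (hy : y ∈ I) : val f x ≤ val f y ↔ x ≤ y := by
  refine ⟨fun hle => ?_, h.hom.val_mono hy⟩
  have hxy : x \ y ∈ I := ideal_mem_of_le sdiff_le hx
  rw [← sdiff_eq_bot_iff]
  apply h.eq_bot _ hxy
  have h1 : val f (x \ y) ⊓ val f y = ⊥ := by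
    rw [← h.hom.val_inf hxy hy, inf_comm, inf_sdiff_self_right, h.hom.val_bot]
  exact le_bot_iff.1 (h1 ▸ le_inf le_rfl ((h.hom.val_mono hx sdiff_le).trans hle))

/-- The difference of two values at x is some f y with y ≤ x. If y ≠ ⊥, it meets a member of F,
below which the maps agree, a contradiction. -/
theorem IsAut.eq_of_val_eq {f g : A →. A} {I : Order.Ideal A} (hf : IsAut f I) (hg : IsAut g I)
    {F : Set A} (hF : MaxDisj F)
    (he : ∀ a ∈ F, ∀ x ≤ a, val f x = val g x) : f = g := by
  have key : ∀ f g : A →. A, IsAut f I → IsAut g I →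
      (∀ a ∈ F, ∀ x ≤ a, val f x = val g x) → ∀ x ∈ I, val f x ≤ val g x := by
    intro f g hf hg he x hx
    rw [← sdiff_eq_bot_iff]
    obtain ⟨y, hy, hyx⟩ := hf.hom.exists_val
      (ideal_mem_of_le (sdiff_le (b := val g x)) (hf.hom.val_mem hx))
    rw [← hyx]
    by_contra hne
    have hy0 : y ≠ ⊥ := by
      rintro rfl
      exact hne hf.hom.val_bot
    have hyx' : y ≤ x := (hf.le_iff hy hx).1 (hyx ▸ sdiff_le)
    obtain ⟨a, ha, hya⟩ := hF.meets y hy0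
    have hyaI : y ⊓ a ∈ I := ideal_mem_of_le inf_le_left hy
    apply hya
    apply hf.eq_bot _ hyaI
    have h1 : val f (y ⊓ a) ≤ val f x \ val g x := hyx ▸ hf.hom.val_mono hy inf_le_left
    have h2 : val f (y ⊓ a) ≤ val g x := by
      rw [he a ha _ inf_le_right]
      exact hg.hom.val_mono hx (inf_le_left.trans hyx')
    have := le_inf h2 h1
    rwa [inf_sdiff_self_right, le_bot_iff] at this
  exact hf.hom.ext hg.hom fun x hx => le_antisymm (key f g hf hg he x hx)
    (key g f hg hf (fun a ha x hx => (he a ha x hx).symm) x hx)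

end PartialMaps

/-! ### Counting partitions by ideals -/

section Families

variable {A : Type u} [BooleanAlgebra A]

/-- A disjoint family of elements generating the ideal `D`. -/
structure Spans {ι : Type u} (w : ι → A) (D : Order.Ideal A) : Prop where
  disj : ∀ i j, i ≠ j → w i ⊓ w j = ⊥
  mem : ∀ i, w i ∈ D
  le : ∀ x ∈ D, ∃ s : Finset ι, x ≤ s.sup w

theorem Spans.finite {ι : Type u} {w : ι → A} {D : Order.Ideal A} (h : Spans w D) {b : A}
    (hb : b ∈ D) : {i | b ⊓ w i ≠ ⊥}.Finite := by
  classical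
  obtain ⟨s, hs⟩ := h.le b hb
  refine s.finite_toSet.subset fun i hi => ?_
  by_contra his
  apply hi
  refine le_bot_iff.1 ((inf_le_inf_right _ hs).trans ?_)
  rw [Finset.sup_inf_distrib_right]
  exact Finset.sup_le fun j hj => (h.disj j i fun hji => his (hji ▸ hj)).le

theorem MaxDisj.prod_Iic_le {G : Set A} (hG : MaxDisj G) :
    (prod fun b : G => #(Set.Iic b.1)) ≤ #(Order.Ideal A) := by
  rw [← mk_pi]
  refine Cardinal.mk_le_of_injective
    (f := fun y => idealOf (⋃ b : G, pts (y b).1)) fun y y' h => ?_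
  have h1 := idealOf_inj (isOp_iUnion_pts _) (isOp_iUnion_pts _) h
  have key : ∀ y y' : ∀ b : G, Set.Iic b.1, (⋃ b : G, pts (y b).1) ⊆ (⋃ b : G, pts (y' b).1) →
      ∀ b, (y b).1 ≤ (y' b).1 := by
    intro y y' h b
    apply le_of_pts_subset
    intro x hx
    obtain ⟨b', hb'⟩ := Set.mem_iUnion.1 (h (Set.mem_iUnion.2 ⟨b, hx⟩))
    by_cases hbb : b = b'
    · exact hbb ▸ hb'
    · exact absurd (pts_mono (y' b').2 hb') (Set.disjoint_left.1 (disjoint_pts_of_inf_eq_bot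
        (hG.disj _ b.2 _ b'.2 fun h => hbb (Subtype.ext h))) (pts_mono (y b).2 hx))
  funext b
  exact Subtype.ext (le_antisymm (key y y' h1.le b) (key y' y h1.ge b))

theorem two_power_mul_le {c x y : Cardinal.{u}} (hc : 2 ^ (ℵ₀ : Cardinal.{u}) ≤ c) (hx : 2 ^ x ≤ c)
    (hy : 2 ^ y ≤ c) : 2 ^ (x * y) ≤ c := by
  refine (power_le_power_left two_ne_zero (mul_le_max x y)).trans ?_
  rcases max_choice (max x y) ℵ₀ with h | h
  · rw [h]
    rcases max_choice x y with h | h <;> rwa [h]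
  · rwa [h]

theorem mk_finset_le {X : Type u} : #(Finset X) ≤ max ℵ₀ #X := by
  rcases finite_or_infinite X with h | h
  · exact (lt_aleph0_of_finite _).le.trans (le_max_left _ _)
  · rw [mk_finset_of_infinite]; exact le_max_right _ _

/-- Each b ∈ G lies in D, so it meets only finitely many w i, and w is coded by the finite sets of
nonzero pieces (i, b ⊓ w i). Each w i is the join of its pieces, since it lies below finitely many
members of G. -/
theorem mk_spans_le [Infinite A] {ι : Type u} [Nonempty ι] (hι : 2 ^ #ι ≤ #(Order.Ideal A))
    {D : Order.Ideal A} {G : Set A} (hG : MaxDisj G) (hGD : Spans (Subtype.val : G → A) D) :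
    #{w : ι → A // Spans w D} ≤ #(Order.Ideal A) := by
  classical
  have hid := continuum_le_mk_ideal (A := A)
  have hidω : ℵ₀ ≤ #(Order.Ideal A) := (cantor _).le.trans hid
  have h2G := hG.two_power_le
  have hfin : ∀ (w : {w : ι → A // Spans w D}) (b : G),
      {p : ι × Set.Iic b.1 | p.2.1 = b.1 ⊓ w.1 p.1 ∧ p.2.1 ≠ ⊥}.Finite := by
    intro w b
    refine Set.Finite.of_finite_image (f := Prod.fst)
      ((w.2.finite (hGD.mem b)).subset ?_) ?_
    · rintro _ ⟨p, hp, rfl⟩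
      exact fun h => hp.2 (hp.1.trans h)
    · rintro ⟨i, x⟩ hx ⟨j, y⟩ hy (rfl : i = j)
      exact Prod.ext rfl (Subtype.ext (hx.1.trans hy.1.symm))
  have h1 : #{w : ι → A // Spans w D} ≤ #(∀ b : G, Finset (ι × Set.Iic b.1)) := by
    refine Cardinal.mk_le_of_injective (f := fun w b => (hfin w b).toFinset) fun w w' h => ?_
    have key : ∀ w w' : {w : ι → A // Spans w D},
        (fun b => (hfin w b).toFinset) = (fun b => (hfin w' b).toFinset) → ∀ i, w.1 i ≤ w'.1 i := by
      intro w w' h i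
      obtain ⟨s, hs⟩ := hGD.le _ (w.2.mem i)
      have : w.1 i = s.sup fun b => b.1 ⊓ w.1 i := by
        rw [← Finset.sup_inf_distrib_right, inf_eq_right.2 hs]
      rw [this]
      refine Finset.sup_le fun b _ => ?_
      by_cases h0 : b.1 ⊓ w.1 i = ⊥
      · rw [h0]; exact bot_le
      · have h2 : ((i, ⟨b.1 ⊓ w.1 i, inf_le_left⟩) : ι × Set.Iic b.1) ∈ (hfin w b).toFinset := by
          rw [Set.Finite.mem_toFinset]
          exact ⟨rfl, h0⟩
        rw [congrFun h b, Set.Finite.mem_toFinset] at h2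
        have h3 : b.1 ⊓ w.1 i = b.1 ⊓ w'.1 i := h2.1
        rw [h3]
        exact inf_le_right
    apply Subtype.ext
    funext i
    exact le_antisymm (key w w' h i) (key w' w h.symm i)
  refine h1.trans ?_
  rw [mk_pi]
  have hι1 : (1 : Cardinal.{u}) ≤ #ι := Cardinal.one_le_iff_ne_zero.2 (mk_ne_zero ι)
  have h2 : ∀ b : G, #(Finset (ι × Set.Iic b.1)) ≤ ℵ₀ * (#ι * #(Set.Iic b.1)) := by
    intro b
    have hb1 : (1 : Cardinal.{u}) ≤ #(Set.Iic b.1) :=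
      Cardinal.one_le_iff_ne_zero.2 (mk_ne_zero_iff.2 ⟨⟨b.1, le_rfl⟩⟩)
    have hp : #(ι × Set.Iic b.1) = #ι * #(Set.Iic b.1) := by rw [mk_prod, lift_id, lift_id]
    refine mk_finset_le.trans (max_le ?_ ?_)
    · calc ℵ₀ = ℵ₀ * (1 * 1) := by simp
        _ ≤ _ := mul_le_mul' le_rfl (mul_le_mul' hι1 hb1)
    · rw [hp]
      calc #ι * #(Set.Iic b.1) = 1 * (#ι * #(Set.Iic b.1)) := (one_mul _).symm
        _ ≤ _ := mul_le_mul' one_le_aleph0 le_rfl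
  have hconst : ∀ c : Cardinal.{u}, 2 ^ c ≤ #(Order.Ideal A) →
      (prod fun _ : G => c) ≤ #(Order.Ideal A) := by
    intro c hc
    rw [prod_const, lift_id, lift_id]
    refine (power_le_power_right (cantor c).le).trans ?_
    rw [← power_mul]
    exact two_power_mul_le hid hc h2G
  calc (prod fun b : G => #(Finset (ι × Set.Iic b.1)))
      ≤ prod fun b : G => ℵ₀ * (#ι * #(Set.Iic b.1)) := prod_le_prod _ _ h2
    _ ≤ (prod fun _ : G => ℵ₀) * prod fun b : G => (#ι * #(Set.Iic b.1)) := prod_mul_le _ _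
    _ ≤ (prod fun _ : G => ℵ₀) * ((prod fun _ : G => #ι) * prod fun b : G => #(Set.Iic b.1)) :=
        mul_le_mul' le_rfl (prod_mul_le _ _)
    _ ≤ #(Order.Ideal A) * (#(Order.Ideal A) * #(Order.Ideal A)) :=
        mul_le_mul' (hconst _ hid) (mul_le_mul' (hconst _ hι) hG.prod_Iic_le)
    _ = #(Order.Ideal A) := by rw [mul_eq_self hidω, mul_eq_self hidω]

/-- The ideal generated by a family. -/
def spanOf {ι : Type u} (w : ι → A) : Order.Ideal A :=
  mkIdeal {x | ∃ s : Finset ι, x ≤ s.sup w} ⟨∅, bot_le⟩ (fun _ _ h ⟨s, hs⟩ => ⟨s, h.trans hs⟩)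
    (fun x y ⟨s, hs⟩ ⟨t, ht⟩ => by
      classical
      exact ⟨s ∪ t, by rw [Finset.sup_union]; exact sup_le_sup hs ht⟩)

theorem spans_spanOf {ι : Type u} {w : ι → A} (h : ∀ i j, i ≠ j → w i ⊓ w j = ⊥) :
    Spans w (spanOf w) :=
  ⟨h, fun i => ⟨{i}, by simp⟩, fun _ hx => hx⟩

/-- Sort the families by the ideal they generate; within one class, any member serves as the
reference family G of `mk_spans_le`. -/
theorem mk_partitions_le [Infinite A] {ι : Type u} (hι : 2 ^ #ι ≤ #(Order.Ideal A)) :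
    #{w : ι → A // (∀ i, w i ≠ ⊥) ∧ (∀ i j, i ≠ j → w i ⊓ w j = ⊥) ∧
      ∀ x, x ≠ ⊥ → ∃ i, x ⊓ w i ≠ ⊥} ≤ #(Order.Ideal A) := by
  classical
  have hidω : ℵ₀ ≤ #(Order.Ideal A) := (cantor _).le.trans (continuum_le_mk_ideal (A := A))
  refine (mk_le_mk_mul_of_mk_preimage_le (c := #(Order.Ideal A)) (fun w => spanOf w.1)
    fun D => ?_).trans (mul_eq_self hidω).le
  rcases Set.eq_empty_or_nonempty ((fun w : {w : ι → A // (∀ i, w i ≠ ⊥) ∧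
      (∀ i j, i ≠ j → w i ⊓ w j = ⊥) ∧ ∀ x, x ≠ ⊥ → ∃ i, x ⊓ w i ≠ ⊥} => spanOf w.1) ⁻¹' {D})
    with he | ⟨w, hw⟩
  · rw [he]; simp
  have hw : spanOf w.1 = D := hw
  obtain ⟨⟨i0, -⟩⟩ : Nonempty {i // (⊤ : A) ⊓ w.1 i ≠ ⊥} := by
    have : Nontrivial A := inferInstance
    obtain ⟨i, hi⟩ := w.2.2.2 ⊤ top_ne_bot
    exact ⟨⟨i, hi⟩⟩
  have : Nonempty ι := ⟨i0⟩
  have hG : MaxDisj (Set.range w.1) := by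
    refine ⟨?_, ?_, ?_⟩
    · rintro _ ⟨i, rfl⟩; exact w.2.1 i
    · rintro _ ⟨i, rfl⟩ _ ⟨j, rfl⟩ hij
      exact w.2.2.1 i j fun h => hij (h ▸ rfl)
    · intro x hx
      obtain ⟨i, hi⟩ := w.2.2.2 x hx
      exact ⟨_, ⟨i, rfl⟩, hi⟩
  have hGD : Spans (Subtype.val : Set.range w.1 → A) D := by
    refine ⟨fun i j hij => hG.disj _ i.2 _ j.2 fun h => hij (Subtype.ext h), ?_, ?_⟩
    · rintro ⟨_, i, rfl⟩
      rw [← hw]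
      exact (spans_spanOf w.2.2.1).mem i
    · intro x hx
      rw [← hw] at hx
      obtain ⟨s, hs⟩ := hx
      refine ⟨s.image fun i => ⟨w.1 i, i, rfl⟩, hs.trans ?_⟩
      rw [Finset.sup_image]
      exact le_rfl
  refine le_trans ?_ (mk_spans_le hι hG hGD)
  refine Cardinal.mk_le_of_injective (f := fun v => ⟨v.1.1, ?_⟩) ?_
  · have hv : spanOf v.1.1 = D := v.2
    exact (congrArg (Spans v.1.1) hv).mp (spans_spanOf v.1.2.2.1)
  · intro v v' h
    exact Subtype.ext (Subtype.ext (Subtype.mk.inj h))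

end Families

/-! ### Counting automorphisms of dense ideals -/

section AutomorphismsOfIdeals

variable {A : Type u} [BooleanAlgebra A]

/-- Restriction of an automorphism of a dense ideal. -/
noncomputable def IsAut.restrict {f : A →. A} {I : Order.Ideal A} (h : IsAut f I) {a b : A}
    (ha : a ∈ I) (hb : val f a = b) : Set.Iic a ≃o Set.Iic b :=
  RelIso.ofSurjective (OrderEmbedding.ofMapLEIff
    (fun x : Set.Iic a => (⟨val f x.1, hb ▸ h.hom.val_mono ha x.2⟩ : Set.Iic b))
    fun x y => h.le_iff (ideal_mem_of_le x.2 ha) (ideal_mem_of_le y.2 ha)) (by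
      rintro ⟨y, hy⟩
      have hbI : b ∈ I := hb ▸ h.hom.val_mem ha
      obtain ⟨x, hx, rfl⟩ := h.hom.exists_val (ideal_mem_of_le hy hbI)
      exact ⟨⟨x, (h.le_iff hx ha).1 (hb ▸ hy)⟩, rfl⟩)

/-- Since I is dense, a maximal disjoint family F of homogeneous elements can be taken inside I. An
automorphism of I is given by the images of the members of F and its restrictions below them.
Comparing F with F₀ makes the bound uniform in I. -/
theorem mk_isAut_le [Infinite A] {F₀ : Set A} (hF₀ : MaxDisj F₀) (I : Order.Ideal A) :
    #{f : A →. A // IsAut f I} ≤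
      #(Order.Ideal A) * (prod fun a : F₀ => #(Subring a.1)) ^ 7 := by
  rcases isEmpty_or_nonempty {f : A →. A // IsAut f I} with he | ⟨⟨f0, hf0⟩⟩
  · rw [mk_eq_zero]; exact zero_le
  obtain ⟨F, hF, hFP⟩ := exists_maxDisj (A := A) (P := fun y => Homog y ∧ y ∈ I) (by
    intro x hx
    obtain ⟨y, hy, hy0, hyx⟩ := hf0.dense x hx
    obtain ⟨z, hz, hz0, hzh⟩ := exists_homog hy0
    exact ⟨z, hz.trans hyx, hz0, hzh, ideal_mem_of_le hz hy⟩)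
  let W := {w : F → A // (∀ i, w i ≠ ⊥) ∧ (∀ i j, i ≠ j → w i ⊓ w j = ⊥) ∧
      ∀ x, x ≠ ⊥ → ∃ i, x ⊓ w i ≠ ⊥}
  have hW : ∀ f : {f : A →. A // IsAut f I}, (∀ a : F, val f.1 a.1 ≠ ⊥) ∧
      (∀ a b : F, a ≠ b → val f.1 a.1 ⊓ val f.1 b.1 = ⊥) ∧
      ∀ x, x ≠ ⊥ → ∃ a : F, x ⊓ val f.1 a.1 ≠ ⊥ := by
    rintro ⟨f, hf⟩
    refine ⟨fun a h => hF.ne_bot _ a.2 (hf.eq_bot _ (hFP _ a.2).2 h), fun a b hab => ?_, ?_⟩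
    · change val f a.1 ⊓ val f b.1 = ⊥
      rw [← hf.hom.val_inf (hFP _ a.2).2 (hFP _ b.2).2,
        hF.disj _ a.2 _ b.2 (fun h => hab (Subtype.ext h)), hf.hom.val_bot]
    · intro x hx
      obtain ⟨y, hy, hy0, hyx⟩ := hf.dense x hx
      obtain ⟨z, hz, rfl⟩ := hf.hom.exists_val hy
      have hz0 : z ≠ ⊥ := by rintro rfl; exact hy0 hf.hom.val_bot
      obtain ⟨a, ha, hza⟩ := hF.meets z hz0
      refine ⟨⟨a, ha⟩, fun h => hza ?_⟩
      apply hf.eq_bot _ (ideal_mem_of_le inf_le_left hz)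
      rw [hf.hom.val_inf hz (hFP a ha).2]
      exact le_bot_iff.1 ((inf_le_inf_right _ hyx).trans h.le)
  refine (mk_le_mk_mul_of_mk_preimage_le (β := W)
    (c := (prod fun a : F₀ => #(Subring a.1)) ^ 7)
    (fun f => ⟨fun a => val f.1 a.1, hW f⟩) ?_).trans
      (mul_le_mul' (mk_partitions_le hF.two_power_le) le_rfl)
  intro w
  have h1 : #((fun f : {f : A →. A // IsAut f I} => (⟨fun a => val f.1 a.1, hW f⟩ : W)) ⁻¹' {w}) ≤
      #(∀ a : F, Set.Iic a.1 ≃o Set.Iic (w.1 a)) := by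
    have hv : ∀ f : ((fun f : {f : A →. A // IsAut f I} =>
        (⟨fun a => val f.1 a.1, hW f⟩ : W)) ⁻¹' {w}), ∀ a : F, val f.1.1 a.1 = w.1 a := fun f a =>
      congrFun (congrArg Subtype.val (show (⟨fun a => val f.1.1 a.1, hW f.1⟩ : W) = w from f.2)) a
    refine Cardinal.mk_le_of_injective
      (f := fun f a => f.1.2.restrict (hFP _ a.2).2 (hv f a)) fun f g h => ?_
    apply Subtype.ext
    apply Subtype.ext
    refine f.1.2.eq_of_val_eq g.1.2 hF fun a ha x hx => ?_
    have h2 := congrFun h ⟨a, ha⟩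
    have h3 := congrArg (fun k : Set.Iic a ≃o Set.Iic (w.1 ⟨a, ha⟩) => (k ⟨x, hx⟩).1) h2
    exact h3
  refine h1.trans ?_
  rw [mk_pi]
  have h7 : ∀ c : Cardinal.{u}, c ^ 7 = c ^ (7 : Cardinal.{u}) := fun c => by
    rw [← Cardinal.power_natCast]; rfl
  calc (prod fun a : F => #(Set.Iic a.1 ≃o Set.Iic (w.1 a)))
      ≤ prod fun a : F => #(Subring a.1) ^ (7 : Cardinal.{u}) :=
        prod_le_prod _ _ fun a => (h7 _) ▸ mk_orderIso_le_of_nonempty _ _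
    _ = (prod fun a : F => #(Subring a.1)) ^ (7 : Cardinal.{u}) := prod_power _ _
    _ ≤ (prod fun a : F₀ => #(Subring a.1)) ^ (7 : Cardinal.{u}) :=
        power_le_power_right (hF₀.prod_subring_le hF fun a ha => (hFP a ha).1)
    _ = _ := (h7 _).symm

/-- The number of automorphisms of dense ideals to the power `ℵ₀` is at most the number of
subalgebras. -/
theorem mk_aut₃_power_le_sub [Infinite A] : #(Aut₃ A) ^ ℵ₀ ≤ #(BooleanSubalgebra A) := by
  have hinf := aleph0_le_sub (A := A)
  obtain ⟨F₀, hF₀, hh⟩ := exists_maxDisj (A := A) (P := Homog) fun x hx => exists_homog hx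
  have hq := hF₀.prod_subring_power_le hh
  obtain ⟨q, hqd⟩ : ∃ q, q = prod fun a : F₀ => #(Subring a.1) := ⟨_, rfl⟩
  have hc := fun I => mk_isAut_le hF₀ (A := A) I
  rw [← hqd] at hq
  simp only [← hqd] at hc
  have h1 : #(Aut₃ A) ≤ #(Order.Ideal A) * (#(Order.Ideal A) * q ^ 7) := by
    have hI : ∀ f : Aut₃ A, ∃ I, IsAut f.1 I := fun f => mem_aut₃_iff.1 f.2
    choose I hI using hI
    refine mk_le_mk_mul_of_mk_preimage_le I fun J => le_trans ?_ (hc J)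
    exact Cardinal.mk_le_of_injective (f := fun f => ⟨f.1.1, 
      (congrArg (IsAut f.1.1) (show I f.1 = J from f.2)).mp (hI f.1)⟩)
      fun f g h => Subtype.ext (Subtype.ext (Subtype.mk.inj h))
  have hmul := mul_eq_self hinf
  have hid := mk_ideal_power_le_sub (A := A)
  calc #(Aut₃ A) ^ ℵ₀ ≤ (#(Order.Ideal A) * (#(Order.Ideal A) * q ^ 7)) ^ ℵ₀ :=
        power_le_power_right h1
    _ = #(Order.Ideal A) ^ ℵ₀ * (#(Order.Ideal A) ^ ℵ₀ * (q ^ ℵ₀) ^ 7) := by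
        rw [mul_power, mul_power]
        congr 2
        rw [← Cardinal.power_natCast, ← Cardinal.power_natCast, ← power_mul, ← power_mul, mul_comm]
    _ ≤ #(BooleanSubalgebra A) * (#(BooleanSubalgebra A) * #(BooleanSubalgebra A) ^ 7) :=
        mul_le_mul' hid (mul_le_mul' hid (pow_le_pow_left₀ zero_le hq 7))
    _ ≤ #(BooleanSubalgebra A) := by
        have : #(BooleanSubalgebra A) ^ 7 ≤ #(BooleanSubalgebra A) := by
          exact power_nat_le hinf
        exact (mul_le_mul' le_rfl ((mul_le_mul' le_rfl this).trans hmul.le)).trans hmul.le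

end AutomorphismsOfIdeals

end ShelahBA
namespace ShelahBA

/-! ### Homomorphisms of ideals through automorphisms of dense ideals -/

section Factorization

variable {A : Type u} [BooleanAlgebra A]

/-- The ideal of elements disjoint from an ideal. -/
def perp (J : Order.Ideal A) : Order.Ideal A :=
  mkIdeal {z | ∀ y ∈ J, z ⊓ y = ⊥} (fun _ _ => bot_inf_eq _)
    (fun _ _ h hx y hy => le_bot_iff.1 ((inf_le_inf_right _ h).trans (hx y hy).le))
    (fun _ _ hx hx' y hy => by rw [inf_sup_right, hx y hy, hx' y hy, sup_idem])

/-- The dense ideal generated by an ideal and its complement. -/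
def withPerp (J : Order.Ideal A) : Order.Ideal A :=
  mkIdeal {z | ∃ y ∈ J, ∃ k ∈ perp J, z = y ⊔ k} ⟨⊥, J.bot_mem, ⊥, (perp J).bot_mem, by simp⟩
    (by
      rintro _ z hz ⟨y, hy, k, hk, rfl⟩
      refine ⟨z ⊓ y, ideal_mem_of_le inf_le_right hy, z ⊓ k, ideal_mem_of_le inf_le_right hk, ?_⟩
      rw [← inf_sup_left, inf_eq_left.2 hz])
    (by
      rintro _ _ ⟨y, hy, k, hk, rfl⟩ ⟨y', hy', k', hk', rfl⟩
      exact ⟨y ⊔ y', Order.Ideal.sup_mem hy hy', k ⊔ k', Order.Ideal.sup_mem hk hk',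
        sup_sup_sup_comm _ _ _ _⟩)

theorem exists_mem_or_perp (J : Order.Ideal A) {x : A} (hx : x ≠ ⊥) :
    ∃ y ≤ x, y ≠ ⊥ ∧ (y ∈ J ∨ y ∈ perp J) := by
  by_cases h : ∃ y ∈ J, x ⊓ y ≠ ⊥
  · obtain ⟨y, hy, hne⟩ := h
    exact ⟨x ⊓ y, inf_le_left, hne, Or.inl (ideal_mem_of_le inf_le_right hy)⟩
  · push Not at h
    exact ⟨x, le_rfl, hx, Or.inr h⟩

theorem dense_withPerp (J : Order.Ideal A) : DenseIdeal (withPerp J) := by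
  intro x hx
  obtain ⟨y, hyx, hy0, h | h⟩ := exists_mem_or_perp J hx
  · exact ⟨y, ⟨y, h, ⊥, (perp J).bot_mem, by simp⟩, hy0, hyx⟩
  · exact ⟨y, ⟨⊥, J.bot_mem, y, h, by simp⟩, hy0, hyx⟩

theorem IsHomOnto.val_le_of_kernel {f g : A →. A} {I J K : Order.Ideal A} (hf : IsHomOnto f I J)
    (hg : IsHomOnto g I K) (hk : ∀ x ∈ I, val f x = ⊥ → val g x = ⊥) {x y : A} (hx : x ∈ I)
    (hy : y ∈ I) (h : val f x ≤ val f y) : val g x ≤ val g y := by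
  have hxy : x \ y ∈ I := ideal_mem_of_le sdiff_le hx
  have hxy' : x ⊓ y ∈ I := ideal_mem_of_le inf_le_left hx
  have h1 : val f (x \ y) ⊓ val f y = ⊥ := by
    rw [← hf.val_inf hxy hy, inf_comm, inf_sdiff_self_right, hf.val_bot]
  have h2 : val f (x \ y) = ⊥ :=
    le_bot_iff.1 (h1 ▸ le_inf le_rfl ((hf.val_mono hx sdiff_le).trans h))
  have h3 : val g x = val g (x ⊓ y) ⊔ val g (x \ y) := by
    rw [← hg.val_sup hxy' hxy, sup_inf_sdiff]
  rw [h3, hk _ hxy h2, sup_bot_eq]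
  exact hg.val_mono hy inf_le_right

open Classical in
/-- The automorphism of `J + J^⊥` that maps `f₀ x ⊔ k` to `f x ⊔ k`. -/
noncomputable def twist (f₀ f : A →. A) (I J : Order.Ideal A) (z : A) : A :=
  if h : ∃ p : A × A, p.1 ∈ I ∧ p.2 ∈ perp J ∧ z = val f₀ p.1 ⊔ p.2 then
    val f h.choose.1 ⊔ h.choose.2 else ⊥

theorem le_of_sup_le_sup_perp {J : Order.Ideal A} {y y' k k' : A} (hy : y ∈ J) (hy' : y' ∈ J)
    (hk : k ∈ perp J) (hk' : k' ∈ perp J) (h : y ⊔ k ≤ y' ⊔ k') : y ≤ y' ∧ k ≤ k' := by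
  constructor
  · refine Disjoint.left_le_of_le_sup_right (c := k') (le_sup_left.trans h) ?_
    rw [disjoint_iff, inf_comm]; exact hk' y hy
  · refine Disjoint.left_le_of_le_sup_left (c := y') (le_sup_right.trans h) ?_
    rw [disjoint_iff]; exact hk y' hy'

theorem twist_apply {f₀ f : A →. A} {I J : Order.Ideal A} (h₀ : IsHomOnto f₀ I J)
    (h : IsHomOnto f I J) (hk : ∀ x ∈ I, val f₀ x = ⊥ → val f x = ⊥) {x k : A} (hx : x ∈ I)
    (hkJ : k ∈ perp J) : twist f₀ f I J (val f₀ x ⊔ k) = val f x ⊔ k := by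
  have hex : ∃ p : A × A, p.1 ∈ I ∧ p.2 ∈ perp J ∧ val f₀ x ⊔ k = val f₀ p.1 ⊔ p.2 :=
    ⟨(x, k), hx, hkJ, rfl⟩
  obtain ⟨h1, h2, h3⟩ := hex.choose_spec
  rw [twist, dif_pos hex]
  obtain ⟨a1, a2⟩ := le_of_sup_le_sup_perp (h₀.val_mem hx) (h₀.val_mem h1) hkJ h2 h3.le
  obtain ⟨b1, b2⟩ := le_of_sup_le_sup_perp (h₀.val_mem h1) (h₀.val_mem hx) h2 hkJ h3.ge
  rw [le_antisymm b2 a2, le_antisymm (h₀.val_le_of_kernel h hk h1 hx b1)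
    (h₀.val_le_of_kernel h hk hx h1 a1)]

theorem sup_inf_sup_perp {J : Order.Ideal A} {y y' k k' : A} (hy : y ∈ J) (hy' : y' ∈ J)
    (hk : k ∈ perp J) (hk' : k' ∈ perp J) : (y ⊔ k) ⊓ (y' ⊔ k') = (y ⊓ y') ⊔ (k ⊓ k') := by
  rw [inf_sup_left, inf_sup_right, inf_sup_right, hk y' hy', inf_comm y k', hk' y hy]
  simp

/-- Equality of the kernels makes the induced map f₀ x ↦ f x of J well defined and injective; adding
the identity on J^⊥ makes the domain dense. -/
theorem isAut_twist {f₀ f : A →. A} {I J : Order.Ideal A} (h₀ : IsHomOnto f₀ I J)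
    (h : IsHomOnto f I J) (hk : ∀ x ∈ I, val f₀ x = ⊥ ↔ val f x = ⊥) :
    IsAut (ofFun (twist f₀ f I J) (withPerp J)) (withPerp J) := by
  have hrep : ∀ z ∈ withPerp J, ∃ x ∈ I, ∃ k ∈ perp J, z = val f₀ x ⊔ k := by
    rintro z ⟨y, hy, k, hkJ, rfl⟩
    obtain ⟨x, hx, rfl⟩ := h₀.exists_val hy
    exact ⟨x, hx, k, hkJ, rfl⟩
  have hspec : ∀ x ∈ I, ∀ k ∈ perp J, twist f₀ f I J (val f₀ x ⊔ k) = val f x ⊔ k :=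
    fun x hx k hkJ => twist_apply h₀ h (fun x hx => (hk x hx).1) hx hkJ
  have h0 : twist f₀ f I J ⊥ = ⊥ := by
    have := hspec ⊥ I.bot_mem ⊥ (perp J).bot_mem
    rwa [h₀.val_bot, h.val_bot, sup_idem] at this
  refine ⟨dense_withPerp J, isHomOnto_ofFun ?_ ?_ h0 ?_ ?_, ?_⟩
  · intro z hz
    obtain ⟨x, hx, k, hkJ, rfl⟩ := hrep z hz
    rw [hspec x hx k hkJ]
    exact ⟨_, h.val_mem hx, k, hkJ, rfl⟩
  · rintro _ ⟨y, hy, k, hkJ, rfl⟩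
    obtain ⟨x, hx, rfl⟩ := h.exists_val hy
    exact ⟨_, ⟨_, h₀.val_mem hx, k, hkJ, rfl⟩, hspec x hx k hkJ⟩
  · intro z hz z' hz'
    obtain ⟨x, hx, k, hkJ, rfl⟩ := hrep z hz
    obtain ⟨x', hx', k', hkJ', rfl⟩ := hrep z' hz'
    rw [sup_sup_sup_comm, ← h₀.val_sup hx hx', hspec _ (Order.Ideal.sup_mem hx hx') _
      (Order.Ideal.sup_mem hkJ hkJ'), hspec x hx k hkJ, hspec x' hx' k' hkJ', h.val_sup hx hx',
      sup_sup_sup_comm]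
  · intro z hz z' hz'
    obtain ⟨x, hx, k, hkJ, rfl⟩ := hrep z hz
    obtain ⟨x', hx', k', hkJ', rfl⟩ := hrep z' hz'
    rw [sup_inf_sup_perp (h₀.val_mem hx) (h₀.val_mem hx') hkJ hkJ', ← h₀.val_inf hx hx',
      hspec _ (ideal_mem_of_le inf_le_left hx) _ (ideal_mem_of_le inf_le_left hkJ),
      hspec x hx k hkJ, hspec x' hx' k' hkJ', h.val_inf hx hx',
      sup_inf_sup_perp (h.val_mem hx) (h.val_mem hx') hkJ hkJ']
  · intro z hz hz0
    rw [val_ofFun hz] at hz0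
    obtain ⟨x, hx, k, hkJ, rfl⟩ := hrep z hz
    rw [hspec x hx k hkJ, sup_eq_bot_iff] at hz0
    rw [(hk x hx).2 hz0.1, hz0.2, sup_idem]

/-- The kernel of a homomorphism of ideals. -/
def IsHomOnto.ker {f : A →. A} {I J : Order.Ideal A} (h : IsHomOnto f I J) : Order.Ideal A :=
  mkIdeal {x | x ∈ I ∧ val f x = ⊥} ⟨I.bot_mem, h.val_bot⟩
    (fun _ _ hyx hx => ⟨ideal_mem_of_le hyx hx.1, le_bot_iff.1 (hx.2 ▸ h.val_mono hx.1 hyx)⟩)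
    (fun _ _ hx hy => ⟨Order.Ideal.sup_mem hx.1 hy.1, by
      rw [h.val_sup hx.1 hy.1, hx.2, hy.2, sup_idem]⟩)

/-- The three ideal factors are domain, range and kernel. Among maps sharing these, fix one f₀; any
other f is recovered from the twist of f₀ to f, evaluated at f₀ x. -/
theorem mk_end₆_le : #(End₆ A) ≤
    #(Order.Ideal A) * #(Order.Ideal A) * #(Order.Ideal A) * #(Aut₃ A) := by
  have hIJ : ∀ f : End₆ A, ∃ I J, IsHomOnto f.1 I J := fun f => f.2
  choose I J h using hIJ
  let T := (Order.Ideal A × Order.Ideal A) × Order.Ideal A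
  have hT : #T = #(Order.Ideal A) * #(Order.Ideal A) * #(Order.Ideal A) := by
    simp only [T, mk_prod, lift_id]
  rw [← hT]
  refine mk_le_mk_mul_of_mk_preimage_le (β := T) (fun f => ((I f, J f), (h f).ker)) ?_
  rintro ⟨⟨I', J'⟩, K'⟩
  have hp : ∀ f : ((fun f => ((I f, J f), (h f).ker) : End₆ A → T) ⁻¹' {((I', J'), K')}),
      IsHomOnto f.1.1 I' J' ∧ ∀ x ∈ I', (val f.1.1 x = ⊥ ↔ x ∈ K') := by
    rintro ⟨f, hf⟩
    have hf : ((I f, J f), (h f).ker) = ((I', J'), K') := hf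
    obtain ⟨h1, rfl⟩ := Prod.mk.inj hf
    obtain ⟨rfl, rfl⟩ := Prod.mk.inj h1
    exact ⟨h f, fun x hx => ⟨fun h0 => ⟨hx, h0⟩, fun h0 => h0.2⟩⟩
  rcases isEmpty_or_nonempty
    ((fun f => ((I f, J f), (h f).ker) : End₆ A → T) ⁻¹' {((I', J'), K')}) with he | ⟨⟨f₀⟩⟩
  · rw [mk_eq_zero]; exact zero_le
  have hk := fun f => fun x hx => ((hp f₀).2 x hx).trans ((hp f).2 x hx).symm
  refine Cardinal.mk_le_of_injective (f := fun f => ⟨_, mem_aut₃_iff.2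
    ⟨_, isAut_twist (hp f₀).1 (hp f).1 (hk f)⟩⟩) ?_
  intro f g hfg
  have hfg := Subtype.mk.inj hfg
  apply Subtype.ext
  apply Subtype.ext
  refine (hp f).1.ext (hp g).1 fun x hx => ?_
  have hmem : val f₀.1.1 x ⊔ ⊥ ∈ withPerp J' :=
    ⟨_, (hp f₀).1.val_mem hx, ⊥, (perp J').bot_mem, rfl⟩
  have h1 := congrArg (fun k => val k (val f₀.1.1 x ⊔ ⊥)) hfg
  simp only [val_ofFun hmem] at h1
  rw [twist_apply (hp f₀).1 (hp f).1 (fun x hx => (hk f x hx).1) hx (perp J').bot_mem,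
    twist_apply (hp f₀).1 (hp g).1 (fun x hx => (hk g x hx).1) hx (perp J').bot_mem] at h1
  simpa using h1

end Factorization

/-! ### Traces of clopen sets on a closed set -/

section Traces

variable {A : Type u} [BooleanAlgebra A]

/-- A subalgebra that separates the points of a closed set induces all traces of clopen sets. -/
theorem exists_same_trace {Z : Set (Pt A)} (hZ : IsCl Set.univ Z) {B : BooleanSubalgebra A}
    (hB : ∀ u ∈ Z, ∀ v ∈ Z, u ≠ v → ∃ b ∈ B, u ∈ pts b ∧ v ∉ pts b) (y : A) :
    ∃ b ∈ B, ∀ z ∈ Z, (z ∈ pts b ↔ z ∈ pts y) := by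
  have hIZ : ∀ x : Pt A, (∀ i : A, Disjoint (pts i) Z → x ∉ pts i) → x ∈ Z := by
    intro x hx
    by_contra hn
    obtain ⟨a, ha, hd⟩ := hZ.2 x trivial hn
    exact hx a hd ha
  have hsup : ∀ i j : A, Disjoint (pts i) Z → Disjoint (pts j) Z → Disjoint (pts (i ⊔ j)) Z := by
    intro i j hi hj
    rw [Set.disjoint_left] at *
    intro x hx
    rcases mem_pts_sup.1 hx with h | h
    · exact hi h
    · exact hj h
  have hbot : Disjoint (pts (⊥ : A)) Z := Set.disjoint_left.2 fun x hx => absurd hx not_mem_pts_bot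
  -- Membership of y in this ideal is the claim: y is then covered, up to a part missing Z, by an
  -- element of B whose trace lies inside y. Otherwise there is a point u of y in Z outside all such
  -- elements.
  let I : Order.Ideal A := mkIdeal
    {x | ∃ b ∈ B, (∀ z ∈ Z, z ∈ pts b → z ∈ pts y) ∧ ∃ i, Disjoint (pts i) Z ∧ x ≤ b ⊔ i}
    ⟨⊥, BooleanSubalgebra.bot_mem, fun z _ hz => absurd hz not_mem_pts_bot, ⊥, hbot, bot_le⟩
    (fun _ _ h ⟨b, hb, h1, i, hi, h2⟩ => ⟨b, hb, h1, i, hi, h.trans h2⟩)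
    (fun _ _ ⟨b, hb, h1, i, hi, h2⟩ ⟨b', hb', h1', i', hi', h2'⟩ =>
      ⟨b ⊔ b', BooleanSubalgebra.sup_mem hb hb',
        fun z hz h => (mem_pts_sup.1 h).elim (h1 z hz) (h1' z hz), i ⊔ i', hsup _ _ hi hi',
        (sup_le_sup h2 h2').trans (sup_sup_sup_comm _ _ _ _).le⟩)
  by_cases hy : y ∈ I
  · obtain ⟨b, hb, h1, i, hi, h2⟩ := hy
    refine ⟨b, hb, fun z hz => ⟨h1 z hz, fun h => ?_⟩⟩
    rcases mem_pts_sup.1 (pts_mono h2 h) with h | h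
    · exact h
    · exact absurd hz (Set.disjoint_left.1 hi h)
  · exfalso
    obtain ⟨u, huy, hu⟩ := exists_pt_of_notMem hy
    have huZ : u ∈ Z := hIZ u fun i hi => hu i
      ⟨⊥, BooleanSubalgebra.bot_mem, fun z _ hz => absurd hz not_mem_pts_bot, i, hi, le_sup_right⟩
    -- If J is improper, some b ∈ B contains u and has trace inside y, contrary to the choice of u.
    -- If J is proper, there is a point v of Z outside y lying in every b ∈ B that contains u,
    -- against separation.
    let J : Order.Ideal A := mkIdeal
      {x | ∃ b ∈ B, u ∈ pts b ∧ ∃ i, Disjoint (pts i) Z ∧ x ≤ (bᶜ ⊔ i) ⊔ y}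
      ⟨⊤, BooleanSubalgebra.top_mem, mem_pts_top, ⊥, hbot, bot_le⟩
      (fun _ _ h ⟨b, hb, h1, i, hi, h2⟩ => ⟨b, hb, h1, i, hi, h.trans h2⟩)
      (fun _ _ ⟨b, hb, h1, i, hi, h2⟩ ⟨b', hb', h1', i', hi', h2'⟩ =>
        ⟨b ⊓ b', BooleanSubalgebra.inf_mem hb hb', mem_pts_inf.2 ⟨h1, h1'⟩, i ⊔ i',
          hsup _ _ hi hi', by
            rw [compl_inf, sup_sup_sup_comm]
            exact sup_le (h2.trans (sup_le_sup_right le_sup_left _))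
              (h2'.trans (sup_le_sup_right le_sup_right _))⟩)
    by_cases ht : ⊤ ∈ J
    · obtain ⟨b, hb, hub, i, hi, hle⟩ := ht
      refine hu b ⟨b, hb, fun z hz hzb => ?_, ⊥, hbot, le_sup_left⟩ hub
      have := pts_mono hle (mem_pts_top (x := z))
      rw [mem_pts_sup, mem_pts_sup, mem_pts_compl] at this
      rcases this with (h | h) | h
      · exact absurd hzb h
      · exact absurd hz (Set.disjoint_left.1 hi h)
      · exact h
    · obtain ⟨v, -, hv⟩ := exists_pt_of_notMem ht
      have hvZ : v ∈ Z := hIZ v fun i hi => hv i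
        ⟨⊤, BooleanSubalgebra.top_mem, mem_pts_top, i, hi, le_sup_right.trans le_sup_left⟩
      have hvy : v ∉ pts y :=
        hv y ⟨⊤, BooleanSubalgebra.top_mem, mem_pts_top, ⊥, hbot, le_sup_right⟩
      have huv : u ≠ v := fun h => hvy (h ▸ huy)
      obtain ⟨b, hb, hub, hvb⟩ := hB u huZ v hvZ huv
      exact hv bᶜ ⟨b, hb, hub, ⊥, hbot, le_sup_left.trans le_sup_left⟩ (mem_pts_compl.2 hvb)

/-- Traces of clopen sets on a closed set can be coded by finite sets of points. -/
theorem exists_trace_code {Z : Set (Pt A)} (hZ : IsCl Set.univ Z) :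
    ∃ s : A → Finset Z, ∀ y y', s y = s y' → ∀ z ∈ Z, (z ∈ pts y ↔ z ∈ pts y') := by
  classical
  rcases finite_or_infinite Z with hfin | hinf
  · have := Fintype.ofFinite Z
    refine ⟨fun y => Finset.univ.filter fun z => z.1 ∈ pts y, fun y y' h z hz => ?_⟩
    have := congrArg (fun t : Finset Z => (⟨z, hz⟩ : Z) ∈ t) h
    simpa using this
  · have hc : ∀ p : Z × Z, ∃ c : A, p.1 ≠ p.2 → p.1.1 ∈ pts c ∧ p.2.1 ∉ pts c := by
      rintro ⟨u, v⟩
      by_cases huv : u = v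
      · exact ⟨⊥, fun h => absurd huv h⟩
      · obtain ⟨c, h⟩ := exists_separating fun h => huv (Subtype.ext h)
        exact ⟨c, fun _ => h⟩
    choose c hc using hc
    -- One separating element for each pair of points of Z generates a subalgebra no larger than Z,
    -- hence no larger than the set of finite subsets of Z.
    let B := BooleanSubalgebra.closure (Set.range c)
    have hB : #B ≤ #(Finset Z) := by
      have hZω : ℵ₀ ≤ #Z := Cardinal.infinite_iff.1 hinf
      rw [mk_finset_of_infinite]
      refine (mk_closure_le _).trans (max_le (mk_range_le.trans ?_) hZω)
      rw [← mul_def, mul_eq_self hZω]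
    obtain ⟨⟨e, he⟩⟩ := Cardinal.le_def _ _ |>.1 hB
    have hex := exists_same_trace hZ (B := B) fun u hu v hv huv =>
      ⟨c (⟨u, hu⟩, ⟨v, hv⟩), BooleanSubalgebra.subset_closure ⟨_, rfl⟩,
        hc _ fun h => huv (congrArg Subtype.val h)⟩
    choose b hb htr using hex
    refine ⟨fun y => e ⟨b y, hb y⟩, fun y y' h z hz => ?_⟩
    have h1 : b y = b y' := congrArg Subtype.val (he h)
    rw [← htr y z hz, ← htr y' z hz, h1]

end Traces

end ShelahBA
namespace ShelahBA

/-! ### Atoms, dense ideals and the bound id(A) ≤ end₃(A) -/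

section Atoms

variable {A : Type u} [BooleanAlgebra A]

/-- The points that contain no atom. -/
def atomlessPts (A : Type u) [BooleanAlgebra A] : Set (Pt A) := {x | ∀ a, IsAtom a → x ∉ pts a}

theorem mem_pts_iff_atom_le {a y : A} (ha : IsAtom a) {x : Pt A} (hx : x ∈ pts a) :
    x ∈ pts y ↔ a ≤ y := by
  refine ⟨fun h => ?_, fun h => pts_mono h hx⟩
  have hxa : x ∈ pts (a ⊓ y) := mem_pts_inf.2 ⟨hx, h⟩
  rcases ha.le_iff.1 (inf_le_left : a ⊓ y ≤ a) with h0 | h0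
  · rw [h0] at hxa; exact absurd hxa not_mem_pts_bot
  · exact inf_eq_left.1 h0

theorem le_of_points_atoms {y y' : A} (h1 : ∀ x ∈ atomlessPts A, x ∈ pts y → x ∈ pts y')
    (h2 : ∀ a, IsAtom a → a ≤ y → a ≤ y') : y ≤ y' := by
  apply le_of_pts_subset
  intro x hx
  by_cases hxa : x ∈ atomlessPts A
  · exact h1 x hxa hx
  · have hxa : ¬ ∀ a, IsAtom a → x ∉ pts a := hxa
    push Not at hxa
    obtain ⟨a, ha, hxa⟩ := hxa
    exact (mem_pts_iff_atom_le ha hxa).2 (h2 a ha ((mem_pts_iff_atom_le ha hxa).1 hx))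

theorem eq_of_points_atoms {y y' : A} (h1 : ∀ x ∈ atomlessPts A, (x ∈ pts y ↔ x ∈ pts y'))
    (h2 : ∀ a, IsAtom a → (a ≤ y ↔ a ≤ y')) : y = y' :=
  le_antisymm (le_of_points_atoms (fun x hx => (h1 x hx).1) fun a ha => (h2 a ha).1)
    (le_of_points_atoms (fun x hx => (h1 x hx).2) fun a ha => (h2 a ha).2)

theorem isCl_atomlessPts_inter (b : A) : IsCl Set.univ (atomlessPts A ∩ pts b) := by
  refine ⟨Set.subset_univ _, fun z _ hz => ?_⟩
  by_cases hzb : z ∈ pts b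
  · have hza : ¬ ∀ a, IsAtom a → z ∉ pts a := fun h => hz ⟨h, hzb⟩
    push Not at hza
    obtain ⟨a, ha, hza⟩ := hza
    exact ⟨a, hza, Set.disjoint_left.2 fun w hw hw' => hw'.1 a ha hw⟩
  · exact ⟨bᶜ, mem_pts_compl.2 hzb, Set.disjoint_left.2 fun w hw hw' => mem_pts_compl.1 hw hw'.2⟩

theorem exists_avoiding_finite (S : Finset (Pt A)) {x : Pt A} (hx : x ∉ S) {c : A}
    (hc : x ∈ pts c) : ∃ d ≤ c, x ∈ pts d ∧ ∀ u ∈ S, u ∉ pts d := by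
  classical
  induction S using Finset.induction_on with
  | empty => exact ⟨c, le_rfl, hc, by simp⟩
  | insert v S _ ih =>
    rw [Finset.mem_insert, not_or] at hx
    obtain ⟨d, hd, hxd, hu⟩ := ih hx.2
    obtain ⟨e, hxe, hve⟩ := exists_separating hx.1
    refine ⟨d ⊓ e, inf_le_left.trans hd, mem_pts_inf.2 ⟨hxd, hxe⟩, fun u hu' => ?_⟩
    rw [mem_pts_inf]
    rcases Finset.mem_insert.1 hu' with rfl | h
    · exact fun h => hve h.2
    · exact fun h' => hu u h h'.1

theorem exists_atom_of_finite {c : A} (hc : c ≠ ⊥) (hf : (pts c).Finite) : ∃ a, IsAtom a ∧ a ≤ c := by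
  have hI : {y | y ≤ c ∧ y ≠ ⊥}.Finite := by
    refine Set.Finite.of_finite_image (hf.powerset.subset ?_) pts_injective.injOn
    rintro _ ⟨x, hx, rfl⟩
    exact pts_mono hx.1
  obtain ⟨a, ha⟩ := hI.exists_minimal ⟨c, le_rfl, hc⟩
  refine ⟨a, ⟨ha.prop.2, fun b hb => ?_⟩, ha.prop.1⟩
  by_contra hb0
  exact hb.not_ge (ha.le_of_le ⟨hb.le.trans ha.prop.1, hb0⟩ hb.le)

/-- An atom below c contains no point of S. If there is none, c has infinitely many points, and one
outside S can be separated from S. -/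
theorem exists_ne_bot_avoiding (S : Finset (Pt A)) (hS : ∀ u ∈ S, u ∈ atomlessPts A) {c : A}
    (hc : c ≠ ⊥) : ∃ d ≤ c, d ≠ ⊥ ∧ ∀ u ∈ S, u ∉ pts d := by
  by_cases h : ∃ a, IsAtom a ∧ a ≤ c
  · obtain ⟨a, ha, hac⟩ := h
    exact ⟨a, hac, ha.1, fun u hu => hS u hu a ha⟩
  · obtain ⟨x, hx, hxS⟩ : ∃ x ∈ pts c, x ∉ S := by
      by_contra hn
      push Not at hn
      exact h (exists_atom_of_finite hc (S.finite_toSet.subset hn))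
    obtain ⟨d, hd, hxd, hu⟩ := exists_avoiding_finite S hxS hx
    exact ⟨d, hd, fun h0 => not_mem_pts_bot (h0 ▸ hxd), hu⟩

/-- Dense ideals. -/
def Dense (A : Type u) [BooleanAlgebra A] : Type u := {I : Order.Ideal A // DenseIdeal I}

/-- An element below b is determined by the atoms below it and its trace on the points of b lying in
no atom; the trace is coded by a finite set of such points. The elements avoiding all these finite
sets form a dense ideal, from which the sets can be read off again. -/
theorem MaxDisj.prod_Iic_le_dense {G : Set A} (hG : MaxDisj G) :
    (prod fun b : G => #(Set.Iic b.1)) ≤ 2 ^ #{a : A // IsAtom a} * #(Dense A) := by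
  classical
  choose s hs using fun b : A => exists_trace_code (isCl_atomlessPts_inter b)
  have hpt : ∀ {b b' : A}, b ∈ G → b' ∈ G → ∀ {x : Pt A}, x ∈ pts b → x ∈ pts b' → b = b' := by
    intro b b' hb hb' x hx hx'
    by_contra hne
    exact Set.disjoint_left.1 (disjoint_pts_of_inf_eq_bot (hG.disj b hb b' hb' hne)) hx hx'
  let D : (∀ b : G, Set.Iic b.1) → Order.Ideal A := fun y =>
    mkIdeal {x | ∀ b : G, ∀ u ∈ s b.1 (y b).1, u.1 ∉ pts x} (fun b u _ => not_mem_pts_bot)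
      (fun _ _ h hx b u hu hu' => hx b u hu (pts_mono h hu'))
      (fun _ _ hx hy b u hu hu' => (mem_pts_sup.1 hu').elim (hx b u hu) (hy b u hu))
  have hlocal : ∀ y (b : G) (x : A), x ≤ b.1 →
      (∀ u ∈ (s b.1 (y b).1).map (Function.Embedding.subtype _), u ∉ pts x) → x ∈ D y := by
    intro y b x hxb hx b' u hu hux
    have hbb : b = b' := Subtype.ext (hpt b.2 b'.2 (pts_mono hxb hux) u.2.2)
    subst hbb
    exact hx u.1 (Finset.mem_map.2 ⟨u, hu, rfl⟩) hux
  have hdense : ∀ y, DenseIdeal (D y) := by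
    intro y x hx
    obtain ⟨b, hb, hxb⟩ := hG.meets x hx
    obtain ⟨d, hd, hd0, hu⟩ := exists_ne_bot_avoiding
      ((s b (y ⟨b, hb⟩).1).map (Function.Embedding.subtype _)) (by
        intro u hu
        obtain ⟨v, -, rfl⟩ := Finset.mem_map.1 hu
        exact v.2.1) hxb
    exact ⟨d, hlocal y ⟨b, hb⟩ d (hd.trans inf_le_right) hu, hd0, hd.trans inf_le_left⟩
  have hrec : ∀ y (b : G) (u : ↥(atomlessPts A ∩ pts b.1)),
      u ∈ s b.1 (y b).1 ↔ ∀ x ∈ D y, u.1 ∉ pts x := by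
    intro y b u
    refine ⟨fun hu x hx => hx b u hu, fun h => ?_⟩
    by_contra hu
    obtain ⟨d, hd, hud, hav⟩ := exists_avoiding_finite
      ((s b.1 (y b).1).map (Function.Embedding.subtype _)) (x := u.1) (by
        intro hm
        obtain ⟨v, hv, hvu⟩ := Finset.mem_map.1 hm
        exact hu ((Subtype.ext hvu : v = u) ▸ hv)) u.2.2
    exact h d (hlocal y b d hd hav) hud
  rw [← mk_pi, ← mk_set, ← lift_id #(Set _), ← lift_id #(Dense A), ← mk_prod]
  refine Cardinal.mk_le_of_injective
    (f := fun y => ({a | ∃ b : G, a.1 ≤ (y b).1}, (⟨D y, hdense y⟩ : Dense A))) ?_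
  intro y y' h
  obtain ⟨h1, h2⟩ := Prod.mk.inj h
  have h2 : D y = D y' := Subtype.mk.inj h2
  have hat : ∀ y y' : (∀ b : G, Set.Iic b.1),
      {a : {a : A // IsAtom a} | ∃ b : G, a.1 ≤ (y b).1} = {a | ∃ b : G, a.1 ≤ (y' b).1} →
      ∀ b : G, ∀ a, IsAtom a → a ≤ (y b).1 → a ≤ (y' b).1 := by
    intro y y' h b a ha hab
    have hm : (⟨a, ha⟩ : {a : A // IsAtom a}) ∈ {a : {a : A // IsAtom a} | ∃ b : G, a.1 ≤ (y' b).1} :=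
      h ▸ ⟨b, hab⟩
    obtain ⟨b', hb'⟩ := hm
    obtain ⟨x, hx⟩ := exists_pt ha.1
    have hbb : b = b' := Subtype.ext (hpt b.2 b'.2 (pts_mono (hab.trans (y b).2) hx)
      (pts_mono (hb'.trans (y' b').2) hx))
    exact hbb ▸ hb'
  funext b
  apply Subtype.ext
  have hsb : s b.1 (y b).1 = s b.1 (y' b).1 := by
    ext u
    rw [hrec y b u, hrec y' b u, h2]
  refine eq_of_points_atoms (fun x hx => ?_) fun a ha => ⟨hat y y' h1 b a ha, hat y' y h1.symm b a ha⟩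
  by_cases hxb : x ∈ pts b.1
  · exact hs b.1 _ _ hsb x ⟨hx, hxb⟩
  · exact ⟨fun h => absurd (pts_mono (y b).2 h) hxb, fun h => absurd (pts_mono (y' b).2 h) hxb⟩

theorem mk_dense_le : #(Dense A) ≤ #(End₃ A) := by
  have h : ∀ I : Order.Ideal A, IsHomOnto (ofFun id I) I I := fun I =>
    isHomOnto_ofFun (fun x hx => hx) (fun y hy => ⟨y, hy, rfl⟩) rfl (fun _ _ _ _ => rfl)
      fun _ _ _ _ => rfl
  refine Cardinal.mk_le_of_injective (f := fun I => ⟨ofFun id I.1, I.1, I.2, h I.1⟩) ?_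
  intro I J hIJ
  have h1 := congrArg PFun.Dom (Subtype.mk.inj hIJ)
  rw [(h I.1).dom_eq, (h J.1).dom_eq] at h1
  exact Subtype.ext (SetLike.coe_injective h1)

/-- Only finitely many members of G are needed to cover b, and the part of b in those belonging to I
is the element sought. -/
theorem exists_largest {I : Order.Ideal A} {G : Set A} (hG : ∀ g ∈ G, g ∈ I ∨ g ∈ perp I) {b : A}
    (hb : b ∈ spanOf (Subtype.val : G → A)) :
    ∃ y ≤ b, y ∈ I ∧ ∀ x ∈ I, x ≤ b → x ≤ y := by
  classical
  obtain ⟨s, hs⟩ := hb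
  refine ⟨(s.filter fun g => g.1 ∈ I).sup fun g => b ⊓ g.1, Finset.sup_le fun _ _ => inf_le_left,
    ?_, fun x hx hxb => ?_⟩
  · refine Finset.sup_induction I.bot_mem (fun _ h _ h' => Order.Ideal.sup_mem h h') fun g hg => ?_
    exact ideal_mem_of_le inf_le_right (Finset.mem_filter.1 hg).2
  · have hx' : x = s.sup fun g => x ⊓ g.1 := by
      rw [← Finset.sup_inf_distrib_left, inf_eq_left.2 (hxb.trans hs)]
    rw [hx']
    refine Finset.sup_le fun g hg => ?_
    rcases hG g.1 g.2 with h | h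
    · exact (inf_le_inf_right _ hxb).trans
        (Finset.le_sup (f := fun g : G => b ⊓ g.1) (Finset.mem_filter.2 ⟨hg, h⟩))
    · rw [inf_comm, h x hx]; exact bot_le

/-- Code I by the dense ideals I + I^⊥ and the span of a partition whose members lie in I or I^⊥.
For ideals with the same code, fix the partition of one of them; every such I has a largest element
below each of its members. These largest elements determine I inside I + I^⊥. -/
theorem mk_ideal_le_of_prod_le {c : Cardinal.{u}}
    (hc : ∀ G : Set A, MaxDisj G → (prod fun b : G => #(Set.Iic b.1)) ≤ c) :
    #(Order.Ideal A) ≤ #(Dense A) * #(Dense A) * c := by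
  classical
  choose G hG hGI using fun I : Order.Ideal A => exists_maxDisj (A := A)
    (P := fun y => y ∈ I ∨ y ∈ perp I) fun x hx => exists_mem_or_perp I hx
  have hd : ∀ I, DenseIdeal (spanOf (Subtype.val : G I → A)) := by
    intro I x hx
    obtain ⟨a, ha, h⟩ := (hG I).meets x hx
    exact ⟨x ⊓ a, ⟨{⟨a, ha⟩}, by simp⟩, h, inf_le_left⟩
  have hprod : #(Dense A × Dense A) = #(Dense A) * #(Dense A) := (mul_def _ _).symm
  rw [← hprod]
  let T : Order.Ideal A → Dense A × Dense A := fun I =>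
    (⟨withPerp I, dense_withPerp I⟩, ⟨_, hd I⟩)
  refine mk_le_mk_mul_of_mk_preimage_le T fun p => ?_
  rcases isEmpty_or_nonempty (T ⁻¹' {p}) with he | ⟨⟨I₀, hI₀⟩⟩
  · rw [mk_eq_zero]; exact zero_le
  have hI : ∀ I : T ⁻¹' {p}, withPerp I.1 = withPerp I₀ ∧
      spanOf (Subtype.val : G I.1 → A) = spanOf (Subtype.val : G I₀ → A) := by
    rintro ⟨I, hI⟩
    have h1 : T I = T I₀ := (show T I = p from hI).trans (show T I₀ = p from hI₀).symm
    obtain ⟨h2, h3⟩ := Prod.mk.inj h1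
    exact ⟨Subtype.mk.inj h2, Subtype.mk.inj h3⟩
  have hmem : ∀ b : G I₀, b.1 ∈ spanOf (Subtype.val : G I₀ → A) := fun b => ⟨{b}, by simp⟩
  have hy : ∀ (I : T ⁻¹' {p}) (b : G I₀), ∃ y ≤ b.1, y ∈ I.1 ∧ ∀ x ∈ I.1, x ≤ b.1 → x ≤ y := by
    intro I b
    apply exists_largest (hGI I.1)
    rw [(hI I).2]
    exact hmem b
  choose y hyb hyI hymax using hy
  refine le_trans ?_ (hc (G I₀) (hG I₀))
  rw [← mk_pi]
  refine Cardinal.mk_le_of_injective (f := fun I b => ⟨y I b, hyb I b⟩) ?_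
  have key : ∀ I J : T ⁻¹' {p}, (∀ b, y I b = y J b) → ∀ x ∈ I.1, x ∈ J.1 := by
    intro I J h x hx
    have hxw : x ∈ withPerp J.1 := by
      rw [(hI J).1, ← (hI I).1]
      exact ⟨x, hx, ⊥, (perp I.1).bot_mem, by simp⟩
    obtain ⟨j, hj, k, hk, rfl⟩ := hxw
    suffices hk0 : k = ⊥ by rw [hk0, sup_bot_eq]; exact hj
    by_contra hk0
    obtain ⟨b, hb, hkb⟩ := (hG I₀).meets k hk0
    apply hkb
    have h1 : k ⊓ b ≤ y I ⟨b, hb⟩ :=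
      hymax I ⟨b, hb⟩ _ (ideal_mem_of_le (inf_le_left.trans le_sup_right) hx) inf_le_right
    rw [h] at h1
    have h2 := hk _ (hyI J ⟨b, hb⟩)
    exact le_bot_iff.1 (h2 ▸ le_inf inf_le_left h1)
  intro I J h
  have h1 : ∀ b, y I b = y J b := fun b => congrArg Subtype.val (congrFun h b)
  exact Subtype.ext (SetLike.ext fun x => ⟨key I J h1 x, key J I (fun b => (h1 b).symm) x⟩)

/-- The dense ideal of elements with finitely many atoms below them. -/
def finAtomIdeal (A : Type u) [BooleanAlgebra A] : Order.Ideal A :=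
  mkIdeal {x | {a : {a : A // IsAtom a} | a.1 ≤ x}.Finite}
    ((Set.finite_empty).subset fun a ha => a.2.1 (le_bot_iff.1 ha))
    (fun _ _ h hx => hx.subset fun _ ha => le_trans ha h)
    (fun x y hx hy => (hx.union hy).subset fun a ha => by
      obtain ⟨z, hz⟩ := exists_pt a.2.1
      rcases mem_pts_sup.1 (pts_mono ha hz) with h | h
      · exact Or.inl ((mem_pts_iff_atom_le a.2 hz).1 h)
      · exact Or.inr ((mem_pts_iff_atom_le a.2 hz).1 h))

theorem dense_finAtomIdeal : DenseIdeal (finAtomIdeal A) := by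
  intro x hx
  by_cases h : ∃ a, IsAtom a ∧ a ≤ x
  · obtain ⟨a, ha, hax⟩ := h
    refine ⟨a, ?_, ha.1, hax⟩
    refine (Set.finite_singleton (⟨a, ha⟩ : {a : A // IsAtom a})).subset fun b hb => ?_
    exact Subtype.ext ((ha.le_iff.1 hb).resolve_left b.2.1)
  · push Not at h
    exact ⟨x, (Set.finite_empty).subset fun a ha => h a.1 a.2 ha, hx, le_rfl⟩

open Classical in
/-- The atoms below an element with finitely many atoms below it. -/
noncomputable def atomsBelow (x : A) : Finset {a : A // IsAtom a} :=
  if h : {a : {a : A // IsAtom a} | a.1 ≤ x}.Finite then h.toFinset else ∅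

theorem mem_atomsBelow {x : A} (hx : x ∈ finAtomIdeal A) {a : {a : A // IsAtom a}} :
    a ∈ atomsBelow x ↔ a.1 ≤ x := by
  have hx : {a : {a : A // IsAtom a} | a.1 ≤ x}.Finite := hx
  rw [atomsBelow, dif_pos hx, Set.Finite.mem_toFinset]
  exact Iff.rfl

/-- The map that permutes the atoms below an element. -/
noncomputable def permAtoms (π : Equiv.Perm {a : A // IsAtom a}) (x : A) : A :=
  (x \ (atomsBelow x).sup Subtype.val) ⊔ ((atomsBelow x).map π.toEmbedding).sup Subtype.val

theorem mem_pts_finset_sup {ι : Type*} {s : Finset ι} {f : ι → A} {x : Pt A} :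
    x ∈ pts (s.sup f) ↔ ∃ i ∈ s, x ∈ pts (f i) := by
  classical
  induction s using Finset.induction_on with
  | empty => simp
  | insert i s _ ih => simp [ih]

theorem atom_le_finset_sup {s : Finset {a : A // IsAtom a}} {a : {a : A // IsAtom a}} :
    a.1 ≤ s.sup Subtype.val ↔ a ∈ s := by
  obtain ⟨x, hx⟩ := exists_pt a.2.1
  rw [← mem_pts_iff_atom_le a.2 hx, mem_pts_finset_sup]
  constructor
  · rintro ⟨b, hb, hxb⟩
    have h1 := (mem_pts_iff_atom_le a.2 hx).1 hxb
    have h2 : a = b := Subtype.ext ((b.2.le_iff.1 h1).resolve_left a.2.1)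
    exact h2 ▸ hb
  · exact fun h => ⟨a, h, hx⟩

theorem mem_pts_permAtoms {π : Equiv.Perm {a : A // IsAtom a}} {x : A} {z : Pt A}
    (hz : z ∈ atomlessPts A) : z ∈ pts (permAtoms π x) ↔ z ∈ pts x := by
  have h : ∀ s : Finset {a : A // IsAtom a}, z ∉ pts (s.sup Subtype.val) := fun s hs => by
    obtain ⟨a, -, ha⟩ := mem_pts_finset_sup.1 hs
    exact hz a.1 a.2 ha
  rw [permAtoms, mem_pts_sup, mem_pts_sdiff]
  have h1 := h (atomsBelow x)
  have h2 := h ((atomsBelow x).map π.toEmbedding)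
  tauto

theorem le_permAtoms {π : Equiv.Perm {a : A // IsAtom a}} {x : A} (hx : x ∈ finAtomIdeal A)
    (a : {a : A // IsAtom a}) : a.1 ≤ permAtoms π x ↔ (π.symm a).1 ≤ x := by
  obtain ⟨z, hz⟩ := exists_pt a.2.1
  have h1 := fun y : A => mem_pts_iff_atom_le (y := y) a.2 hz
  rw [← h1, permAtoms, mem_pts_sup, mem_pts_sdiff, h1, h1, h1, atom_le_finset_sup,
    atom_le_finset_sup, mem_atomsBelow hx, Finset.mem_map_equiv, mem_atomsBelow hx]
  tauto

theorem permAtoms_mem {π : Equiv.Perm {a : A // IsAtom a}} {x : A} (hx : x ∈ finAtomIdeal A) :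
    permAtoms π x ∈ finAtomIdeal A := by
  refine ((atomsBelow x).map π.toEmbedding).finite_toSet.subset fun a ha => ?_
  have := (le_permAtoms hx a).1 ha
  rw [Finset.mem_coe, Finset.mem_map_equiv, mem_atomsBelow hx]
  exact this

theorem isHomOnto_permAtoms (π : Equiv.Perm {a : A // IsAtom a}) :
    IsHomOnto (ofFun (permAtoms π) (finAtomIdeal A)) (finAtomIdeal A) (finAtomIdeal A) := by
  have hinf : ∀ (a : {a : A // IsAtom a}) (x y : A), a.1 ≤ x ⊓ y ↔ a.1 ≤ x ∧ a.1 ≤ y :=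
    fun a x y => le_inf_iff
  have hsup : ∀ (a : {a : A // IsAtom a}) (x y : A), a.1 ≤ x ⊔ y ↔ a.1 ≤ x ∨ a.1 ≤ y := by
    intro a x y
    obtain ⟨z, hz⟩ := exists_pt a.2.1
    have h1 := fun y : A => mem_pts_iff_atom_le (y := y) a.2 hz
    rw [← h1, ← h1, ← h1, mem_pts_sup]
  refine isHomOnto_ofFun (fun x hx => permAtoms_mem hx)
    (fun y hy => ⟨permAtoms π.symm y, permAtoms_mem hy, ?_⟩) ?_ (fun x hx y hy => ?_)
    fun x hx y hy => ?_
  · refine eq_of_points_atoms (fun z hz => ?_) fun a ha => ?_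
    · rw [mem_pts_permAtoms hz, mem_pts_permAtoms hz]
    · rw [le_permAtoms (permAtoms_mem hy) ⟨a, ha⟩, le_permAtoms hy]
      simp
  · refine eq_of_points_atoms (fun z hz => mem_pts_permAtoms hz) fun a ha => ?_
    rw [le_permAtoms (finAtomIdeal A).bot_mem ⟨a, ha⟩, le_bot_iff, le_bot_iff]
    exact ⟨fun h => absurd h (π.symm ⟨a, ha⟩).2.1, fun h => absurd h ha.1⟩
  · refine eq_of_points_atoms (fun z hz => ?_) fun a ha => ?_
    · rw [mem_pts_sup, mem_pts_permAtoms hz, mem_pts_permAtoms hz, mem_pts_permAtoms hz,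
        mem_pts_sup]
    · rw [le_permAtoms (Order.Ideal.sup_mem hx hy) ⟨a, ha⟩, hsup, hsup ⟨a, ha⟩,
        le_permAtoms hx ⟨a, ha⟩, le_permAtoms hy ⟨a, ha⟩]
  · refine eq_of_points_atoms (fun z hz => ?_) fun a ha => ?_
    · rw [mem_pts_inf, mem_pts_permAtoms hz, mem_pts_permAtoms hz, mem_pts_permAtoms hz,
        mem_pts_inf]
    · rw [le_permAtoms (ideal_mem_of_le inf_le_left hx) ⟨a, ha⟩, hinf, hinf ⟨a, ha⟩,
        le_permAtoms hx ⟨a, ha⟩, le_permAtoms hy ⟨a, ha⟩]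

/-- Infinitely many atoms have 2 ^ #atoms permutations, which act faithfully on the dense ideal of
elements with finitely many atoms below them. The term ℵ₀ covers the case of finitely many atoms. -/
theorem two_power_atoms_le : 2 ^ #{a : A // IsAtom a} ≤ max #(End₃ A) ℵ₀ := by
  rcases finite_or_infinite {a : A // IsAtom a} with h | h
  · exact (power_lt_aleph0 (natCast_lt_aleph0 (n := 2)) (lt_aleph0_of_finite _)).le.trans
      (le_max_right _ _)
  · refine le_trans ?_ (le_max_left _ _)
    rw [← mk_perm_eq_two_power]
    refine Cardinal.mk_le_of_injective (f := fun π => ⟨ofFun (permAtoms π) (finAtomIdeal A),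
      finAtomIdeal A, dense_finAtomIdeal, isHomOnto_permAtoms π⟩) ?_
    intro π π' hππ
    have h1 := Subtype.mk.inj hππ
    have h2 : π.symm = π'.symm := by
      ext a : 1
      have hmem : (π.symm a).1 ∈ finAtomIdeal A := by
        refine (Set.finite_singleton (π.symm a)).subset fun b hb => ?_
        exact Subtype.ext (((π.symm a).2.le_iff.1 hb).resolve_left b.2.1)
      have h3 := congrArg (fun f => val f (π.symm a).1) h1
      simp only [val_ofFun hmem] at h3
      have h4 : a.1 ≤ permAtoms π (π.symm a).1 := (le_permAtoms hmem a).2 le_rfl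
      rw [h3, le_permAtoms hmem] at h4
      exact Subtype.ext (((π.symm a).2.le_iff.1 h4).resolve_left (π'.symm a).2.1).symm
    exact Equiv.symm_bijective.injective h2

theorem mk_ideal_le_end₃ [Infinite A] : #(Order.Ideal A) ≤ #(End₃ A) := by
  obtain ⟨m, hm⟩ : ∃ m, m = max #(End₃ A) ℵ₀ := ⟨_, rfl⟩
  have hmω : ℵ₀ ≤ m := hm ▸ le_max_right _ _
  have hdm : #(Dense A) ≤ m := mk_dense_le.trans (hm ▸ le_max_left _ _)
  have ham : 2 ^ #{a : A // IsAtom a} ≤ m := hm ▸ two_power_atoms_le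
  have hmm := mul_eq_self hmω
  have h1 : #(Order.Ideal A) ≤ m := by
    refine (mk_ideal_le_of_prod_le (c := m) fun G hG => ?_).trans ?_
    · exact hG.prod_Iic_le_dense.trans ((mul_le_mul' ham hdm).trans hmm.le)
    · exact (mul_le_mul' (mul_le_mul' hdm hdm) le_rfl).trans (by rw [hmm, hmm])
  -- The auxiliary ℵ₀ in m can be dropped, because id(A) is uncountable.
  have h2 : ℵ₀ < m := (cantor ℵ₀).trans_le ((continuum_le_mk_ideal (A := A)).trans h1)
  rcases max_choice #(End₃ A) ℵ₀ with h | h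
  · rwa [hm, h] at h1
  · rw [hm, h] at h2
    exact absurd h2 (lt_irrefl _)

/-- As id(A) is infinite, id³ · aut is absorbed by id + aut, while each summand is at most end₃. -/
theorem mk_end_eq [Infinite A] {E : Set (A →. A)} (h3 : End₃ A ⊆ E) (h6 : E ⊆ End₆ A) :
    #E = #(Order.Ideal A) + #(Aut₃ A) := by
  obtain ⟨m, hm⟩ : ∃ m, m = #(Order.Ideal A) + #(Aut₃ A) := ⟨_, rfl⟩
  have hidω : ℵ₀ < #(Order.Ideal A) := (cantor ℵ₀).trans_le (continuum_le_mk_ideal (A := A))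
  have hI : #(Order.Ideal A) ≤ m := by rw [hm]; exact self_le_add_right _ _
  have ha : #(Aut₃ A) ≤ m := by rw [hm]; exact self_le_add_left _ _
  have hmm := mul_eq_self (hidω.le.trans hI)
  rw [← hm]
  apply le_antisymm
  · refine (mk_le_mk_of_subset h6).trans (mk_end₆_le.trans ?_)
    exact (mul_le_mul' (mul_le_mul' (mul_le_mul' hI hI) hI) ha).trans (by rw [hmm, hmm, hmm])
  · refine le_trans ?_ (mk_le_mk_of_subset h3)
    have h1 := mk_ideal_le_end₃ (A := A)
    have h2 : #(Aut₃ A) ≤ #(End₃ A) := mk_le_mk_of_subset fun f hf => hf.1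
    rw [hm]
    exact add_le_of_le (hidω.le.trans h1) h1 h2

theorem mk_end_power_le_sub [Infinite A] {E : Set (A →. A)} (h6 : E ⊆ End₆ A) :
    #E ^ ℵ₀ ≤ #(BooleanSubalgebra A) := by
  have hidω : ℵ₀ < #(Order.Ideal A) := (cantor ℵ₀).trans_le (continuum_le_mk_ideal (A := A))
  refine (power_le_power_right (mk_le_mk_of_subset h6)).trans ?_
  rw [mk_end_eq (fun f ⟨I, _, h⟩ => ⟨I, I, h⟩) le_rfl, add_eq_max hidω.le]
  rcases max_choice #(Order.Ideal A) #(Aut₃ A) with h | h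
  · rw [h]; exact mk_ideal_power_le_sub
  · rw [h]; exact mk_aut₃_power_le_sub

theorem end₂_subset : End₂ A ⊆ End₆ A := by
  rintro _ ⟨g, hg, rfl⟩
  refine ⟨⊤, ⊤, ?_, ?_, ?_, ?_, ?_⟩
  · ext x; simp
  · ext y
    obtain ⟨x, rfl⟩ := hg y
    simp [PFun.ran]
  · simp
  · rintro x y a b ha hb
    simp only [PFun.coe_val, Part.mem_some_iff] at *
    rw [ha, hb, map_sup]
  · rintro x y a b ha hb
    simp only [PFun.coe_val, Part.mem_some_iff] at *
    rw [ha, hb, map_inf]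

end Atoms

end ShelahBA

theorem mainTheorem7 {A : Type*} [BooleanAlgebra A] [Infinite A] :
    (#(ShelahBA.End₃ A) = #(Order.Ideal A) + #(ShelahBA.Aut₃ A) ∧
      #(ShelahBA.End₄ A) = #(Order.Ideal A) + #(ShelahBA.Aut₃ A) ∧
      #(ShelahBA.End₅ A) = #(Order.Ideal A) + #(ShelahBA.Aut₃ A) ∧
      #(ShelahBA.End₆ A) = #(Order.Ideal A) + #(ShelahBA.Aut₃ A)) ∧
    #(ShelahBA.End₆ A) ^ ℵ₀ ≤ #(BooleanSubalgebra A) ∧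
    (#(ShelahBA.End₂ A) ^ ℵ₀ ≤ #(BooleanSubalgebra A) ∧
      #(ShelahBA.End₃ A) ^ ℵ₀ ≤ #(BooleanSubalgebra A) ∧
      #(ShelahBA.End₄ A) ^ ℵ₀ ≤ #(BooleanSubalgebra A) ∧
      #(ShelahBA.End₅ A) ^ ℵ₀ ≤ #(BooleanSubalgebra A) ∧
      #(ShelahBA.End₆ A) ^ ℵ₀ ≤ #(BooleanSubalgebra A)) := by
  have h36 : ShelahBA.End₃ A ⊆ ShelahBA.End₆ A := fun f ⟨I, _, h⟩ => ⟨I, I, h⟩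
  have h34 : ShelahBA.End₃ A ⊆ ShelahBA.End₄ A := fun f ⟨I, _, h⟩ => ⟨I, h⟩
  have h46 : ShelahBA.End₄ A ⊆ ShelahBA.End₆ A := fun f ⟨I, h⟩ => ⟨I, I, h⟩
  have h35 : ShelahBA.End₃ A ⊆ ShelahBA.End₅ A := fun f ⟨I, hd, h⟩ => ⟨I, I, hd, hd, h⟩
  have h56 : ShelahBA.End₅ A ⊆ ShelahBA.End₆ A := fun f ⟨I, J, _, _, h⟩ => ⟨I, J, h⟩
  exact ⟨⟨ShelahBA.mk_end_eq le_rfl h36, ShelahBA.mk_end_eq h34 h46, ShelahBA.mk_end_eq h35 h56,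
    ShelahBA.mk_end_eq h36 le_rfl⟩, ShelahBA.mk_end_power_le_sub le_rfl,
    ShelahBA.mk_end_power_le_sub ShelahBA.end₂_subset, ShelahBA.mk_end_power_le_sub h36,
    ShelahBA.mk_end_power_le_sub h46, ShelahBA.mk_end_power_le_sub h56,
    ShelahBA.mk_end_power_le_sub le_rfl⟩
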